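/- **Setting.** Fix $d\ge 2$, a finite set $I$ of players, and $\omega=e^{2\pi i/d}$. A *(single-round) game* on a multipartite scenario (sites, settings at each site, finitely many outcomes for each setting) is a finite convex combination $\sum \Phi_{U,A}\,(U,A)$, where the question $U$ gives at most one setting to each site and $A$ is a set of accepted joint outcomes of $U$; $p_S(e,\Phi)$ is the probability that the reply is accepted when the behaviour $e$ is used. A *nonlocal game with bound $\gamma$* is a game such that every non-contextual empirical model has success probability $\le\gamma$ and some quantum realised model has success probability $>\gamma$. The *Weyl operator* of $p=(p_1,p_2)\in\mathbb Z_d^2$ is $W(p)|j\rangle=\omega^{jp_2}|j+p_1\rangle$. Measuring it returns $q\in\mathbb Z_d$ according to the eigenvalue $\omega^q$ of $W(p)$ (of $e^{\pi i/d}W(p)$ if $d$ is even and $p_1,p_2$ are odd, in which case $W(p)^d=-1$). A *Weyl measurement game* $(\Phi,\psi,\gamma)$ is a game $\Phi$ on the scenario with sites $I$, settings $\mathbb Z_d^2$ and outcomes $\mathbb Z_d$, an $I$-qudit state $\psi$ and a real $\gamma$ such that all non-contextual models have success probability $\le\gamma$, whereas the model $e_\psi$ given by measuring $W(p_i)$ on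 qudit $i$ of $\psi$ has $p_S(e_\psi,\Phi)>\gamma$. Put $[p,p']=p_2p_1'-p_1p_2'$. A *rooted graph* $G=(V,E,r)$ is a finite connected graph with a root $r$, and $|G|=|V|$. Paths are non-repetitive lists of adjacent nodes $v_1=r,\dots,v_l$, and $\mathrm{rad}(G)$ is the least $K\ge1$ such that every node is the end of a path with at most $K$ nodes. A *path distribution* $u$ on $G$ is a probability distribution on paths, supported on paths with at most $\mathrm{rad}(G)$ nodes, whose end node is uniform on $V$. **Distributed game $\Phi_G$ (for a path distribution $u$).** Its sites are $I\times V$. The settings at $(i,r)$ are the $p\in\mathbb Z_d^2$ (outcome in $\mathbb Z_d$) and the neighbours $w$ of $r$ (outcome in $\mathbb Z_d^2$). The settings at $(i,v)$, $v\ne r$, are the pairs $(w,p)$ with $w$ a neighbour of $v$ and $p\in\mathbb Z_d^2$ (outcome in $\mathbb Z_d$) and the pairs $(w,w')$ of distinct neighbours of $v$ (outcome in $\mathbb Z_d^2$). Verifier draws $(U,A)$ from $\Phi$ and, independently for each $i\in I$, a path $v_{i1},\dots,v_{il_i}$ from $u$. Let $p_i$ be the setting of $i$ in $U$, and $p_i=(0,0)$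 if $i$ is not questioned in $U$. If $l_i=1$, then $(i,r)$ is asked $p_i$; otherwise $(i,r)$ is asked $v_{i2}$, each $(i,v_{ij})$ with $1<j<l_i$ is asked $(v_{i(j-1)},v_{i(j+1)})$, and $(i,v_{il_i})$ is asked $(v_{i(l_i-1)},p_i)$. From replies $p'_{ij}$ ($j<l_i$) and $q_i$ along the path one forms $q_i-[p_i,\sum_{j<l_i}p'_{ij}]$; Verifier accepts if these values, restricted to the players questioned in $U$, belong to $A$. **Circuits.** Classical and quantum circuit strategies for a game have one input and one output wire per site, the input being a setting or $\bullet$ (not questioned) and the output an outcome of that setting, respectively $\bullet$. Gates of classical circuits are probabilistic and may use a random seed. Quantum circuits act on qudits of dimension $d$ initialised in $|0\rangle$, by classically controlled unitaries and projective measurements. Depth is the largest number of gates on a path from an input (wire or initial qudit) to an output; the fan-in of a gate is its number of inputs, classical and quantum. A family of circuits is *shallow* if depth and fan-in are bounded. **Theorem.** Let $(\Phi,\psi,\gamma)$ be a Weyl measurement game and $(G_n)_{n\in\mathbb N}$ rooted graphs of uniformly bounded degree with $\mathrm{rad}(G_n)/|G_n|\to0$. Every $G_n$ has a path distribution, and for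 any choice of path distributions $u_n$, with $\Phi_{G_n}$ the resulting distributed games: 1. Each $\Phi_{G_n}$ is a nonlocal game with bound $\gamma$. 2. There is a shallow family of quantum circuit strategies $Q_n$ with $p_S(Q_n,\Phi_{G_n})=p_S(e_\psi,\Phi)>\gamma$ for all $n$. 3. For every shallow family of classical circuit strategies $C_n$ there are $\epsilon_n\in O(\mathrm{rad}(G_n)/|G_n|)$, so $\epsilon_n\to0$, with $p_S(C_n,\Phi_{G_n})\le\gamma+\epsilon_n$ for all $n$. -/

import Mathlib

noncomputable section

open scoped Classical

namespace ShallowGames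

/-! ## Multipartite scenarios, empirical models and single-round games -/

/-- A (finite) multipartite scenario: measurement sites, the settings available at each site, and
the outcomes of each setting. -/
structure Scenario where
  Site : Type
  Setting : Site → Type
  Outcome : (i : Site) → Setting i → Type
  [siteFintype : Fintype Site]
  [settingFintype : ∀ i, Fintype (Setting i)]
  [outcomeFintype : ∀ i x, Fintype (Outcome i x)]

attribute [instance] Scenario.siteFintype Scenario.settingFintype Scenario.outcomeFintype

/-- A context (joint measurement): every site receives at most one setting; `none` is the symbol
`•` for "no measurement". -/
abbrev Context (S : Scenario) : Type := (i : S.Site) → Option (S.Setting i)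

/-- A local section over `C`: a joint outcome for the measurements performed in `C`. -/
abbrev LocalSection (S : Scenario) (C : Context S) : Type :=
  (i : S.Site) → (x : S.Setting i) → C i = some x → S.Outcome i x

/-- A global section: an outcome for every measurement of the scenario. -/
abbrev GlobalSection (S : Scenario) : Type :=
  (i : S.Site) → (x : S.Setting i) → S.Outcome i x

/-- A family assigning to each context a weight function on its local sections. -/
abbrev Behaviour (S : Scenario) : Type := (C : Context S) → LocalSection S C → ℝ

/-- `C ⊆ C'` as sets of measurements. -/
def Context.Sub {S : Scenario} (C C' : Context S) : Prop :=
  ∀ i x, C i = some x → C' i = some x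

/-- Restriction of a local section to a smaller context. -/
def LocalSection.restrict {S : Scenario} {C C' : Context S} (h : Context.Sub C C')
    (s : LocalSection S C') : LocalSection S C :=
  fun i x hx => s i x (h i x hx)

/-- Restriction of a global section to a context. -/
def GlobalSection.restrict {S : Scenario} (g : GlobalSection S) (C : Context S) :
    LocalSection S C :=
  fun i x _ => g i x

/-- Probabilistic empirical models: a probability distribution on the joint outcomes of each
context, compatible with marginalisation (no-signalling). -/
structure EmpiricalModel (S : Scenario) where
  prob : Behaviour S
  isDist : ∀ C, prob C ∈ stdSimplex ℝ (LocalSection S C)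
  compat : ∀ (C C' : Context S) (h : Context.Sub C C') (s : LocalSection S C),
    prob C s = ∑ s' : LocalSection S C', if s'.restrict h = s then prob C' s' else 0

/-- An empirical model is non-contextual if it consists of the marginals of one probability
distribution on global sections. -/
def EmpiricalModel.NonContextual {S : Scenario} (e : EmpiricalModel S) : Prop :=
  ∃ m ∈ stdSimplex ℝ (GlobalSection S), ∀ (C : Context S) (s : LocalSection S C),
    e.prob C s = ∑ g : GlobalSection S, if g.restrict C = s then m g else 0

/-- A single-round game: a (formal) convex combination of pairs consisting of a context and an
accepting condition on its joint outcomes. -/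
structure Game (S : Scenario) where
  Index : Type
  [indexFintype : Fintype Index]
  weight : Index → ℝ
  weight_mem : weight ∈ stdSimplex ℝ Index
  ctx : Index → Context S
  acc : (k : Index) → Set (LocalSection S (ctx k))

attribute [instance] Game.indexFintype

/-- The success probability `p_S(B, Φ)`. -/
def successProb {S : Scenario} (B : Behaviour S) (Φ : Game S) : ℝ :=
  ∑ k, Φ.weight k * ∑ s : LocalSection S (Φ.ctx k), if s ∈ Φ.acc k then B (Φ.ctx k) s else 0

/-- `γ` bounds the success probability of every non-contextual model. -/
def ClassicalBound {S : Scenario} (Φ : Game S) (γ : ℝ) : Prop :=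
  ∀ e : EmpiricalModel S, e.NonContextual → successProb e.prob Φ ≤ γ

/-! ## Quantum realised models -/

/-- A pure state of a system with finite orthonormal basis `B`. -/
def IsState {B : Type} [Fintype B] (ψ : B → ℂ) : Prop := ∑ b, ‖ψ b‖ ^ 2 = 1

/-- A projective measurement with outcomes `α`. -/
def IsProjectiveMeasurement {α B : Type} [Fintype α] [Fintype B]
    (P : α → Matrix B B ℂ) : Prop :=
  (∀ o, IsStarProjection (P o)) ∧ ∑ o, P o = 1

/-- The operator applied at site `i` when the settings in `C` are measured with outcome `s`:
the projector of the outcome, or the identity if nothing is measured. -/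
def siteOp {S : Scenario} {H : S.Site → Type} [∀ i, Fintype (H i)]
    (π : (i : S.Site) → (x : S.Setting i) → S.Outcome i x → Matrix (H i) (H i) ℂ)
    (C : Context S) (s : LocalSection S C) (i : S.Site) : Matrix (H i) (H i) ℂ :=
  match h : C i with
  | none => 1
  | some x => π i x (s i x h)

/-- Born rule: `‖(⨂ᵢ siteOp i) ψ‖²`, where site `i` holds a system with orthonormal basis `H i`. -/
def quantumBehaviour (S : Scenario) {H : S.Site → Type} [∀ i, Fintype (H i)]
    (π : (i : S.Site) → (x : S.Setting i) → S.Outcome i x → Matrix (H i) (H i) ℂ)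
    (ψ : ((i : S.Site) → H i) → ℂ) : Behaviour S :=
  fun C s => ∑ b : (i : S.Site) → H i,
    ‖∑ b' : (i : S.Site) → H i, (∏ i, siteOp π C s i (b i) (b' i)) * ψ b'‖ ^ 2

/-- `Φ` is a nonlocal game with bound `γ`: some quantum realised model exceeds `γ`, which no
non-contextual model does. -/
def IsNonlocalGame {S : Scenario} (Φ : Game S) (γ : ℝ) : Prop :=
  ClassicalBound Φ γ ∧
  ∃ (H : S.Site → Type) (_ : ∀ i, Fintype (H i))
    (π : (i : S.Site) → (x : S.Setting i) → S.Outcome i x → Matrix (H i) (H i) ℂ)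
    (ψ : ((i : S.Site) → H i) → ℂ),
    (∀ i x, IsProjectiveMeasurement (π i x)) ∧ IsState ψ ∧
      γ < successProb (quantumBehaviour S π ψ) Φ

/-! ## Weyl measurements -/

section Weyl

variable (d : ℕ) [NeZero d]

/-- The Weyl operator `W(p₁, p₂) |j⟩ = ω ^ (j p₂) |j + p₁⟩`, `ω = exp (2πi/d)`. -/
def weyl (p : ZMod d × ZMod d) : Matrix (ZMod d) (ZMod d) ℂ :=
  fun k j => if k = j + p.1 then ZMod.stdAddChar (j * p.2) else 0

/-- The operator whose eigenvalues label the outcomes of the Weyl measurement. One has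
`W(p) ^ d = 1`, so that the eigenvalues of `W(p)` are among the `ω ^ q`, unless `d` is even and
`p₁`, `p₂` are both odd. In that case `W(p) ^ d = -1`, and `exp (πi/d) W(p)` takes its place; for
`d = 2` this is the Pauli operator `Y`. -/
def weylObs (p : ZMod d × ZMod d) : Matrix (ZMod d) (ZMod d) ℂ :=
  (if Even d ∧ Odd p.1.val ∧ Odd p.2.val then Complex.exp (Real.pi * Complex.I / d) else 1) •
    weyl d p

/-- The projector for outcome `q` of the Weyl measurement `p`: the spectral projector of
`weylObs d p` for the eigenvalue `ω ^ q`, written as a discrete Fourier average of powers. -/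
def weylProj (p : ZMod d × ZMod d) (q : ZMod d) : Matrix (ZMod d) (ZMod d) ℂ :=
  (d : ℂ)⁻¹ • ∑ k : ZMod d, ZMod.stdAddChar (-(q * k)) • weylObs d p ^ k.val

/-- The symplectic form with `W(p) W(p') = ω ^ [p, p'] W(p') W(p)`. -/
def bracket (p p' : ZMod d × ZMod d) : ZMod d := p.2 * p'.1 - p.1 * p'.2

/-- The scenario `(I, ℤ_d², ℤ_d)`. -/
abbrev weylScenario (I : Type) [Fintype I] : Scenario where
  Site := I
  Setting := fun _ => ZMod d × ZMod d
  Outcome := fun _ _ => ZMod d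

/-- The behaviour obtained by measuring `W(p)` on qudit `i` for each measurement `(i, p)`. -/
def weylBehaviour (I : Type) [Fintype I] (ψ : (I → ZMod d) → ℂ) :
    Behaviour (weylScenario d I) :=
  quantumBehaviour (weylScenario d I) (H := fun _ => ZMod d) (fun _ p q => weylProj d p q) ψ

/-- A Weyl measurement game `(Φ, ψ, γ)`: measuring Weyl operators on the `I`-qudit state `ψ` beats
the bound `γ` obeyed by all non-contextual models. -/
structure IsWeylGame {I : Type} [Fintype I] (Φ : Game (weylScenario d I))
    (ψ : (I → ZMod d) → ℂ) (γ : ℝ) : Prop where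
  state : IsState ψ
  bound : ClassicalBound Φ γ
  violation : γ < successProb (weylBehaviour d I ψ) Φ

end Weyl

/-! ## Rooted graphs -/

/-- A finite connected rooted graph. -/
structure RootedGraph where
  V : Type
  [vFintype : Fintype V]
  graph : SimpleGraph V
  connected : graph.Connected
  root : V

attribute [instance] RootedGraph.vFintype

/-- Non-repetitive paths `v₁ = root, …, v_l` (with the final node as first component). -/
abbrev RootedPath (G : RootedGraph) : Type := (v : G.V) × G.graph.Path G.root v

/-- The number `l` of nodes of a path. -/
def RootedPath.numNodes {G : RootedGraph} (P : RootedPath G) : ℕ := P.2.1.length + 1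

/-- The radius: the least `K ≥ 1` such that every node is reached from the root by a path with at
most `K` nodes. -/
def RootedGraph.rad (G : RootedGraph) : ℕ :=
  sInf {K : ℕ | 1 ≤ K ∧ ∀ v : G.V, ∃ P : RootedPath G, P.1 = v ∧ P.numNodes ≤ K}

/-- The number of nodes `|G|`. -/
def RootedGraph.size (G : RootedGraph) : ℕ := Fintype.card G.V

/-- A distribution on paths, supported on paths with at most `rad G` nodes, whose final node is
uniformly distributed. -/
structure PathDistribution (G : RootedGraph) where
  weight : RootedPath G → ℝ
  weight_mem : weight ∈ stdSimplex ℝ (RootedPath G)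
  numNodes_le : ∀ P, 0 < weight P → P.numNodes ≤ G.rad
  uniform : ∀ v : G.V, ∑ P : RootedPath G, (if P.1 = v then weight P else 0) = 1 / (G.size : ℝ)

/-! ## The distributed scenario and the distributed game -/

/-- Settings at a site `(i, v)`. At the root: a Weyl measurement `p` on qudit `i` of the state, or a
neighbour `w` (Bell measurement of qudit `i` and the qudit shared with `w`). Elsewhere: a neighbour
`w` with a Weyl measurement `p` (on the qudit shared with `w`), or two distinct neighbours (Bell
measurement of the qudits shared with them). -/
inductive DistSetting (G : RootedGraph) (d : ℕ) (v : G.V) : Type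
  | rootWeyl (hv : v = G.root) (p : ZMod d × ZMod d)
  | rootBell (hv : v = G.root) (w : G.V) (hw : G.graph.Adj v w)
  | weyl (hv : v ≠ G.root) (w : G.V) (hw : G.graph.Adj v w) (p : ZMod d × ZMod d)
  | bell (hv : v ≠ G.root) (w w' : G.V) (hw : G.graph.Adj v w) (hw' : G.graph.Adj v w')
      (hne : w ≠ w')

/-- Outcomes: `ℤ_d` for Weyl measurements, `ℤ_d²` for Bell measurements. -/
def DistOutcome {G : RootedGraph} {d : ℕ} {v : G.V} : DistSetting G d v → Type
  | .rootWeyl _ _ => ZMod d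
  | .rootBell _ _ _ => ZMod d × ZMod d
  | .weyl _ _ _ _ => ZMod d
  | .bell _ _ _ _ _ _ => ZMod d × ZMod d

instance {G : RootedGraph} {d : ℕ} [NeZero d] {v : G.V} (x : DistSetting G d v) :
    Fintype (DistOutcome x) := by
  cases x <;> (unfold DistOutcome; infer_instance)

/-- An injective code, used only to see that there are finitely many settings. -/
def DistSetting.code {G : RootedGraph} {d : ℕ} {v : G.V} : DistSetting G d v →
    ((ZMod d × ZMod d) ⊕ G.V) ⊕ ((G.V × (ZMod d × ZMod d)) ⊕ (G.V × G.V))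
  | .rootWeyl _ p => .inl (.inl p)
  | .rootBell _ w _ => .inl (.inr w)
  | .weyl _ w _ p => .inr (.inl (w, p))
  | .bell _ w w' _ _ _ => .inr (.inr (w, w'))

theorem DistSetting.code_injective {G : RootedGraph} {d : ℕ} {v : G.V} :
    Function.Injective (DistSetting.code (G := G) (d := d) (v := v)) := by
  intro x y h
  cases x <;> cases y <;> simp_all [DistSetting.code]

instance {G : RootedGraph} {d : ℕ} [NeZero d] {v : G.V} : Fintype (DistSetting G d v) :=
  Fintype.ofInjective _ DistSetting.code_injective

/-- The distributed scenario `T(I, G, d)`, with measurement sites `I × V`. -/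
abbrev distScenario (d : ℕ) [NeZero d] (I : Type) [Fintype I] (G : RootedGraph) : Scenario where
  Site := I × G.V
  Setting := fun a => DistSetting G d a.2
  Outcome := fun _ x => DistOutcome x

theorem RootedPath.getVert_idxOf {G : RootedGraph} (P : RootedPath G) {v : G.V}
    (hv : v ∈ P.2.1.support) : P.2.1.getVert (P.2.1.support.idxOf v) = v := by
  have h := List.idxOf_lt_length_iff.2 hv
  rw [← SimpleGraph.Walk.support_getElem_eq_getVert (h := h)]
  exact List.getElem_idxOf h

theorem RootedPath.idxOf_le {G : RootedGraph} (P : RootedPath G) {v : G.V}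
    (hv : v ∈ P.2.1.support) : P.2.1.support.idxOf v ≤ P.2.1.length := by
  have h := List.idxOf_lt_length_iff.2 hv
  rw [SimpleGraph.Walk.length_support] at h
  omega

theorem RootedPath.idxOf_eq_zero_iff {G : RootedGraph} (P : RootedPath G) {v : G.V}
    (hv : v ∈ P.2.1.support) : P.2.1.support.idxOf v = 0 ↔ v = G.root := by
  have h1 := P.getVert_idxOf hv
  constructor
  · intro h
    rw [h, SimpleGraph.Walk.getVert_zero] at h1
    exact h1.symm
  · intro h
    refine P.2.2.getVert_injOn (P.idxOf_le hv) (Nat.zero_le _) ?_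
    rw [h1, SimpleGraph.Walk.getVert_zero, h]

theorem RootedPath.adj_next {G : RootedGraph} (P : RootedPath G) {v : G.V}
    (hv : v ∈ P.2.1.support) (h : P.2.1.support.idxOf v < P.2.1.length) :
    G.graph.Adj v (P.2.1.getVert (P.2.1.support.idxOf v + 1)) := by
  have := P.2.1.adj_getVert_succ h
  rwa [P.getVert_idxOf hv] at this

theorem RootedPath.adj_prev {G : RootedGraph} (P : RootedPath G) {v : G.V}
    (hv : v ∈ P.2.1.support) (h : P.2.1.support.idxOf v ≠ 0) :
    G.graph.Adj v (P.2.1.getVert (P.2.1.support.idxOf v - 1)) := by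
  have hle := P.idxOf_le hv
  have := P.2.1.adj_getVert_succ (i := P.2.1.support.idxOf v - 1) (by omega)
  rw [Nat.sub_add_cancel (Nat.pos_of_ne_zero h), P.getVert_idxOf hv] at this
  exact this.symm

theorem RootedPath.prev_ne_next {G : RootedGraph} (P : RootedPath G) {v : G.V}
    (h : P.2.1.support.idxOf v < P.2.1.length) :
    P.2.1.getVert (P.2.1.support.idxOf v - 1) ≠ P.2.1.getVert (P.2.1.support.idxOf v + 1) := by
  intro he
  have h1 : P.2.1.support.idxOf v - 1 ≤ P.2.1.length := by omega
  have h2 : P.2.1.support.idxOf v + 1 ≤ P.2.1.length := by omega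
  have := P.2.2.getVert_injOn h1 h2 he
  omega

/-- The question put to player `(i, v)` if the Weyl setting `p` is to be measured by teleporting
qudit `i` along the path `v₁, …, v_l`. For `l = 1` the root is asked to measure `p`. For `l > 1` the
root is asked for the Bell measurement towards `v₂`, each intermediate `v_j` for the Bell
measurement of `(v_{j-1}, v_{j+1})`, and `v_l` is asked `(v_{l-1}, p)`. Players off the path are not
asked anything. -/
def RootedPath.question {G : RootedGraph} {d : ℕ} (P : RootedPath G) (p : ZMod d × ZMod d)
    (v : G.V) : Option (DistSetting G d v) :=
  if hv : v ∈ P.2.1.support then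
    if h0 : P.2.1.support.idxOf v = 0 then
      if hl : P.2.1.support.idxOf v < P.2.1.length then
        some (.rootBell ((P.idxOf_eq_zero_iff hv).1 h0)
          (P.2.1.getVert (P.2.1.support.idxOf v + 1)) (P.adj_next hv hl))
      else
        some (.rootWeyl ((P.idxOf_eq_zero_iff hv).1 h0) p)
    else
      if hl : P.2.1.support.idxOf v < P.2.1.length then
        some (.bell (fun h => h0 ((P.idxOf_eq_zero_iff hv).2 h))
          (P.2.1.getVert (P.2.1.support.idxOf v - 1)) (P.2.1.getVert (P.2.1.support.idxOf v + 1))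
          (P.adj_prev hv h0) (P.adj_next hv hl) (P.prev_ne_next hl))
      else
        some (.weyl (fun h => h0 ((P.idxOf_eq_zero_iff hv).2 h))
          (P.2.1.getVert (P.2.1.support.idxOf v - 1)) (P.adj_prev hv h0) p)
  else none

/-- What a site replies: `none` is `•`, and otherwise the reply is an outcome of some setting. -/
abbrev Reply (S : Scenario) (i : S.Site) : Type := Option ((x : S.Setting i) × S.Outcome i x)

/-- The replies corresponding to a local section. -/
def LocalSection.reply {S : Scenario} {C : Context S} (s : LocalSection S C) (i : S.Site) :
    Reply S i :=
  match h : C i with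
  | none => none
  | some x => some ⟨x, s i x h⟩

section DistributedGame

variable {d : ℕ} [NeZero d] {I : Type} [Fintype I] {G : RootedGraph}

/-- The outcome of a Bell measurement; `0` for any other reply. -/
def bellPart {a : I × G.V} : Reply (distScenario d I G) a → ZMod d × ZMod d
  | some ⟨.rootBell _ _ _, o⟩ => o
  | some ⟨.bell _ _ _ _ _ _, o⟩ => o
  | _ => 0

/-- The outcome of a Weyl measurement; `0` for any other reply. -/
def weylPart {a : I × G.V} : Reply (distScenario d I G) a → ZMod d
  | some ⟨.rootWeyl _ _, o⟩ => o
  | some ⟨.weyl _ _ _ _, o⟩ => o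
  | _ => 0

/-- The joint question for paths `P i` and Weyl settings `p i`. -/
def distContext (P : I → RootedPath G) (p : I → ZMod d × ZMod d) :
    Context (distScenario d I G) :=
  fun a => (P a.1).question (p a.1) a.2

/-- The corrected outcome `q - [p i, p'₁ + ⋯ + p'_{l-1}]`, where `q` is the reply of the last player
`(i, v_l)` and `p'_j` the reply of `(i, v_j)`, `j < l`. (All players `(i, v)` other than the latter
contribute `0` to the sum.) -/
def distOutcome (P : I → RootedPath G) (p : I → ZMod d × ZMod d)
    (s : LocalSection (distScenario d I G) (distContext P p)) (i : I) : ZMod d :=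
  weylPart (s.reply (i, (P i).1)) - bracket d (p i) (∑ v : G.V, bellPart (s.reply (i, v)))

/-- The distributed game `Φ_G`. Verifier draws a question and an accepting condition of `Φ` and,
independently for each `i`, a path from `u`, asks the joint question for these, and accepts if the
corrected outcomes, restricted to the measurements of the question of `Φ`, are accepted in `Φ`.
Players `i` that are not questioned in `Φ` are treated as if they had been asked for the trivial
measurement `W(0, 0) = 1`, the outcome of which is ignored. -/
def distributedGame (u : PathDistribution G) (Φ : Game (weylScenario d I)) :
    Game (distScenario d I G) where
  Index := (I → RootedPath G) × Φ.Index
  weight := fun k => (∏ i, u.weight (k.1 i)) * Φ.weight k.2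
  weight_mem := by
    refine ⟨fun k => mul_nonneg (Finset.prod_nonneg fun i _ => u.weight_mem.1 _)
      (Φ.weight_mem.1 _), ?_⟩
    rw [Fintype.sum_prod_type]
    simp only [← Finset.mul_sum, Φ.weight_mem.2, mul_one]
    rw [← Fintype.prod_sum (f := fun (_ : I) P => u.weight P)]
    simp [u.weight_mem.2]
  ctx := fun k => distContext k.1 fun i => (Φ.ctx k.2 i).getD 0
  acc := fun k => {s | (fun i _ _ => distOutcome k.1 (fun i => (Φ.ctx k.2 i).getD 0) s i) ∈
    Φ.acc k.2}

end DistributedGame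

/-! ## Circuits -/

/-- The graph of a circuit with classical input and output wires labelled by `Wire`, acting on a
register of qudits `Q`. A gate reads some classical nodes (input wires or results of other gates),
acts on some qudits, and produces a classical result. `time` is a schedule, which makes the graph
acyclic and orders the gates that act on the same qudit. -/
structure CircuitGraph (Wire Q : Type) where
  Gate : Type
  [gateFintype : Fintype Gate]
  time : Gate → ℕ
  reads : Gate → Finset (Wire ⊕ Gate)
  acts : Gate → Finset Q
  out : Wire → Wire ⊕ Gate
  reads_earlier : ∀ g g', Sum.inr g' ∈ reads g → time g' < time g
  acts_disjoint : ∀ g g', g ≠ g' → time g = time g' → Disjoint (acts g) (acts g')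

attribute [instance] CircuitGraph.gateFintype

namespace CircuitGraph

variable {Wire Q : Type} (F : CircuitGraph Wire Q)

/-- Gate `g'` depends directly on gate `g`, through a classical or a quantum wire. -/
def Edge (g g' : F.Gate) : Prop :=
  Sum.inr g ∈ F.reads g' ∨ (F.time g < F.time g' ∧ ¬ Disjoint (F.acts g) (F.acts g'))

/-- `F.PathTo n g`: there is a path from an input (a classical input wire, or a qudit in its
initial state) to gate `g` passing through `n` gates, `g` included. -/
inductive PathTo : ℕ → F.Gate → Prop
  | input {i : Wire} {g : F.Gate} (h : Sum.inl i ∈ F.reads g) : PathTo 1 g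
  | qudit {q : Q} {g : F.Gate} (h : q ∈ F.acts g) : PathTo 1 g
  | step {n : ℕ} {g g' : F.Gate} (h : PathTo n g) (e : F.Edge g g') : PathTo (n + 1) g'

/-- Every path from an input to an output passes through at most `D` gates. -/
def DepthLE (D : ℕ) : Prop :=
  ∀ (j : Wire) (g : F.Gate) (n : ℕ), F.out j = Sum.inr g → F.PathTo n g → n ≤ D

/-- Every gate has at most `K` inputs, classical and quantum. -/
def FanInLE (K : ℕ) : Prop := ∀ g, (F.reads g).card + (F.acts g).card ≤ K

/-- The values carried by the classical nodes. -/
def NodeVal (InVal : Wire → Type) (Val : F.Gate → Type) : Wire ⊕ F.Gate → Type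
  | .inl i => InVal i
  | .inr g => Val g

/-- The values of all classical nodes, given those of the input wires and the gate results. -/
def nodeVal {InVal : Wire → Type} {Val : F.Gate → Type} (x : ∀ i, InVal i) (a : ∀ g, Val g) :
    (n : Wire ⊕ F.Gate) → F.NodeVal InVal Val n
  | .inl i => x i
  | .inr g => a g

end CircuitGraph

/-- Input wire `i` of a circuit strategy carries a setting of site `i` or `•`. -/
abbrev Question (S : Scenario) (i : S.Site) : Type := Option (S.Setting i)

/-- Classical circuit strategies: gates are probabilistic, and all gates may use a random seed.
Each output wire returns (a function of) the value of one node. -/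
structure ClassicalCircuit (S : Scenario) where
  graph : CircuitGraph S.Site Empty
  Val : graph.Gate → Type
  [valFintype : ∀ g, Fintype (Val g)]
  Seed : Type
  [seedFintype : Fintype Seed]
  seedWeight : Seed → ℝ
  seedWeight_mem : seedWeight ∈ stdSimplex ℝ Seed
  /-- The probability that gate `g` returns `o`, given the seed and the values read. -/
  kernel : Seed → (g : graph.Gate) →
    ((n : graph.reads g) → graph.NodeVal (Question S) Val n) → Val g → ℝ
  kernel_mem : ∀ z g c, kernel z g c ∈ stdSimplex ℝ (Val g)
  decode : (j : S.Site) → graph.NodeVal (Question S) Val (graph.out j) → Reply S j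

attribute [instance] ClassicalCircuit.valFintype ClassicalCircuit.seedFintype

/-- The probability of output `y` on input `x`: the sum over the seeds and over all joint gate
results with output `y` of the product of the gate probabilities. -/
def ClassicalCircuit.outProb {S : Scenario} (F : ClassicalCircuit S) (x : ∀ i, Question S i)
    (y : ∀ i, Reply S i) : ℝ :=
  ∑ z, F.seedWeight z * ∑ a : ((g : F.graph.Gate) → F.Val g),
    if ∀ j, F.decode j (F.graph.nodeVal x a (F.graph.out j)) = y j then
      ∏ g, F.kernel z g (fun n => F.graph.nodeVal x a n) (a g)
    else 0

/-- Quantum circuit strategies on qudits of dimension `d`: a gate is a unitary or a projective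
measurement on the qudits it acts on, controlled by the classical values it reads. The result of a
measurement gate is the outcome; unitary gates have a trivial result. -/
structure QuantumCircuit (S : Scenario) (d : ℕ) [NeZero d] where
  Q : Type
  [quditFintype : Fintype Q]
  graph : CircuitGraph S.Site Q
  Val : graph.Gate → Type
  [valFintype : ∀ g, Fintype (Val g)]
  op : (g : graph.Gate) → ((n : graph.reads g) → graph.NodeVal (Question S) Val n) → Val g →
    Matrix (graph.acts g → ZMod d) (graph.acts g → ZMod d) ℂ
  op_spec : ∀ g,
    (Nonempty (Unique (Val g)) ∧ ∀ c o, op g c o ∈ Matrix.unitaryGroup (graph.acts g → ZMod d) ℂ) ∨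
    (∀ c, IsProjectiveMeasurement (op g c))
  decode : (j : S.Site) → graph.NodeVal (Question S) Val (graph.out j) → Reply S j

attribute [instance] QuantumCircuit.quditFintype QuantumCircuit.valFintype

namespace QuantumCircuit

variable {S : Scenario} {d : ℕ} [NeZero d] (F : QuantumCircuit S d)

/-- The operator `⨂_g op g ⊗ 1` applied at time `k`, on input `x` and with gate results `a`. -/
def layer (x : ∀ i, Question S i) (a : ∀ g, F.Val g) (k : ℕ) :
    Matrix (F.Q → ZMod d) (F.Q → ZMod d) ℂ :=
  fun b b' =>
    (∏ g : F.graph.Gate, if F.graph.time g = k then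
      F.op g (fun n => F.graph.nodeVal x a n) (a g) (fun q => b q) (fun q => b' q) else 1) *
    if ∀ q, (∀ g, F.graph.time g = k → q ∉ F.graph.acts g) → b q = b' q then 1 else 0

/-- The unnormalised state before time `k`; initially every qudit is in the state `|0⟩`. -/
def state (x : ∀ i, Question S i) (a : ∀ g, F.Val g) : ℕ → (F.Q → ZMod d) → ℂ
  | 0 => Pi.single 0 1
  | k + 1 => Matrix.mulVec (F.layer x a k) (state x a k)

/-- The probability of output `y` on input `x`: the sum, over all joint gate results with output
`y`, of the squared norm of the final state. -/
def outProb (x : ∀ i, Question S i) (y : ∀ i, Reply S i) : ℝ :=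
  ∑ a : ((g : F.graph.Gate) → F.Val g),
    if ∀ j, F.decode j (F.graph.nodeVal x a (F.graph.out j)) = y j then
      ∑ b, ‖F.state x a (Finset.univ.sup F.graph.time + 1) b‖ ^ 2
    else 0

end QuantumCircuit

/-- On input `•` a site replies `•`, and on input `x` it replies with an outcome of `x`, with
certainty. -/
def WellTyped {S : Scenario} (outProb : (∀ i, Question S i) → (∀ i, Reply S i) → ℝ) : Prop :=
  ∀ C y, outProb C y ≠ 0 → ∀ i, (y i).map Sigma.fst = C i

/-- The behaviour of a circuit: the probability of the joint reply `s` to the joint question `C`. -/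
def circuitBehaviour {S : Scenario} (outProb : (∀ i, Question S i) → (∀ i, Reply S i) → ℝ) :
    Behaviour S :=
  fun C s => outProb C s.reply

/-- A family of circuits is shallow if it has bounded depth and bounded fan-in. -/
def Shallow {Wire Q : ℕ → Type} (F : (n : ℕ) → CircuitGraph (Wire n) (Q n)) : Prop :=
  ∃ K D : ℕ, ∀ n, (F n).DepthLE D ∧ (F n).FanInLE K

end ShallowGames

end

noncomputable section

open scoped Classical

namespace ShallowGames

/-! Quantum side. Each edge of the graph carries, for each player, a Bell pair; the qudit of player
`i` is teleported along its path, and the last node performs the Weyl measurement `p i`. The proof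
compares characteristic functions instead of following the state through the teleportation. A Bell
measurement is the joint spectral measurement of the commuting operators `W(c) ⊗ W(c₁, -c₂)`, so by
Fourier inversion the sum of its projectors, weighted by the character of weight `k` of the
correction `-[p, p'_j]`, is the single operator with label `c = k • p`. The corresponding sum at the
last node is `W(k • p)` up to the phase that makes the powers of the Weyl observable a
representation of `ZMod d`. On every Bell pair of the path the two operators that meet are `W(c)`
and `W(c₁, -c₂)`, which together leave the pair invariant. What remains is `W(k • p)` on the
original qudit of `ψ`, with the phase of the direct measurement. Hence, for all paths, the corrected
outcomes have the characteristic function, and so the distribution, of the direct Weyl measurements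
(`questionSum_question`, `expect_register`, `expect_charOp`, `valueSum_distBehaviour`). Preparing
the states and measuring the sites are two layers of gates, whose fan-in is controlled by `|I|` and
the degree of the graph.

Classical side. Success probabilities are linear, so only deterministic strategies matter. For fixed
paths, if the replies along the path of `i` depend only on the setting of `i`, then player `i` can
compute its corrected outcome alone; this is a deterministic strategy for `Φ`, with value at most
`γ` (`pathValue_le`). Global sections always have this locality. A classical circuit is a mixture of
deterministic circuits (`ClassicalCircuit.exists_mixture`), in which a reply depends on the
questions in its light cone, at most `(K + 1) ^ D` many. The setting of `j` is visible only in the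
question to the last node of the path of `j`, so locality fails only under crosstalk: that node is
in the light cone of a reply along the path of some other `i`.

Crosstalk is rare. The path of `i` has at most `rad G` nodes, their light cones contain at most `rad
G * (K + 1) ^ D` inputs, and the last node of the path of `j` is uniform and independent of the path
of `i`. A union bound over pairs of players gives `|I|² (K + 1) ^ D rad G / |G|`
(`sum_crosstalk_le`), which is the excess over `γ`. -/

/-! ## Deterministic models and the classical bound -/

/-- The deterministic empirical model of a global section. -/
def EmpiricalModel.deterministic {S : Scenario} (h : GlobalSection S) : EmpiricalModel S where
  prob C s := if h.restrict C = s then 1 else 0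
  isDist C := ⟨fun s => by positivity, by simp⟩
  compat C C' hC s := by
    have : (h.restrict C').restrict hC = h.restrict C := rfl
    simp only [← ite_and]
    rw [Finset.sum_eq_single (h.restrict C')]
    · simp [this]
    · intro b _ hb
      simp [hb.symm]
    · simp

theorem EmpiricalModel.deterministic_nonContextual {S : Scenario} (h : GlobalSection S) :
    (EmpiricalModel.deterministic h).NonContextual := by
  refine ⟨Pi.single h 1, single_mem_stdSimplex ℝ h, fun C s => ?_⟩
  rw [Finset.sum_eq_single h]
  · simp [EmpiricalModel.deterministic]
  · intro b _ hb
    simp [hb]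
  · simp

/-- The probability that the deterministic strategy `h` wins `Φ`. -/
def Game.value {S : Scenario} (Φ : Game S) (h : GlobalSection S) : ℝ :=
  ∑ k, Φ.weight k * if h.restrict (Φ.ctx k) ∈ Φ.acc k then 1 else 0

theorem Game.value_nonneg {S : Scenario} (Φ : Game S) (h : GlobalSection S) : 0 ≤ Φ.value h :=
  Finset.sum_nonneg fun k _ => mul_nonneg (Φ.weight_mem.1 k) (by positivity)

theorem sum_ite_mem_ite_eq {α : Type*} [Fintype α] (A : Set α) (a : α) (c : ℝ)
    [∀ s, Decidable (s ∈ A)] [∀ s, Decidable (a = s)] :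
    (∑ s, if s ∈ A then (if a = s then c else 0) else 0) = if a ∈ A then c else 0 := by
  rw [Finset.sum_eq_single a]
  · simp
  · intro b _ hb
    simp [hb.symm]
  · simp

theorem successProb_deterministic {S : Scenario} (Φ : Game S) (h : GlobalSection S) :
    successProb (EmpiricalModel.deterministic h).prob Φ = Φ.value h := by
  simp only [successProb, Game.value, EmpiricalModel.deterministic]
  refine Finset.sum_congr rfl fun k _ => ?_
  rw [sum_ite_mem_ite_eq]

/-- The success probability is linear in the behaviour, so it commutes with the mixture over global
sections. -/
theorem successProb_nonContextual {S : Scenario} (Φ : Game S) (e : EmpiricalModel S)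
    (m : GlobalSection S → ℝ)
    (hm : ∀ (C : Context S) (s : LocalSection S C),
      e.prob C s = ∑ g : GlobalSection S, if g.restrict C = s then m g else 0) :
    successProb e.prob Φ = ∑ g, m g * Φ.value g := by
  have key : ∀ k, (∑ s : LocalSection S (Φ.ctx k),
      if s ∈ Φ.acc k then e.prob (Φ.ctx k) s else 0) =
      ∑ g : GlobalSection S, if g.restrict (Φ.ctx k) ∈ Φ.acc k then m g else 0 := by
    intro k
    have : ∀ s : LocalSection S (Φ.ctx k),
        (if s ∈ Φ.acc k then e.prob (Φ.ctx k) s else 0) =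
        ∑ g : GlobalSection S,
          if s ∈ Φ.acc k then (if g.restrict (Φ.ctx k) = s then m g else 0) else 0 := by
      intro s
      split_ifs with hs
      · exact hm _ _
      · simp
    simp_rw [this]
    rw [Finset.sum_comm]
    exact Finset.sum_congr rfl fun g _ => sum_ite_mem_ite_eq _ _ _
  simp only [successProb, Game.value, key, Finset.mul_sum]
  rw [Finset.sum_comm]
  refine Finset.sum_congr rfl fun g _ => Finset.sum_congr rfl fun k _ => ?_
  split_ifs <;> ring

/-- A weighted average does not exceed a common upper bound, so deterministic strategies suffice.
All classical estimates below use the bound in this form. -/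
theorem classicalBound_iff {S : Scenario} (Φ : Game S) (γ : ℝ) :
    ClassicalBound Φ γ ↔ ∀ h : GlobalSection S, Φ.value h ≤ γ := by
  constructor
  · intro H h
    rw [← successProb_deterministic]
    exact H _ (EmpiricalModel.deterministic_nonContextual h)
  · rintro H e ⟨m, hm, he⟩
    rw [successProb_nonContextual Φ e m he]
    calc ∑ g, m g * Φ.value g ≤ ∑ g, m g * γ :=
          Finset.sum_le_sum fun g _ => mul_le_mul_of_nonneg_left (H g) (hm.1 g)
      _ = γ := by rw [← Finset.sum_mul, hm.2, one_mul]

/-! ## Replies -/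

theorem LocalSection.reply_of_some {S : Scenario} {C : Context S} (s : LocalSection S C)
    {i : S.Site} {x : S.Setting i} (h : C i = some x) : s.reply i = some ⟨x, s i x h⟩ := by
  unfold LocalSection.reply
  split
  · rename_i h'
    rw [h] at h'
    cases h'
  · rename_i y h'
    have : y = x := Option.some.inj (h'.symm.trans h)
    subst this
    rfl

theorem LocalSection.reply_of_none {S : Scenario} {C : Context S} (s : LocalSection S C)
    {i : S.Site} (h : C i = none) : s.reply i = none := by
  unfold LocalSection.reply
  split
  · rfl
  · rename_i y h'
    rw [h] at h'
    cases h'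

theorem LocalSection.reply_map_fst {S : Scenario} {C : Context S} (s : LocalSection S C)
    (i : S.Site) : (s.reply i).map Sigma.fst = C i := by
  cases h : C i with
  | none => rw [s.reply_of_none h]; rfl
  | some x => rw [s.reply_of_some h]; rfl

theorem LocalSection.reply_injective {S : Scenario} {C : Context S} :
    Function.Injective (LocalSection.reply (S := S) (C := C)) := by
  intro s t h
  funext i x hx
  have := congrFun h i
  rw [s.reply_of_some hx, t.reply_of_some hx] at this
  simpa using this

theorem GlobalSection.reply_restrict {S : Scenario} (g : GlobalSection S) (C : Context S)
    (i : S.Site) : (g.restrict C).reply i = (C i).map fun x => ⟨x, g i x⟩ := by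
  cases h : C i with
  | none => rw [LocalSection.reply_of_none _ h]; rfl
  | some x => rw [LocalSection.reply_of_some _ h]; rfl

/-- The probability assigned to an accepting condition. -/
def acceptSum {S : Scenario} {C : Context S} (A : Set (LocalSection S C))
    (f : LocalSection S C → ℝ) : ℝ := ∑ s, if s ∈ A then f s else 0

theorem successProb_eq {S : Scenario} (B : Behaviour S) (Φ : Game S) :
    successProb B Φ = ∑ k, Φ.weight k * acceptSum (Φ.acc k) (B (Φ.ctx k)) := rfl

/-- The replies `r` are an accepted joint outcome. -/
def Wins {S : Scenario} {C : Context S} (A : Set (LocalSection S C)) (r : ∀ i, Reply S i) : Prop :=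
  ∃ s ∈ A, r = s.reply

/-- Replies that do not fit the question come from no section and lose; fitting ones come from
exactly one, by injectivity of `LocalSection.reply`. -/
theorem acceptSum_ite_reply {S : Scenario} {C : Context S} (A : Set (LocalSection S C))
    (r : ∀ i, Reply S i) :
    acceptSum A (fun s => if r = s.reply then 1 else 0) = if Wins A r then 1 else 0 := by
  by_cases h : ∃ s : LocalSection S C, r = s.reply
  · obtain ⟨s, rfl⟩ := h
    have : ∀ t : LocalSection S C, s.reply = t.reply ↔ s = t :=
      fun t => LocalSection.reply_injective.eq_iff
    simp only [acceptSum, Wins, this]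
    rw [sum_ite_mem_ite_eq]
    simp
  · push Not at h
    simp [acceptSum, Wins, h]

/-! ## The classical bound for the distributed game -/

section

variable {d : ℕ} {I : Type} [Fintype I] {G : RootedGraph}

theorem RootedPath.question_of_notMem (P : RootedPath G) (p : ZMod d × ZMod d) {v : G.V}
    (hv : v ∉ P.2.1.support) : P.question p v = none := by
  simp [RootedPath.question, hv]

/-- The question put to `(i, v)` depends on the Weyl setting only if `v` is the last node. -/
theorem RootedPath.question_congr (P : RootedPath G) (p p' : ZMod d × ZMod d) {v : G.V}
    (hv : v ≠ P.1) : P.question p v = P.question p' v := by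
  by_cases hm : v ∈ P.2.1.support
  · have hl : P.2.1.support.idxOf v < P.2.1.length := by
      refine lt_of_le_of_ne (P.idxOf_le hm) fun h => hv ?_
      rw [← P.getVert_idxOf hm, h, SimpleGraph.Walk.getVert_length]
    simp [RootedPath.question, hm, hl]
  · rw [P.question_of_notMem _ hm, P.question_of_notMem _ hm]

variable [NeZero d]

/-- The Weyl settings of the question `C`, with the trivial one for sites that are not asked. -/
abbrev fullSetting (C : Context (weylScenario d I)) : I → ZMod d × ZMod d :=
  fun i => (C i).getD 0

/-- The accepting condition of the distributed game for the paths `P`. -/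
def pathAcc (Φ : Game (weylScenario d I)) (P : I → RootedPath G) (k : Φ.Index) :
    Set (LocalSection (distScenario d I G) (distContext P (fullSetting (Φ.ctx k)))) :=
  {s | (fun i _ _ => distOutcome P (fullSetting (Φ.ctx k)) s i) ∈ Φ.acc k}

theorem successProb_distributedGame (B : Behaviour (distScenario d I G)) (u : PathDistribution G)
    (Φ : Game (weylScenario d I)) :
    successProb B (distributedGame u Φ) =
      ∑ P : I → RootedPath G, (∏ i, u.weight (P i)) *
        ∑ k, Φ.weight k * acceptSum (pathAcc Φ P k) (B (distContext P (fullSetting (Φ.ctx k)))) := by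
  rw [successProb_eq]
  refine (Fintype.sum_prod_type _).trans (Finset.sum_congr rfl fun P _ => ?_)
  rw [Finset.mul_sum]
  exact Finset.sum_congr rfl fun k _ => mul_assoc _ _ _

/-- The winning probability of the deterministic replies `F p` to the joint questions
`distContext P p`, for fixed paths `P`. -/
def pathValue (Φ : Game (weylScenario d I)) (P : I → RootedPath G)
    (F : (I → ZMod d × ZMod d) → ∀ a, Reply (distScenario d I G) a) : ℝ :=
  ∑ k, Φ.weight k * if Wins (pathAcc Φ P k) (F (fullSetting (Φ.ctx k))) then 1 else 0

theorem pathValue_le_one (Φ : Game (weylScenario d I)) (P : I → RootedPath G)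
    (F : (I → ZMod d × ZMod d) → ∀ a, Reply (distScenario d I G) a) : pathValue Φ P F ≤ 1 := by
  calc pathValue Φ P F ≤ ∑ k, Φ.weight k * 1 := by
        refine Finset.sum_le_sum fun k _ => mul_le_mul_of_nonneg_left ?_ (Φ.weight_mem.1 k)
        split_ifs <;> norm_num
    _ = 1 := by simp [Φ.weight_mem.2]

/-- If the replies along the path of player `i` depend on the Weyl settings only through that of
player `i`, then the corrected outcomes come from a global section. -/
theorem pathValue_le {Φ : Game (weylScenario d I)} {γ : ℝ} (hΦ : ClassicalBound Φ γ)
    (P : I → RootedPath G)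
    (F : (I → ZMod d × ZMod d) → ∀ a, Reply (distScenario d I G) a)
    (hF : ∀ i, ∀ v ∈ (P i).2.1.support, ∀ p p' : I → ZMod d × ZMod d, p i = p' i →
      F p (i, v) = F p' (i, v)) :
    pathValue Φ P F ≤ γ := by
  -- Player `i` carries out the correction alone. By `hF` the replies along its path are functions
  -- of its own setting, so `F` can be fed the constant family `fun _ => x`. Replies off the path
  -- are left out because `hF` says nothing about them.
  let h : GlobalSection (weylScenario d I) := fun i x =>
    weylPart (F (fun _ => x) (i, (P i).1)) -
      bracket d x (∑ v : G.V, if v ∈ (P i).2.1.support then bellPart (F (fun _ => x) (i, v)) else 0)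
  refine le_trans ?_ ((classicalBound_iff Φ γ).1 hΦ h)
  refine Finset.sum_le_sum fun k _ => mul_le_mul_of_nonneg_left ?_ (Φ.weight_mem.1 k)
  have key : ∀ s : LocalSection (distScenario d I G) (distContext P (fullSetting (Φ.ctx k))),
      F (fullSetting (Φ.ctx k)) = s.reply →
      (fun i _ _ => distOutcome P (fullSetting (Φ.ctx k)) s i) = h.restrict (Φ.ctx k) := by
    intro s hs
    funext i x hx
    have hp : fullSetting (Φ.ctx k) i = x := by simp [fullSetting, hx]
    have hr : ∀ v ∈ (P i).2.1.support, s.reply (i, v) = F (fun _ => x) (i, v) := by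
      intro v hv
      rw [← hs]
      exact hF i v hv _ _ hp
    simp only [distOutcome, GlobalSection.restrict, h, hp]
    rw [hr _ (SimpleGraph.Walk.end_mem_support _)]
    congr 2
    refine Finset.sum_congr rfl fun v _ => ?_
    split_ifs with hv
    · rw [hr v hv]
    -- Off the path the question is `•`, the reply is `none`, and its Bell part is the default value
    -- `0`.
    · rw [s.reply_of_none]
      · rfl
      · exact (P i).question_of_notMem _ hv
  have hw : Wins (pathAcc Φ P k) (F (fullSetting (Φ.ctx k))) → h.restrict (Φ.ctx k) ∈ Φ.acc k := by
    rintro ⟨s, hs, hr⟩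
    rw [← key s hr]
    exact hs
  by_cases h1 : Wins (pathAcc Φ P k) (F (fullSetting (Φ.ctx k)))
  · rw [if_pos h1, if_pos (hw h1)]
  · rw [if_neg h1]
    positivity

theorem sum_prod_pathWeight (u : PathDistribution G) :
    ∑ P : I → RootedPath G, ∏ i, u.weight (P i) = 1 := by
  rw [← Fintype.prod_sum (f := fun (_ : I) P => u.weight P)]
  simp [u.weight_mem.2]

theorem prod_pathWeight_nonneg (u : PathDistribution G) (P : I → RootedPath G) :
    0 ≤ ∏ i, u.weight (P i) := Finset.prod_nonneg fun _ _ => u.weight_mem.1 _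

/-- Under a global section each site sees only its own question, and the questions to the sites `(i,
v)` involve only the setting of `i`. So `pathValue_le` applies for each choice of paths, and the
bound survives averaging over them. -/
theorem classicalBound_distributedGame {Φ : Game (weylScenario d I)} {γ : ℝ}
    (hΦ : ClassicalBound Φ γ) (u : PathDistribution G) :
    ClassicalBound (distributedGame u Φ) γ := by
  rw [classicalBound_iff]
  intro h
  rw [← successProb_deterministic, successProb_distributedGame]
  calc _ ≤ ∑ P : I → RootedPath G, (∏ i, u.weight (P i)) * γ := by
        refine Finset.sum_le_sum fun P _ =>
          mul_le_mul_of_nonneg_left ?_ (prod_pathWeight_nonneg u P)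
        refine le_trans (le_of_eq ?_) (pathValue_le hΦ P
          (fun p => (h.restrict (distContext P p)).reply) fun i v _ p p' hp => ?_)
        · refine Finset.sum_congr rfl fun k _ => ?_
          rw [← acceptSum_ite_reply]
          simp only [LocalSection.reply_injective.eq_iff]
          rfl
        · rw [GlobalSection.reply_restrict, GlobalSection.reply_restrict]
          simp only [distContext, hp]
    _ = γ := by rw [← Finset.sum_mul, sum_prod_pathWeight, one_mul]

end

/-! ## Light cones -/

namespace CircuitGraph

variable {Wire Q : Type} (F : CircuitGraph Wire Q)

/-- The input wire `i` influences the gate through classical wires. -/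
inductive Influences (i : Wire) : F.Gate → Prop
  | direct {g : F.Gate} (h : Sum.inl i ∈ F.reads g) : Influences i g
  | step {g g' : F.Gate} (h : Influences i g) (e : Sum.inr g ∈ F.reads g') : Influences i g'

/-- The input wire `i` influences the classical node. -/
def NodeInfluences (i : Wire) : Wire ⊕ F.Gate → Prop
  | .inl i' => i = i'
  | .inr g => F.Influences i g

variable {F}

theorem Influences.exists_node {i : Wire} {g : F.Gate} (h : F.Influences i g) :
    ∃ n ∈ F.reads g, F.NodeInfluences i n := by
  cases h with
  | direct h => exact ⟨_, h, rfl⟩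
  | step h e => exact ⟨_, e, h⟩

theorem Influences.exists_pathTo {i : Wire} {g : F.Gate} (h : F.Influences i g) :
    ∃ n, 1 ≤ n ∧ F.PathTo n g := by
  induction h with
  | direct h => exact ⟨1, le_rfl, .input h⟩
  | step _ e ih =>
    obtain ⟨n, _, hp⟩ := ih
    exact ⟨n + 1, by omega, .step hp (.inl e)⟩

variable [Fintype Wire]

omit [Fintype Wire] in
theorem nodeInfluences_inl {i i' : Wire} : F.NodeInfluences i (Sum.inl i') ↔ i = i' := Iff.rfl

/-- The base `K + 1` is positive even for `K = 0`, so every power has room for the single wire that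
an input node depends on. -/
theorem card_nodeInfluences_inl_le (K D : ℕ) (i' : Wire) :
    (Finset.univ.filter fun i => F.NodeInfluences i (Sum.inl i')).card ≤ (K + 1) ^ D := by
  refine le_trans (Finset.card_le_one.2 fun i hi j hj => ?_) (Nat.one_le_pow _ _ (by omega))
  simp only [Finset.mem_filter, Finset.mem_univ, true_and, nodeInfluences_inl] at hi hj
  rw [hi, hj]

/-- Each gate reads at most `K` nodes, so every unit of depth multiplies the size of the light cone
by at most `K + 1`. -/
theorem card_influences_le {K : ℕ} (hK : F.FanInLE K) (D : ℕ) (g : F.Gate)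
    (hD : ∀ n, F.PathTo n g → n ≤ D) :
    (Finset.univ.filter fun i => F.Influences i g).card ≤ (K + 1) ^ D := by
  induction D generalizing g with
  | zero =>
    rw [Finset.filter_eq_empty_iff.2]
    · simp
    · intro i _ h
      obtain ⟨n, h1, h2⟩ := h.exists_pathTo
      have := hD n h2
      omega
  | succ D ih =>
    have hsub : (Finset.univ.filter fun i => F.Influences i g) ⊆
        (F.reads g).biUnion fun n => Finset.univ.filter fun i => F.NodeInfluences i n := by
      intro i hi
      simpa using (Finset.mem_filter.1 hi).2.exists_node
    refine (Finset.card_le_card hsub).trans ?_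
    refine (Finset.card_biUnion_le_card_mul _ _ ((K + 1) ^ D) ?_).trans ?_
    · rintro (i | g') hn
      · exact card_nodeInfluences_inl_le K D i
      -- Every path to `g'` extends by one gate to a path to `g`, so the depth available to `g'` is
      -- smaller by one.
      · exact ih g' fun n hp => Nat.le_of_succ_le_succ (hD _ (.step hp (.inl hn)))
    · rw [pow_succ, mul_comm]
      exact Nat.mul_le_mul_left _ (by have := hK g; omega)

theorem card_nodeInfluences_out_le {K D : ℕ} (hK : F.FanInLE K) (hD : F.DepthLE D) (j : Wire) :
    (Finset.univ.filter fun i => F.NodeInfluences i (F.out j)).card ≤ (K + 1) ^ D := by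
  cases h : F.out j with
  | inl i => exact card_nodeInfluences_inl_le K D i
  | inr g => exact card_influences_le hK D g fun n => hD j g n h

end CircuitGraph

/-! ## Derandomisation of classical circuits -/

namespace ClassicalCircuit

variable {S : Scenario} (F : ClassicalCircuit S)

instance (n : S.Site ⊕ F.graph.Gate) : Fintype (F.graph.NodeVal (Question S) F.Val n) := by
  cases n <;> (unfold CircuitGraph.NodeVal; infer_instance)

/-- What gate `g` reads. -/
abbrev GateInput (g : F.graph.Gate) : Type :=
  (n : F.graph.reads g) → F.graph.NodeVal (Question S) F.Val n

/-- A deterministic function for each gate. -/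
abbrev GateFun : Type := (g : F.graph.Gate) → F.GateInput g → F.Val g

/-- The gate results on input `x` if the gates are deterministic. -/
def eval (f : F.GateFun) (x : ∀ i, Question S i) (g : F.graph.Gate) : F.Val g :=
  f g fun n => match n with
    | ⟨.inl i, _⟩ => x i
    | ⟨.inr g', _⟩ => eval f x g'
termination_by F.graph.time g
decreasing_by exact F.graph.reads_earlier _ _ (by assumption)

theorem eval_eq (f : F.GateFun) (x : ∀ i, Question S i) (g : F.graph.Gate) :
    F.eval f x g = f g fun n => F.graph.nodeVal x (F.eval f x) n := by
  rw [eval]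
  congr 1
  funext n
  rcases n with ⟨_ | _, _⟩ <;> rfl

/-- Gates read only earlier gates, so by induction on the schedule the gate equations have a unique
solution. -/
theorem eq_eval {f : F.GateFun} {x : ∀ i, Question S i} {a : ∀ g, F.Val g}
    (h : ∀ g, f g (fun n => F.graph.nodeVal x a n) = a g) : a = F.eval f x := by
  have : ∀ t g, F.graph.time g = t → a g = F.eval f x g := by
    intro t
    induction t using Nat.strong_induction_on with
    | _ t ih =>
      intro g hg
      rw [← h g, eval_eq]
      congr 1
      funext ⟨n, hn⟩
      cases n with
      | inl i => rfl
      | inr g' => exact ih _ (hg ▸ F.graph.reads_earlier _ _ hn) g' rfl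
  exact funext fun g => this _ g rfl

/-- The reply of a deterministic circuit. -/
def evalReply (f : F.GateFun) (x : ∀ i, Question S i) (j : S.Site) : Reply S j :=
  F.decode j (F.graph.nodeVal x (F.eval f x) (F.graph.out j))

theorem eval_congr (f : F.GateFun) {x x' : ∀ i, Question S i} (g : F.graph.Gate)
    (h : ∀ i, F.graph.Influences i g → x i = x' i) : F.eval f x g = F.eval f x' g := by
  have : ∀ t g, F.graph.time g = t → (∀ i, F.graph.Influences i g → x i = x' i) →
      F.eval f x g = F.eval f x' g := by
    intro t
    induction t using Nat.strong_induction_on with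
    | _ t ih =>
      intro g hg h
      rw [eval_eq, eval_eq]
      congr 1
      funext ⟨n, hn⟩
      cases n with
      | inl i => exact h i (.direct hn)
      | inr g' =>
        exact ih _ (hg ▸ F.graph.reads_earlier _ _ hn) g' rfl fun i hi => h i (.step hi hn)
  exact this _ g rfl h

theorem evalReply_congr (f : F.GateFun) {x x' : ∀ i, Question S i} (j : S.Site)
    (h : ∀ i, F.graph.NodeInfluences i (F.graph.out j) → x i = x' i) :
    F.evalReply f x j = F.evalReply f x' j := by
  unfold evalReply
  congr 1
  revert h
  cases F.graph.out j with
  | inl i => exact fun h => h i rfl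
  | inr g => exact fun h => F.eval_congr f g h

/-- The probability that the gates, with independent randomness for each input, act as `f`. -/
def funWeight (z : F.Seed) (f : F.GateFun) : ℝ := ∏ g, ∏ c, F.kernel z g c (f g c)

/-- The values of `f` are independent under the product weight, and all coordinates other than `a`
sum to one. -/
theorem sum_prod_apply {A B : Type} [Fintype A] [Fintype B] [DecidableEq A] [DecidableEq B]
    (k : A → B → ℝ)
    (hk : ∀ a, ∑ b, k a b = 1) (a : A) (b : B) :
    (∑ f : A → B, if f a = b then ∏ a', k a' (f a') else 0) = k a b := by
  -- The constraint is absorbed into the factor at `a`, so that the sum over functions factorises.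
  have : ∀ f : A → B, (if f a = b then ∏ a', k a' (f a') else 0) =
      ∏ a', (if a' = a then (if f a' = b then k a' (f a') else 0) else k a' (f a')) := by
    intro f
    split_ifs with h
    · refine Finset.prod_congr rfl fun a' _ => ?_
      split_ifs with h1 h2
      · rfl
      · exact absurd (h1 ▸ h) h2
      · rfl
    · exact (Finset.prod_eq_zero (Finset.mem_univ a) (by simp [h])).symm
  simp_rw [this]
  rw [← Fintype.prod_sum
    (f := fun a' b' => if a' = a then (if b' = b then k a' b' else 0) else k a' b')]
  rw [Finset.prod_eq_single a]
  · simp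
  · intro a' _ ha'
    simp [ha', hk]
  · simp

theorem sum_ite_forall_prod {ι : Type} [Fintype ι] {β : ι → Type} [∀ i, Fintype (β i)]
    (p : ∀ i, β i → Prop) (w : ∀ i, β i → ℝ) [∀ f : ∀ i, β i, Decidable (∀ i, p i (f i))]
    [∀ i b, Decidable (p i b)] :
    (∑ f : ∀ i, β i, if ∀ i, p i (f i) then ∏ i, w i (f i) else 0) =
      ∏ i, ∑ b, if p i b then w i b else 0 := by
  rw [Fintype.prod_sum]
  refine Finset.sum_congr rfl fun f _ => ?_
  split_ifs with h
  · exact Finset.prod_congr rfl fun i _ => by rw [if_pos (h i)]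
  · push Not at h
    obtain ⟨i, hi⟩ := h
    exact (Finset.prod_eq_zero (Finset.mem_univ i) (by simp [hi])).symm

/-- Drawing the answer of a gate in advance, independently for every conceivable input, has the same
effect as drawing it for the input `c g` that occurs: the entries that are not consulted integrate
to one. -/
theorem sum_funWeight_consistent (z : F.Seed) (c : ∀ g, F.GateInput g) (a : ∀ g, F.Val g) :
    (∑ f : F.GateFun, if ∀ g, f g (c g) = a g then F.funWeight z f else 0) =
      ∏ g, F.kernel z g (c g) (a g) := by
  refine (@sum_ite_forall_prod _ _ _ _ (fun g (fg : F.GateInput g → F.Val g) => fg (c g) = a g)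
    (fun g fg => ∏ c', F.kernel z g c' (fg c')) _ _).trans ?_
  exact Finset.prod_congr rfl fun g _ =>
    @sum_prod_apply _ _ _ _ _ _ (F.kernel z g) (fun c' => (F.kernel_mem z g c').2) _ _

theorem funWeight_nonneg (z : F.Seed) (f : F.GateFun) : 0 ≤ F.funWeight z f :=
  Finset.prod_nonneg fun g _ => Finset.prod_nonneg fun c _ => (F.kernel_mem z g c).1 _

theorem sum_funWeight (z : F.Seed) : ∑ f, F.funWeight z f = 1 := by
  unfold funWeight
  rw [← Fintype.prod_sum (f := fun g (fg : F.GateInput g → F.Val g) =>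
    ∏ c', F.kernel z g c' (fg c'))]
  refine Finset.prod_eq_one fun g _ => ?_
  rw [← Fintype.prod_sum (f := fun c b => F.kernel z g c b)]
  exact Finset.prod_eq_one fun c _ => (F.kernel_mem z g c).2

/-- A classical circuit is a mixture of deterministic ones. -/
theorem outProb_eq (x : ∀ i, Question S i) (y : ∀ i, Reply S i) :
    F.outProb x y = ∑ z, F.seedWeight z * ∑ f, F.funWeight z f *
      if F.evalReply f x = y then 1 else 0 := by
  unfold outProb
  refine Finset.sum_congr rfl fun z _ => ?_
  congr 1
  -- The gate results `a` occur exactly when the predrawn functions `f` are consistent with them,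
  -- that is, when `a` is the run of `f`. After exchanging the sums, each `f` leaves a single `a`.
  have h1 : ∀ a : (g : F.graph.Gate) → F.Val g,
      (if ∀ j, F.decode j (F.graph.nodeVal x a (F.graph.out j)) = y j then
        ∏ g, F.kernel z g (fun n => F.graph.nodeVal x a n) (a g) else 0) =
      ∑ f : F.GateFun, if a = F.eval f x then
        (if F.evalReply f x = y then F.funWeight z f else 0) else 0 := by
    intro a
    rw [← sum_funWeight_consistent F z (fun g n => F.graph.nodeVal x a n) a]
    have h2 : ∀ f : F.GateFun,
        (∀ g, f g (fun n => F.graph.nodeVal x a n) = a g) ↔ a = F.eval f x :=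
      fun f => ⟨F.eq_eval, by rintro rfl g; exact (F.eval_eq f x g).symm⟩
    simp only [h2]
    split_ifs with h
    · refine Finset.sum_congr rfl fun f _ => ?_
      split_ifs with h3 h4
      · rfl
      · subst h3
        exact absurd (funext h) h4
      · rfl
    · refine (Finset.sum_eq_zero fun f _ => ?_).symm
      split_ifs with h3 h4
      · subst h3
        exact absurd (fun j => congrFun h4 j) h
      · rfl
      · rfl
  rw [Finset.sum_congr rfl fun a _ => h1 a, Finset.sum_comm]
  refine Finset.sum_congr rfl fun f _ => ?_
  rw [Finset.sum_ite_eq' Finset.univ (F.eval f x), if_pos (Finset.mem_univ _)]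
  split_ifs <;> ring

end ClassicalCircuit

theorem acceptSum_mixture {S : Scenario} {C : Context S} (A : Set (LocalSection S C))
    {Ω : Type} [Fintype Ω] (μ : Ω → ℝ) (R : Ω → ∀ i, Reply S i) :
    acceptSum A (fun s => ∑ ω, μ ω * if R ω = s.reply then 1 else 0) =
      ∑ ω, μ ω * if Wins A (R ω) then 1 else 0 := by
  simp only [← acceptSum_ite_reply, acceptSum, Finset.mul_sum]
  rw [Finset.sum_comm]
  refine Finset.sum_congr rfl fun s _ => ?_
  by_cases h : s ∈ A <;> simp [h]

/-- A classical circuit strategy is a mixture of deterministic strategies in which every reply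
depends only on the questions in its light cone. -/
theorem ClassicalCircuit.exists_mixture {S : Scenario} (F : ClassicalCircuit S) :
    ∃ (Ω : Type) (_ : Fintype Ω) (μ : Ω → ℝ) (R : Ω → (∀ i, Question S i) → ∀ i, Reply S i),
      μ ∈ stdSimplex ℝ Ω ∧
      (∀ (C : Context S) (A : Set (LocalSection S C)),
        acceptSum A (circuitBehaviour F.outProb C) =
          ∑ ω, μ ω * if Wins A (R ω C) then 1 else 0) ∧
      ∀ ω j x x', (∀ i, F.graph.NodeInfluences i (F.graph.out j) → x i = x' i) →
        R ω x j = R ω x' j := by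
  refine ⟨F.Seed × F.GateFun, inferInstance, fun ω => F.seedWeight ω.1 * F.funWeight ω.1 ω.2,
    fun ω => F.evalReply ω.2, ⟨fun ω => mul_nonneg (F.seedWeight_mem.1 _) (F.funWeight_nonneg _ _),
    ?_⟩, fun C A => ?_, fun ω j x x' h => F.evalReply_congr _ j h⟩
  · rw [Fintype.sum_prod_type]
    simp only [← Finset.mul_sum, F.sum_funWeight, mul_one, F.seedWeight_mem.2]
  · rw [← acceptSum_mixture]
    congr 1
    funext s
    rw [circuitBehaviour, F.outProb_eq, Fintype.sum_prod_type]
    simp only [Finset.mul_sum, mul_assoc]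

/-! ## Classical circuits for the distributed game -/

section

variable {d : ℕ} [NeZero d] {I : Type} [Fintype I] {G : RootedGraph}

/-- The last node of the path of some `j` is in the light cone of a reply along the path of another
player `i`. -/
def Crosstalk (F : CircuitGraph (I × G.V) Empty) (P : I → RootedPath G) : Prop :=
  ∃ i j, i ≠ j ∧ ∃ v ∈ (P i).2.1.support, F.NodeInfluences (j, (P j).1) (F.out (i, v))

/-- Without crosstalk each deterministic component of the circuit is local for the given paths, and
`pathValue_le` bounds it by `γ`; with crosstalk the trivial bound `1` is used. -/
theorem successProb_le_add_crosstalk {Φ : Game (weylScenario d I)} {γ : ℝ}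
    (hΦ : ClassicalBound Φ γ) (u : PathDistribution G)
    (C : ClassicalCircuit (distScenario d I G)) :
    successProb (circuitBehaviour C.outProb) (distributedGame u Φ) ≤
      γ + ∑ P : I → RootedPath G, (∏ i, u.weight (P i)) *
        if Crosstalk C.graph P then 1 else 0 := by
  -- Nonnegativity of `γ` turns the trivial bound `1` into the bound `γ + 1` in the case of
  -- crosstalk.
  have hγ : 0 ≤ γ := ((classicalBound_iff Φ γ).1 hΦ fun _ _ => 0).trans' (Φ.value_nonneg _)
  obtain ⟨Ω, _, μ, R, hμ, hacc, hR⟩ := C.exists_mixture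
  rw [successProb_distributedGame]
  have hval : ∀ P : I → RootedPath G, ∀ ω, pathValue Φ P (fun p => R ω (distContext P p)) ≤
      γ + if Crosstalk C.graph P then 1 else 0 := by
    intro P ω
    by_cases hP : Crosstalk C.graph P
    · rw [if_pos hP]
      linarith [pathValue_le_one Φ P (fun p => R ω (distContext P p))]
    · rw [if_neg hP, add_zero]
      refine pathValue_le hΦ P _ fun i v hv p p' hp => hR ω _ _ _ ?_
      -- Settings that agree at `i` produce the same questions throughout the light cone. For `j =
      -- i` this is clear; for `j ≠ i` only the last node on the path of `j` sees the setting of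
      -- `j`, and without crosstalk it is outside the light cone.
      rintro ⟨j, w⟩ hw
      by_cases hij : i = j
      · subst hij
        simp only [distContext, hp]
      · refine (P j).question_congr _ _ fun hend => hP ⟨i, j, hij, v, hv, ?_⟩
        simp only at hend
        rwa [hend] at hw
  have hP : ∀ P : I → RootedPath G, ∑ k, Φ.weight k * acceptSum (pathAcc Φ P k)
      (circuitBehaviour C.outProb (distContext P (fullSetting (Φ.ctx k)))) ≤
      γ + if Crosstalk C.graph P then 1 else 0 := by
    intro P
    calc _ = ∑ ω, μ ω * pathValue Φ P (fun p => R ω (distContext P p)) := by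
          simp only [hacc, pathValue, Finset.mul_sum]
          rw [Finset.sum_comm]
          refine Finset.sum_congr rfl fun ω _ => Finset.sum_congr rfl fun k _ => ?_
          ring
      _ ≤ ∑ ω, μ ω * (γ + if Crosstalk C.graph P then 1 else 0) :=
          Finset.sum_le_sum fun ω _ => mul_le_mul_of_nonneg_left (hval P ω) (hμ.1 ω)
      _ = _ := by rw [← Finset.sum_mul, hμ.2, one_mul]
  calc _ ≤ ∑ P : I → RootedPath G, (∏ i, u.weight (P i)) *
        (γ + if Crosstalk C.graph P then 1 else 0) :=
        Finset.sum_le_sum fun P _ => mul_le_mul_of_nonneg_left (hP P) (prod_pathWeight_nonneg u P)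
    _ = _ := by
        simp only [mul_add, Finset.sum_add_distrib, ← Finset.sum_mul, sum_prod_pathWeight, one_mul]

/-- Independence of the paths of two players. -/
theorem sum_prod_pathWeight_mul (u : PathDistribution G) {i j : I} (hij : i ≠ j)
    (f g : RootedPath G → ℝ) :
    ∑ P : I → RootedPath G, (∏ l, u.weight (P l)) * (f (P i) * g (P j)) =
      (∑ A, u.weight A * f A) * ∑ B, u.weight B * g B := by
  -- The two functions are written as factors at `i` and `j` of a product over all players, which
  -- then factorises as a sum.
  have h1 : ∀ P : I → RootedPath G, (∏ l, u.weight (P l)) * (f (P i) * g (P j)) =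
      ∏ l, u.weight (P l) * ((if l = i then f (P l) else 1) * if l = j then g (P l) else 1) := by
    intro P
    simp only [Finset.prod_mul_distrib, Finset.prod_ite_eq', Finset.mem_univ, if_true]
  simp only [h1]
  rw [← Fintype.prod_sum (f := fun l A =>
    u.weight A * ((if l = i then f A else 1) * if l = j then g A else 1))]
  have h2 : ∀ l, ∑ A, u.weight A * ((if l = i then f A else 1) * if l = j then g A else 1) =
      (if l = i then ∑ A, u.weight A * f A else 1) *
        if l = j then ∑ A, u.weight A * g A else 1 := by
    intro l
    by_cases h : l = i
    · have : l ≠ j := h ▸ hij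
      simp [h, hij]
    · by_cases h' : l = j <;> simp [h, h', u.weight_mem.2, hij.symm]
  simp only [h2, Finset.prod_mul_distrib, Finset.prod_ite_eq', Finset.mem_univ, if_true]

theorem sum_weight_mul_ite_end (u : PathDistribution G) (w : G.V) :
    ∑ A, u.weight A * (if A.1 = w then 1 else 0) = 1 / (G.size : ℝ) := by
  simp only [mul_ite, mul_one, mul_zero]
  exact u.uniform w

/-- Exchanging the sums gives the expected number of nodes on the path. -/
theorem sum_weight_mul_mem_le (u : PathDistribution G) :
    ∑ v : G.V, ∑ A, u.weight A * (if v ∈ A.2.1.support then 1 else 0) ≤ G.rad := by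
  rw [Finset.sum_comm]
  calc _ ≤ ∑ A, u.weight A * (G.rad : ℝ) := by
        refine Finset.sum_le_sum fun A _ => ?_
        rw [← Finset.mul_sum]
        -- Only paths of positive weight are known to be short; the others contribute nothing.
        rcases (u.weight_mem.1 A).eq_or_lt with h | h
        · simp [← h]
        · refine mul_le_mul_of_nonneg_left ?_ h.le
          have h1 := u.numNodes_le A h
          have h2 : (∑ v : G.V, if v ∈ A.2.1.support then (1 : ℝ) else 0) =
              A.2.1.support.toFinset.card := by
            rw [Finset.sum_boole]
            congr 2
            ext v
            simp
          rw [h2]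
          refine Nat.cast_le.2 ((List.toFinset_card_le _).trans ?_)
          rw [SimpleGraph.Walk.length_support]
          exact h1
    _ = G.rad := by rw [← Finset.sum_mul, u.weight_mem.2, one_mul]

/-- A union bound over ordered pairs of players, nodes `v` on the path of `i`, and inputs `(j, w)`
in the light cone of `(i, v)`. These inputs are determined by the circuit, while the last node of
the path of `j` is uniform and independent of the path of `i`. -/
theorem sum_crosstalk_le (u : PathDistribution G) (F : CircuitGraph (I × G.V) Empty) {K D : ℕ}
    (hK : F.FanInLE K) (hD : F.DepthLE D) :
    (∑ P : I → RootedPath G, (∏ i, u.weight (P i)) * if Crosstalk F P then 1 else 0) ≤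
      (Fintype.card I : ℝ) ^ 2 * (K + 1) ^ D * ((G.rad : ℝ) / G.size) := by
  let c : I → I → G.V → G.V → ℝ := fun i j v w =>
    if F.NodeInfluences (j, w) (F.out (i, v)) then 1 else 0
  have hc : ∀ i j v w, 0 ≤ c i j v w := fun i j v w => by dsimp only [c]; positivity
  have hcsum : ∀ i j v, ∑ w, c i j v w ≤ (K + 1 : ℝ) ^ D := by
    intro i j v
    rw [Finset.sum_boole]
    have h1 := F.card_nodeInfluences_out_le hK hD (i, v)
    have h2 : (Finset.univ.filter fun w => F.NodeInfluences (j, w) (F.out (i, v))).card ≤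
        (Finset.univ.filter fun a => F.NodeInfluences a (F.out (i, v))).card :=
      Finset.card_le_card_of_injOn (fun w => (j, w)) (fun w hw => by simpa using hw)
        (fun w _ w' _ h => by simpa using h)
    exact_mod_cast h2.trans h1
  -- The indicator of crosstalk is at most the number of its witnesses.
  have hind : ∀ P : I → RootedPath G, (if Crosstalk F P then (1 : ℝ) else 0) ≤
      ∑ i, ∑ j, if i = j then 0 else ∑ v, ∑ w, c i j v w *
        ((if v ∈ (P i).2.1.support then 1 else 0) * if (P j).1 = w then 1 else 0) := by
    intro P
    have h0 : ∀ i j v w, 0 ≤ c i j v w *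
        ((if v ∈ (P i).2.1.support then 1 else 0) * if (P j).1 = w then 1 else 0) :=
      fun i j v w => mul_nonneg (hc _ _ _ _) (by positivity)
    have h1 : ∀ i j, 0 ≤ if i = j then 0 else ∑ v, ∑ w, c i j v w *
        ((if v ∈ (P i).2.1.support then 1 else 0) * if (P j).1 = w then 1 else 0) := by
      intro i j
      split_ifs
      · exact le_rfl
      · exact Finset.sum_nonneg fun v _ => Finset.sum_nonneg fun w _ => h0 i j v w
    split_ifs with h
    · obtain ⟨i, j, hij, v, hv, hn⟩ := h
      refine le_trans ?_ (Finset.single_le_sum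
        (fun i _ => Finset.sum_nonneg fun j _ => h1 i j) (Finset.mem_univ i))
      refine le_trans ?_ (Finset.single_le_sum (fun j _ => h1 i j) (Finset.mem_univ j))
      rw [if_neg hij]
      refine le_trans ?_ (Finset.single_le_sum
        (fun v _ => Finset.sum_nonneg fun w _ => h0 i j v w) (Finset.mem_univ v))
      refine le_trans ?_ (Finset.single_le_sum
        (fun w _ => h0 i j v w) (Finset.mem_univ (P j).1))
      simp [c, hv, hn]
    · exact Finset.sum_nonneg fun i _ => Finset.sum_nonneg fun j _ => h1 i j
  have hpair : ∀ i j, (∑ P : I → RootedPath G, (∏ l, u.weight (P l)) *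
      if i = j then 0 else ∑ v, ∑ w, c i j v w *
        ((if v ∈ (P i).2.1.support then 1 else 0) * if (P j).1 = w then 1 else 0)) ≤
      (K + 1) ^ D * ((G.rad : ℝ) / G.size) := by
    intro i j
    by_cases hij : i = j
    · simp only [hij, if_true, mul_zero, Finset.sum_const_zero]
      positivity
    · simp only [hij, if_false]
      calc _ = ∑ v, ∑ w, c i j v w * ((∑ A, u.weight A * (if v ∈ A.2.1.support then 1 else 0)) *
              (1 / (G.size : ℝ))) := by
            -- Independence of the paths of `i` and `j` splits the probability; the factor `1 / |G|`
            -- is that of the path of `j` ending at `w`, for any `w`.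
            have e : ∀ v w, (∑ A, u.weight A * (if v ∈ A.2.1.support then 1 else 0)) *
                (1 / (G.size : ℝ)) = ∑ P : I → RootedPath G, (∏ l, u.weight (P l)) *
                ((if v ∈ (P i).2.1.support then 1 else 0) * if (P j).1 = w then 1 else 0) := by
              intro v w
              rw [← sum_weight_mul_ite_end u w, ← sum_prod_pathWeight_mul u hij
                (fun A => if v ∈ A.2.1.support then 1 else 0) (fun A => if A.1 = w then 1 else 0)]
            refine Eq.trans ?_ (Finset.sum_congr rfl fun v _ => Finset.sum_congr rfl fun w _ =>
              congrArg (c i j v w * ·) (e v w).symm)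
            simp only [Finset.mul_sum]
            rw [Finset.sum_comm]
            refine Finset.sum_congr rfl fun v _ => ?_
            rw [Finset.sum_comm]
            refine Finset.sum_congr rfl fun w _ => Finset.sum_congr rfl fun P _ => ?_
            ring
        _ ≤ ∑ v, (K + 1) ^ D * ((∑ A, u.weight A * (if v ∈ A.2.1.support then 1 else 0)) *
              (1 / (G.size : ℝ))) := by
            refine Finset.sum_le_sum fun v _ => ?_
            rw [← Finset.sum_mul]
            refine mul_le_mul_of_nonneg_right (hcsum i j v) (mul_nonneg ?_ (by positivity))
            exact Finset.sum_nonneg fun A _ => mul_nonneg (u.weight_mem.1 A) (by positivity)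
        _ ≤ _ := by
            rw [← Finset.mul_sum, ← Finset.sum_mul, div_eq_mul_one_div (G.rad : ℝ)]
            exact mul_le_mul_of_nonneg_left (mul_le_mul_of_nonneg_right
              (sum_weight_mul_mem_le u) (by positivity)) (by positivity)
  calc _ ≤ ∑ P : I → RootedPath G, (∏ i, u.weight (P i)) *
        ∑ i, ∑ j, if i = j then 0 else ∑ v, ∑ w, c i j v w *
        ((if v ∈ (P i).2.1.support then 1 else 0) * if (P j).1 = w then 1 else 0) :=
        Finset.sum_le_sum fun P _ => mul_le_mul_of_nonneg_left (hind P) (prod_pathWeight_nonneg u P)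
    _ = ∑ i, ∑ j, ∑ P : I → RootedPath G, (∏ l, u.weight (P l)) *
        if i = j then 0 else ∑ v, ∑ w, c i j v w *
        ((if v ∈ (P i).2.1.support then 1 else 0) * if (P j).1 = w then 1 else 0) := by
        simp only [Finset.mul_sum (s := (Finset.univ : Finset I))]
        rw [Finset.sum_comm]
        exact Finset.sum_congr rfl fun i _ => Finset.sum_comm
    _ ≤ ∑ i : I, ∑ j : I, (K + 1) ^ D * ((G.rad : ℝ) / G.size) :=
        Finset.sum_le_sum fun i _ => Finset.sum_le_sum fun j _ => hpair i j
    _ = _ := by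
        simp only [Finset.sum_const, Finset.card_univ, nsmul_eq_mul]
        ring

end

/-! ## Existence of path distributions -/

theorem RootedGraph.exists_path_le_rad (G : RootedGraph) (v : G.V) :
    ∃ P : RootedPath G, P.1 = v ∧ P.numNodes ≤ G.rad := by
  have hne : {K : ℕ | 1 ≤ K ∧ ∀ v : G.V, ∃ P : RootedPath G, P.1 = v ∧ P.numNodes ≤ K}.Nonempty := by
    choose P hP using fun v : G.V => (G.connected.preconnected G.root v).exists_isPath
    -- A crude common bound: the sum of all the node counts dominates each of them. It only serves
    -- to show that the infimum defining the radius is attained.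
    refine ⟨∑ v, ((P v).length + 1) + 1, by omega, fun v => ⟨⟨v, P v, hP v⟩, rfl, ?_⟩⟩
    have := Finset.single_le_sum (f := fun v => (P v).length + 1) (fun _ _ => Nat.zero_le _)
      (Finset.mem_univ v)
    simp only [RootedPath.numNodes]
    omega
  exact (Nat.sInf_mem hne).2 v

/-- One path with at most `rad G` nodes is chosen for each end node, and the chosen paths get equal
weight. -/
theorem nonempty_pathDistribution (G : RootedGraph) : Nonempty (PathDistribution G) := by
  choose P hP hrad using G.exists_path_le_rad
  have hsize : (G.size : ℝ) ≠ 0 := by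
    have : Nonempty G.V := ⟨G.root⟩
    exact Nat.cast_ne_zero.2 Fintype.card_ne_zero
  have key : ∀ A : RootedPath G, (∃ v, A = P v) → A = P A.1 := by
    rintro A ⟨v, rfl⟩
    rw [hP]
  have huni : ∀ v : G.V, ∑ A : RootedPath G,
      (if A.1 = v then (if A = P A.1 then 1 / (G.size : ℝ) else 0) else 0) = 1 / (G.size : ℝ) := by
    intro v
    rw [Finset.sum_eq_single (P v)]
    · rw [if_pos (hP v), if_pos (by rw [hP])]
    · intro A _ hA
      split_ifs with h1 h2
      · exact absurd (by rw [h2, h1]) hA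
      · rfl
      · rfl
    · simp
  refine ⟨⟨fun A => if A = P A.1 then 1 / (G.size : ℝ) else 0,
    ⟨fun A => by positivity, ?_⟩, ?_, huni⟩⟩
  -- The total mass is the uniform end distribution summed over all end nodes.
  · have := Finset.sum_congr (rfl : (Finset.univ : Finset G.V) = _) fun v _ => huni v
    rw [Finset.sum_comm] at this
    simp only [Finset.sum_ite_eq, Finset.mem_univ, if_true] at this
    rw [this]
    simp only [Finset.sum_const, Finset.card_univ, nsmul_eq_mul]
    exact mul_one_div_cancel hsize
  · intro A hA
    by_cases h : A = P A.1
    · rw [h]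
      exact hrad _
    · simp [h] at hA

/-! ## Tensor products of matrices -/

section Tensor

variable {T : Type} [Fintype T] {H : T → Type}

/-- The tensor product of a family of matrices. -/
def tensor (M : ∀ t, Matrix (H t) (H t) ℂ) : Matrix (∀ t, H t) (∀ t, H t) ℂ :=
  fun b b' => ∏ t, M t (b t) (b' t)

theorem tensor_conjTranspose (M : ∀ t, Matrix (H t) (H t) ℂ) :
    (tensor M).conjTranspose = tensor fun t => (M t).conjTranspose := by
  ext b b'
  simp [tensor, Matrix.conjTranspose_apply]

theorem tensor_smul (c : T → ℂ) (M : ∀ t, Matrix (H t) (H t) ℂ) :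
    tensor (fun t => c t • M t) = (∏ t, c t) • tensor M := by
  ext b b'
  simp [tensor, Finset.prod_mul_distrib]

theorem sum_tensor {L : T → Type} [∀ t, Fintype (L t)] (M : ∀ t, L t → Matrix (H t) (H t) ℂ) :
    ∑ l : ∀ t, L t, tensor (fun t => M t (l t)) = tensor fun t => ∑ l, M t l := by
  ext b b'
  simp only [tensor, Matrix.sum_apply]
  exact (Fintype.prod_sum fun t l => M t l (b t) (b' t)).symm

/-- The product state of a family of states. -/
def productState (φ : ∀ t, H t → ℂ) : (∀ t, H t) → ℂ := fun b => ∏ t, φ t (b t)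

variable [∀ t, Fintype (H t)]

theorem tensor_mul (M N : ∀ t, Matrix (H t) (H t) ℂ) :
    tensor M * tensor N = tensor fun t => M t * N t := by
  ext b b'
  simp only [tensor, Matrix.mul_apply, ← Finset.prod_mul_distrib]
  exact (Fintype.prod_sum fun t c => M t (b t) c * N t c (b' t)).symm

theorem tensor_mulVec_productState (M : ∀ t, Matrix (H t) (H t) ℂ) (φ : ∀ t, H t → ℂ) :
    (tensor M).mulVec (productState φ) = productState fun t => (M t).mulVec (φ t) := by
  ext b
  simp only [tensor, productState, Matrix.mulVec, dotProduct, ← Finset.prod_mul_distrib]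
  exact (Fintype.prod_sum fun t c => M t (b t) c * φ t c).symm

theorem dotProduct_productState (φ φ' : ∀ t, H t → ℂ) :
    productState φ ⬝ᵥ productState φ' = ∏ t, φ t ⬝ᵥ φ' t := by
  simp only [productState, dotProduct, ← Finset.prod_mul_distrib]
  exact (Fintype.prod_sum fun t c => φ t c * φ' t c).symm

end Tensor

/-! ## Expectations -/

section Expectation

/-- The expectation `⟨ψ, M ψ⟩`. -/
def expect {B : Type} [Fintype B] (ψ : B → ℂ) (M : Matrix B B ℂ) : ℂ := star ψ ⬝ᵥ M.mulVec ψ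

/-- The expectation of a tensor product of matrices. -/
def tensorExpect {T : Type} [Fintype T] {H : T → Type} [∀ t, Fintype (H t)] (ψ : (∀ t, H t) → ℂ)
    (M : ∀ t, Matrix (H t) (H t) ℂ) : ℂ := expect ψ (tensor M)

theorem tensorExpect_smul {T : Type} [Fintype T] {H : T → Type} [∀ t, Fintype (H t)]
    (ψ : (∀ t, H t) → ℂ) (c : T → ℂ) (M : ∀ t, Matrix (H t) (H t) ℂ) :
    tensorExpect ψ (fun t => c t • M t) = (∏ t, c t) * tensorExpect ψ M := by
  simp [tensorExpect, expect, tensor_smul, Matrix.smul_mulVec]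

variable {B : Type} [Fintype B]

theorem expect_sum {ι : Type} (s : Finset ι) (ψ : B → ℂ) (M : ι → Matrix B B ℂ) :
    expect ψ (∑ i ∈ s, M i) = ∑ i ∈ s, expect ψ (M i) := by
  simp only [expect, Matrix.sum_mulVec, dotProduct_sum]

theorem expect_smul (c : ℂ) (ψ : B → ℂ) (M : Matrix B B ℂ) :
    expect ψ (c • M) = c * expect ψ M := by
  simp [expect, Matrix.smul_mulVec]

theorem ofReal_sum_norm_sq (ψ : B → ℂ) : ((∑ b, ‖ψ b‖ ^ 2 : ℝ) : ℂ) = star ψ ⬝ᵥ ψ := by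
  simp [dotProduct, Complex.conj_mul']

/-- For a projection, `M† M = M`. This makes Born probabilities linear in the projector, so that
weighted sums over outcomes can be moved inside the expectation. -/
theorem norm_sq_mulVec_eq_expect (ψ : B → ℂ) {M : Matrix B B ℂ} (hM : IsStarProjection M) :
    ((∑ b, ‖M.mulVec ψ b‖ ^ 2 : ℝ) : ℂ) = expect ψ M := by
  have h1 : M.conjTranspose = M := hM.isSelfAdjoint
  have h2 : M * M = M := hM.isIdempotentElem
  rw [ofReal_sum_norm_sq, Matrix.star_mulVec, h1, ← Matrix.dotProduct_mulVec, Matrix.mulVec_mulVec,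
    h2, expect]

theorem isStarProjection_tensor {T : Type} [Fintype T] {H : T → Type} [∀ t, Fintype (H t)]
    {M : ∀ t, Matrix (H t) (H t) ℂ} (hM : ∀ t, IsStarProjection (M t)) :
    IsStarProjection (tensor M) where
  isIdempotentElem := by
    rw [IsIdempotentElem, tensor_mul]
    exact congrArg tensor (funext fun t => (hM t).isIdempotentElem)
  isSelfAdjoint := by
    rw [IsSelfAdjoint, Matrix.star_eq_conjTranspose, tensor_conjTranspose]
    exact congrArg tensor (funext fun t => (hM t).isSelfAdjoint)

theorem expect_productState {T : Type} [Fintype T] {H : T → Type} [∀ t, Fintype (H t)]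
    (φ : ∀ t, H t → ℂ) (M : ∀ t, Matrix (H t) (H t) ℂ) :
    expect (productState φ) (tensor M) = ∏ t, expect (φ t) (M t) := by
  have : star (productState φ) = productState fun t => star (φ t) := by
    ext b
    simp [productState]
  rw [expect, this, tensor_mulVec_productState, dotProduct_productState]
  rfl

theorem expect_comp_equiv {B' : Type} [Fintype B'] (e : B' ≃ B) (ψ : B → ℂ) (M : Matrix B B ℂ) :
    expect (fun b => ψ (e b)) (M.submatrix e e) = expect ψ M := by
  simp only [expect, dotProduct, Matrix.mulVec, Matrix.submatrix_apply, Pi.star_apply]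
  rw [← e.sum_comp]
  refine Finset.sum_congr rfl fun b _ => ?_
  rw [← e.sum_comp (fun b' => M (e b) b' * ψ b')]

end Expectation

/-! ## Registers partitioned into sites -/

section Fiber

variable {Q T : Type} [Fintype Q]

/-- The qudits at site `t`. -/
abbrev fiber (f : Q → T) (t : T) : Finset Q := Finset.univ.filter fun q => f q = t

/-- Basis states of the register as families of basis states of the sites. -/
def glue (f : Q → T) (Z : Type) : (∀ t, (fiber f t → Z)) ≃ (Q → Z) where
  toFun b q := b (f q) ⟨q, by simp⟩
  invFun b t q := b q
  left_inv b := by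
    funext t ⟨q, hq⟩
    obtain rfl : f q = t := by simpa using hq
    rfl
  right_inv b := rfl

theorem sum_fiber [Fintype T] {M : Type} [AddCommMonoid M] (f : Q → T) (g : Q → M) :
    ∑ t, ∑ q : fiber f t, g q = ∑ q, g q := by
  rw [← Finset.sum_fiberwise Finset.univ f g]
  exact Finset.sum_congr rfl fun t _ => Finset.sum_coe_sort (fiber f t) g

end Fiber

/-! ## Weyl operators on several qudits -/

section MultiWeyl

variable {d : ℕ} [NeZero d]

theorem stdAddChar_sum {ι : Type} (s : Finset ι) (f : ι → ZMod d) :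
    (ZMod.stdAddChar (∑ i ∈ s, f i) : ℂ) = ∏ i ∈ s, ZMod.stdAddChar (f i) := by
  induction s using Finset.induction_on with
  | empty => simp
  | insert i s hi ih => rw [Finset.sum_insert hi, Finset.prod_insert hi, AddChar.map_add_eq_mul, ih]

/-- The tensor product of the Weyl operators `W(l i)`. -/
def multiWeyl {X : Type} [Fintype X] (l : X → ZMod d × ZMod d) :
    Matrix (X → ZMod d) (X → ZMod d) ℂ :=
  fun b b' => if b = b' + (fun i => (l i).1) then ZMod.stdAddChar (∑ i, b' i * (l i).2) else 0

variable {X : Type} [Fintype X] [DecidableEq X]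

/-- The phase arises because the left factor acts on basis states already shifted by the right one.
It is bilinear in the labels and additive over the qudits, so the contributions of different qudits
can cancel. -/
theorem multiWeyl_mul (l l' : X → ZMod d × ZMod d) :
    multiWeyl l * multiWeyl l' =
      (ZMod.stdAddChar (∑ i, (l' i).1 * (l i).2) : ℂ) • multiWeyl (l + l') := by
  ext b b'
  rw [Matrix.mul_apply, Finset.sum_eq_single (b' + fun i => (l' i).1)]
  · simp only [multiWeyl, Matrix.smul_apply, if_true, smul_eq_mul]
    have h : b = b' + (fun i => (l' i).1) + (fun i => (l i).1) ↔
        b = b' + fun i => ((l + l') i).1 := by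
      constructor <;> (rintro rfl; funext i; simp; ring)
    by_cases hb : b = b' + fun i => ((l + l') i).1
    · rw [if_pos hb, if_pos (h.2 hb), ← AddChar.map_add_eq_mul, ← AddChar.map_add_eq_mul]
      congr 1
      simp only [← Finset.sum_add_distrib]
      refine Finset.sum_congr rfl fun i _ => ?_
      simp
      ring
    · rw [if_neg hb, if_neg (fun hc => hb (h.1 hc)), zero_mul, mul_zero]
  · intro c _ hc
    simp [multiWeyl, hc]
  · simp

omit [DecidableEq X] in
theorem multiWeyl_zero [DecidableEq (X → ZMod d)] : multiWeyl (0 : X → ZMod d × ZMod d) = 1 := by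
  ext b b'
  have : b' + (fun _ : X => (0 : ZMod d)) = b' := by funext i; simp
  simp [multiWeyl, Matrix.one_apply, this]

omit [DecidableEq X] in
theorem multiWeyl_conjTranspose (l : X → ZMod d × ZMod d) :
    (multiWeyl l).conjTranspose =
      (ZMod.stdAddChar (∑ i, (l i).1 * (l i).2) : ℂ) • multiWeyl (-l) := by
  ext b b'
  simp only [multiWeyl, Matrix.conjTranspose_apply, Matrix.smul_apply, smul_eq_mul]
  have h : b' = b + (fun i => (l i).1) ↔ b = b' + fun i => ((-l) i).1 := by
    constructor <;> (rintro rfl; funext i; simp)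
  by_cases hb : b' = b + (fun i => (l i).1)
  · rw [if_pos hb, if_pos (h.1 hb), ← AddChar.map_add_eq_mul]
    change (starRingEnd ℂ) _ = _
    rw [← AddChar.map_neg_eq_conj]
    congr 1
    subst hb
    simp only [← Finset.sum_add_distrib, ← Finset.sum_neg_distrib]
    refine Finset.sum_congr rfl fun i _ => ?_
    simp
    ring
  · rw [if_neg hb, if_neg (fun hc => hb (h.2 hc))]
    simp

theorem multiWeyl_unitary [DecidableEq (X → ZMod d)] (l : X → ZMod d × ZMod d) :
    (multiWeyl l).conjTranspose * multiWeyl l = 1 := by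
  rw [multiWeyl_conjTranspose, smul_mul_assoc, multiWeyl_mul, smul_smul, ← AddChar.map_add_eq_mul,
    ← Finset.sum_add_distrib, neg_add_cancel, multiWeyl_zero]
  simp

/-- The Weyl operator on a partitioned register. -/
theorem multiWeyl_glue {Q T : Type} [Fintype Q] [Fintype T] (f : Q → T)
    (l : Q → ZMod d × ZMod d) :
    (multiWeyl l).submatrix (glue f (ZMod d)) (glue f (ZMod d)) =
      tensor fun t => multiWeyl fun q : fiber f t => l q := by
  ext b b'
  simp only [Matrix.submatrix_apply, tensor, multiWeyl]
  have h : glue f (ZMod d) b = glue f (ZMod d) b' + (fun q => (l q).1) ↔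
      ∀ t, b t = b' t + fun q : fiber f t => (l q).1 := by
    rw [← (glue f (ZMod d)).symm.injective.eq_iff, Equiv.symm_apply_apply, funext_iff]
    refine forall_congr' fun t => Eq.congr rfl ?_
    funext ⟨q, hq⟩
    obtain rfl : f q = t := by simpa using hq
    rfl
  by_cases hb : glue f (ZMod d) b = glue f (ZMod d) b' + (fun q => (l q).1)
  · rw [if_pos hb, Finset.prod_congr rfl fun t _ => if_pos (h.1 hb t), ← stdAddChar_sum,
      ← sum_fiber f]
    congr 1
    refine Finset.sum_congr rfl fun t _ => Finset.sum_congr rfl fun ⟨q, hq⟩ _ => ?_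
    obtain rfl : f q = t := by simpa using hq
    rfl
  · rw [if_neg hb]
    have hb' : ¬ ∀ t, b t = b' t + fun q : fiber f t => (l q).1 := fun hc => hb (h.2 hc)
    push Not at hb'
    obtain ⟨t, ht⟩ := hb'
    exact (Finset.prod_eq_zero (Finset.mem_univ t) (if_neg ht)).symm

omit [DecidableEq X] in
theorem tensor_weyl (l : X → ZMod d × ZMod d) :
    tensor (fun i => weyl d (l i)) = multiWeyl l := by
  ext b b'
  simp only [tensor, multiWeyl, weyl]
  by_cases hb : b = b' + (fun i => (l i).1)
  · rw [if_pos hb, stdAddChar_sum]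
    exact Finset.prod_congr rfl fun i _ => if_pos (congrFun hb i)
  · rw [if_neg hb]
    have hb' : ¬ ∀ i, b i = b' i + (l i).1 := fun hc => hb (funext hc)
    push Not at hb'
    obtain ⟨t, ht⟩ := hb'
    exact Finset.prod_eq_zero (Finset.mem_univ t) (if_neg ht)

end MultiWeyl

/-! ## Fourier projectors of a unitary representation -/

section Fourier

variable {d : ℕ} [NeZero d] {A O B : Type} [AddCommGroup A] [Fintype A] [Fintype O] [Fintype B]

/-- A unitary representation of a finite abelian group. -/
structure IsUnitaryRep (U : A → Matrix B B ℂ) : Prop where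
  map_zero : U 0 = 1
  map_add : ∀ a b, U (a + b) = U a * U b
  unitary : ∀ a, (U a).conjTranspose * U a = 1

/-- A family of characters of `A`, orthogonal in the sense that each nontrivial element of `A` is
averaged out. -/
structure IsPairing (e : A → O → ZMod d) : Prop where
  map_add : ∀ a b o, e (a + b) o = e a o + e b o
  sum_eq : ∀ a, ∑ o, (ZMod.stdAddChar (e a o) : ℂ) = if a = 0 then (Fintype.card A : ℂ) else 0

/-- The spectral projectors of a unitary representation. -/
def fourierProj (e : A → O → ZMod d) (U : A → Matrix B B ℂ) (o : O) : Matrix B B ℂ :=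
  (Fintype.card A : ℂ)⁻¹ • ∑ a, (ZMod.stdAddChar (e a o) : ℂ) • U a

variable {e : A → O → ZMod d} {U : A → Matrix B B ℂ}

omit [Fintype A] in
theorem IsUnitaryRep.conjTranspose (hU : IsUnitaryRep U) (a : A) :
    (U a).conjTranspose = U (-a) := by
  have h : U a * U (-a) = 1 := by rw [← hU.map_add, add_neg_cancel, hU.map_zero]
  calc (U a).conjTranspose = (U a).conjTranspose * (U a * U (-a)) := by rw [h, mul_one]
    _ = U (-a) := by rw [← mul_assoc, hU.unitary, one_mul]

theorem IsPairing.map_zero (he : IsPairing e) (o : O) : e 0 o = 0 := by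
  simpa using he.map_add 0 0 o

theorem IsPairing.map_neg (he : IsPairing e) (a : A) (o : O) : e (-a) o = -e a o := by
  have := he.map_add (-a) a o
  rw [neg_add_cancel, he.map_zero] at this
  exact eq_neg_of_add_eq_zero_left this.symm

omit [Fintype B] in
-- Fourier inversion, from orthogonality of characters. It is the mechanism of the teleportation
-- argument: weighting outcomes by a character collapses a measurement to one unitary.
theorem sum_stdAddChar_smul_fourierProj (he : IsPairing e) (a : A) :
    ∑ o, (ZMod.stdAddChar (-e a o) : ℂ) • fourierProj e U o = U a := by
  have hA : (Fintype.card A : ℂ) ≠ 0 := Nat.cast_ne_zero.2 Fintype.card_ne_zero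
  simp only [fourierProj, Finset.smul_sum, smul_smul]
  rw [Finset.sum_comm]
  have h : ∀ b, ∑ o, (ZMod.stdAddChar (-e a o) * ((Fintype.card A : ℂ)⁻¹ *
      ZMod.stdAddChar (e b o))) • U b = if b = a then U b else 0 := by
    intro b
    rw [← Finset.sum_smul]
    have : ∀ o, (ZMod.stdAddChar (-e a o) : ℂ) * ((Fintype.card A : ℂ)⁻¹ *
        ZMod.stdAddChar (e b o)) = (Fintype.card A : ℂ)⁻¹ * ZMod.stdAddChar (e (b - a) o) := by
      intro o
      rw [sub_eq_add_neg, he.map_add, he.map_neg, AddChar.map_add_eq_mul]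
      ring
    simp only [this]
    rw [← Finset.mul_sum, he.sum_eq]
    by_cases hb : b = a
    · simp [hb, hA]
    · simp [hb, sub_eq_zero]
  simp [h]

theorem isProjectiveMeasurement_fourierProj (he : IsPairing e) (hU : IsUnitaryRep U) :
    IsProjectiveMeasurement (fourierProj e U) := by
  have hA : (Fintype.card A : ℂ) ≠ 0 := Nat.cast_ne_zero.2 Fintype.card_ne_zero
  refine ⟨fun o => ⟨?_, ?_⟩, ?_⟩
  · simp only [IsIdempotentElem, fourierProj, smul_mul_smul_comm]
    rw [Finset.sum_mul_sum]
    -- Multiplication by the term of `a` only translates the summation index, so each of the `card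
    -- A` inner sums equals the same sum.
    have h : ∀ a, ∑ b, ((ZMod.stdAddChar (e a o) : ℂ) • U a) *
        ((ZMod.stdAddChar (e b o) : ℂ) • U b) = ∑ b, (ZMod.stdAddChar (e b o) : ℂ) • U b := by
      intro a
      refine Eq.trans ?_ (Equiv.sum_comp (Equiv.addLeft a) _)
      refine Finset.sum_congr rfl fun b _ => ?_
      rw [smul_mul_smul_comm, Equiv.coe_addLeft, hU.map_add, he.map_add, AddChar.map_add_eq_mul]
    simp only [h, Finset.sum_const, Finset.card_univ]
    rw [← Nat.cast_smul_eq_nsmul ℂ, smul_smul, mul_assoc, inv_mul_cancel₀ hA, mul_one]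
  -- Adjoints replace `a` by `-a` both in the representation and in the character, which the
  -- reindexing undoes.
  · rw [IsSelfAdjoint, Matrix.star_eq_conjTranspose, fourierProj, Matrix.conjTranspose_smul,
      Matrix.conjTranspose_sum, ← Equiv.sum_comp (Equiv.neg A)]
    congr 1
    · simp
    · refine Finset.sum_congr rfl fun a _ => ?_
      rw [Matrix.conjTranspose_smul, hU.conjTranspose, Equiv.neg_apply, neg_neg, he.map_neg,
        AddChar.map_neg_eq_conj]
      simp
  -- Completeness is Fourier inversion at the neutral element.
  · have := sum_stdAddChar_smul_fourierProj (U := U) he 0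
    simpa [he.map_zero, hU.map_zero] using this

end Fourier

/-! ## The two pairings -/

section Pairing

variable {d : ℕ} [NeZero d]

theorem sum_stdAddChar_mul (k : ZMod d) :
    ∑ q : ZMod d, (ZMod.stdAddChar (q * k) : ℂ) = if k = 0 then (d : ℂ) else 0 := by
  rw [AddChar.sum_mulShift k (ZMod.isPrimitive_stdAddChar d), ZMod.card]
  simp

theorem isPairing_mul : IsPairing (d := d) (fun k q : ZMod d => -(q * k)) where
  map_add a b o := by ring
  sum_eq k := by
    simp only [← mul_neg]
    rw [sum_stdAddChar_mul, ZMod.card]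
    simp

/-- The character sum of the symplectic form splits into two character sums over `ZMod d`, which
vanish unless both components of `c` do. -/
theorem isPairing_bracket : IsPairing (d := d) (bracket d) where
  map_add a b o := by simp only [bracket, Prod.fst_add, Prod.snd_add]; ring
  sum_eq c := by
    have h : ∀ o : ZMod d × ZMod d, (ZMod.stdAddChar (bracket d c o) : ℂ) =
        ZMod.stdAddChar (o.1 * c.2) * ZMod.stdAddChar (o.2 * -c.1) := by
      intro o
      rw [← AddChar.map_add_eq_mul]
      congr 1
      simp only [bracket]
      ring
    simp only [h]
    rw [Fintype.sum_prod_type]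
    simp only [← Finset.mul_sum, ← Finset.sum_mul, sum_stdAddChar_mul]
    rw [Fintype.card_prod, ZMod.card, Prod.ext_iff]
    by_cases h1 : c.1 = 0 <;> by_cases h2 : c.2 = 0 <;> simp [h1, h2]

end Pairing

/-! ## Powers of Weyl operators -/

section WeylPower

variable {d : ℕ} [NeZero d]

theorem weyl_mul (p p' : ZMod d × ZMod d) :
    weyl d p * weyl d p' = (ZMod.stdAddChar (p'.1 * p.2) : ℂ) • weyl d (p + p') := by
  ext b b'
  rw [Matrix.mul_apply, Finset.sum_eq_single (b' + p'.1)]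
  · simp only [weyl, Matrix.smul_apply, if_true, smul_eq_mul]
    have h : b = b' + p'.1 + p.1 ↔ b = b' + (p + p').1 := by
      rw [Prod.fst_add, add_assoc, add_comm p'.1]
    by_cases hb : b = b' + (p + p').1
    · rw [if_pos hb, if_pos (h.2 hb), ← AddChar.map_add_eq_mul, ← AddChar.map_add_eq_mul]
      congr 1
      rw [Prod.snd_add]
      ring
    · rw [if_neg hb, if_neg (fun hc => hb (h.1 hc)), zero_mul, mul_zero]
  · intro c _ hc
    simp [weyl, hc]
  · simp

theorem weyl_zero : weyl d 0 = 1 := by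
  ext b b'
  simp [weyl, Matrix.one_apply]

/-- The entry at `(p.1, 0)` of a Weyl operator is `1`. Scalar identities can thus be read off from
matrix identities, as in `weylPhase_add`. -/
theorem smul_weyl_injective (p : ZMod d × ZMod d) :
    Function.Injective fun c : ℂ => c • weyl d p := by
  intro c c' h
  have := congrFun (congrFun h p.1) 0
  simpa [weyl] using this

/-- The scalar by which `weylObs d p ^ n` differs from `weyl d (n • p)`. -/
def weylPhase (p : ZMod d × ZMod d) (n : ℕ) : ℂ :=
  (if Even d ∧ Odd p.1.val ∧ Odd p.2.val then Complex.exp (Real.pi * Complex.I / d) else 1) ^ n *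
    ZMod.stdAddChar ((n.choose 2 : ZMod d) * (p.1 * p.2))

theorem weylObs_pow_eq (p : ZMod d × ZMod d) (n : ℕ) :
    weylObs d p ^ n = weylPhase p n • weyl d (n • p) := by
  induction n with
  | zero => simp [weylPhase, weyl_zero]
  | succ n ih =>
    rw [pow_succ, ih, weylObs, smul_mul_smul_comm, weyl_mul, smul_smul, ← succ_nsmul]
    congr 1
    rw [weylPhase, weylPhase, pow_succ, Nat.choose_succ_succ' n 1, Nat.choose_one_right,
      Nat.cast_add, add_mul, AddChar.map_add_eq_mul]
    have : p.1 * (n • p).2 = (n : ZMod d) * (p.1 * p.2) := by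
      rw [Prod.smul_snd, nsmul_eq_mul]
      ring
    rw [this]
    ring

/-- For `d = 2m` one has `ω ^ m = -1`. -/
theorem stdAddChar_half_mul (m n : ℕ) (hd : d = m + m) :
    (ZMod.stdAddChar (((m * n : ℕ) : ZMod d)) : ℂ) = (-1) ^ n := by
  have h := ZMod.stdAddChar_coe (N := d) ((m * n : ℕ) : ℤ)
  rw [Int.cast_natCast] at h
  rw [h, ← Complex.exp_pi_mul_I, ← Complex.exp_nat_mul]
  congr 1
  have hm : (m : ℂ) ≠ 0 := by
    intro hm
    have : m = 0 := by exact_mod_cast hm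
    exact NeZero.ne d (by omega)
  rw [hd]
  push_cast
  field_simp
  ring

/-- For odd `d` the exponent `d.choose 2` is a multiple of `d`. For `d = 2m` it is `m (d - 1)` with
`d - 1` odd, so the Weyl operator contributes the sign `(-1) ^ (p₁ p₂)`. This is `-1` exactly when
both components are odd, and then `exp (πi/d) ^ d = -1` cancels it. -/
theorem weylPhase_self (p : ZMod d × ZMod d) : weylPhase p d = 1 := by
  have hd0 : (d : ℂ) ≠ 0 := Nat.cast_ne_zero.2 (NeZero.ne d)
  rcases Nat.even_or_odd d with hd | hd
  · obtain ⟨m, hm⟩ := id hd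
    have hm0 : m ≠ 0 := fun h => NeZero.ne d (by omega)
    have hch : d.choose 2 = m * (d - 1) := by
      rw [Nat.choose_two_right, hm, ← two_mul, mul_assoc, Nat.mul_div_cancel_left _ (by norm_num)]
    have hcast : ((d.choose 2 : ZMod d)) * (p.1 * p.2) =
        ((m * ((d - 1) * (p.1.val * p.2.val)) : ℕ) : ZMod d) := by
      rw [hch]
      push_cast
      rw [ZMod.natCast_zmod_val, ZMod.natCast_zmod_val]
      ring
    have hodd : Odd (d - 1) := ⟨m - 1, by omega⟩
    rw [weylPhase, hcast, stdAddChar_half_mul m _ hm]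
    by_cases h : Odd p.1.val ∧ Odd p.2.val
    · rw [if_pos ⟨hd, h⟩, ← Complex.exp_nat_mul, mul_div_cancel₀ _ hd0, Complex.exp_pi_mul_I,
        (hodd.mul (h.1.mul h.2)).neg_one_pow]
      norm_num
    · rw [if_neg (fun hc => h hc.2), one_pow, one_mul]
      refine Even.neg_one_pow (Even.mul_left ?_ _)
      rw [Nat.even_mul]
      by_contra hc
      simp only [not_or, Nat.not_even_iff_odd] at hc
      exact h hc
  · obtain ⟨m, hm⟩ := id hd
    have hch : d.choose 2 = d * m := by
      rw [Nat.choose_two_right]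
      have : d - 1 = 2 * m := by omega
      rw [this, mul_left_comm, Nat.mul_div_cancel_left _ (by norm_num)]
    rw [weylPhase, if_neg (fun hc => Nat.not_even_iff_odd.2 hd hc.1), hch]
    simp

theorem weylObs_pow_self (p : ZMod d × ZMod d) : weylObs d p ^ d = 1 := by
  rw [weylObs_pow_eq, weylPhase_self, one_smul]
  have : d • p = 0 := by ext <;> simp
  rw [this, weyl_zero]

theorem val_nsmul (k : ZMod d) (p : ZMod d × ZMod d) : k.val • p = k • p := by
  ext <;> simp

/-- The powers of `weylObs` have period `d`, so they form a representation of `ZMod d`; comparing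
coefficients of Weyl operators gives the cocycle identity of the phases. As an identity of scalars
it applies equally to a Weyl operator embedded in a larger register. -/
theorem weylPhase_add (p : ZMod d × ZMod d) (k l : ZMod d) :
    weylPhase p (k + l).val =
      weylPhase p k.val * weylPhase p l.val * ZMod.stdAddChar ((l • p).1 * (k • p).2) := by
  apply smul_weyl_injective ((k + l) • p)
  simp only
  have h : weylObs d p ^ (k + l).val = weylObs d p ^ k.val * weylObs d p ^ l.val := by
    rw [← pow_add, ZMod.val_add]
    exact (pow_eq_pow_mod _ (weylObs_pow_self p)).symm
  rw [weylObs_pow_eq, weylObs_pow_eq, weylObs_pow_eq, smul_mul_smul_comm, weyl_mul, smul_smul,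
    val_nsmul, val_nsmul, val_nsmul, ← add_smul] at h
  exact h

theorem weylPhase_zero (p : ZMod d × ZMod d) : weylPhase p 0 = 1 := by
  simp [weylPhase]

theorem star_weylPhase_mul (p : ZMod d × ZMod d) (n : ℕ) :
    star (weylPhase p n) * weylPhase p n = 1 := by
  have h : ‖weylPhase p n‖ = 1 := by
    rw [weylPhase, norm_mul, norm_pow, AddChar.norm_apply, mul_one]
    split_ifs
    · have : (Real.pi * Complex.I / d : ℂ) = ((Real.pi / d : ℝ) : ℂ) * Complex.I := by
        push_cast
        ring
      rw [this, Complex.norm_exp_ofReal_mul_I, one_pow]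
    · simp
  change (starRingEnd ℂ) _ * _ = 1
  rw [Complex.conj_mul', h]
  simp

theorem weylProj_eq_sum (p : ZMod d × ZMod d) (q : ZMod d) :
    weylProj d p q = (d : ℂ)⁻¹ • ∑ k : ZMod d, (ZMod.stdAddChar (-(q * k)) : ℂ) •
      (weylPhase p k.val • weyl d (k • p)) := by
  simp only [weylProj, weylObs_pow_eq, val_nsmul]

end WeylPower

/-! ## Weyl and Bell measurements on the qudits of a register -/

section Port

variable {d : ℕ} [NeZero d] {X : Type} [Fintype X] [DecidableEq X]

/-- The labels of a Weyl operator at `o`. -/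
def weylLabel (o : X) (c : ZMod d × ZMod d) : X → ZMod d × ZMod d := Pi.single o c

/-- The labels of the stabiliser `W(c) ⊗ W(c₁, -c₂)` of the Bell state of `o` and `o'`. -/
def bellLabel (o o' : X) (c : ZMod d × ZMod d) : X → ZMod d × ZMod d :=
  Pi.single o c + Pi.single o' (c.1, -c.2)

/-- The Weyl measurement `p` of the qudit `o`. -/
def portWeyl (o : X) (p : ZMod d × ZMod d) : ZMod d → Matrix (X → ZMod d) (X → ZMod d) ℂ :=
  fourierProj (fun k q : ZMod d => -(q * k))
    fun k => weylPhase p k.val • multiWeyl (weylLabel o (k • p))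

/-- The Bell measurement of the qudits `o` and `o'`. -/
def portBell (o o' : X) : ZMod d × ZMod d → Matrix (X → ZMod d) (X → ZMod d) ℂ :=
  fourierProj (bracket d) fun c => multiWeyl (bellLabel o o' c)

omit [NeZero d] in
theorem sum_weylLabel_mul (o : X) (c c' : ZMod d × ZMod d) :
    ∑ i, (weylLabel o c i).1 * (weylLabel o c' i).2 = c.1 * c'.2 := by
  rw [Finset.sum_eq_single o]
  · simp [weylLabel]
  · intro b _ hb
    simp [weylLabel, hb]
  · simp

theorem isUnitaryRep_portWeyl (o : X) (p : ZMod d × ZMod d) :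
    IsUnitaryRep fun k : ZMod d => weylPhase p k.val • multiWeyl (weylLabel o (k • p)) where
  map_zero := by
    have : weylLabel o (0 : ZMod d × ZMod d) = 0 := by simp [weylLabel]
    rw [zero_smul, this, ZMod.val_zero, weylPhase_zero, one_smul]
    convert multiWeyl_zero (X := X)
  map_add k l := by
    have : weylLabel o ((k + l) • p) = weylLabel o (k • p) + weylLabel o (l • p) := by
      rw [add_smul, weylLabel, Pi.single_add]
      rfl
    rw [smul_mul_smul_comm, multiWeyl_mul, smul_smul, sum_weylLabel_mul, ← this, weylPhase_add]
  unitary k := by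
    rw [Matrix.conjTranspose_smul, smul_mul_smul_comm, star_weylPhase_mul, one_smul]
    convert multiWeyl_unitary (weylLabel o (k • p))

theorem isUnitaryRep_portBell {o o' : X} (h : o ≠ o') :
    IsUnitaryRep fun c : ZMod d × ZMod d => multiWeyl (bellLabel o o' c) where
  map_zero := by
    have : bellLabel o o' (0 : ZMod d × ZMod d) = 0 := by
      have : ((0 : ZMod d × ZMod d).1, -(0 : ZMod d × ZMod d).2) = 0 := by ext <;> simp
      rw [bellLabel, this, Pi.single_zero, Pi.single_zero, add_zero]
    rw [this]
    convert multiWeyl_zero (X := X)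
  map_add c c' := by
    have h1 : bellLabel o o' (c + c') = bellLabel o o' c + bellLabel o o' c' := by
      have : ((c + c').1, -(c + c').2) = (c.1, -c.2) + (c'.1, -c'.2) := by
        ext <;> simp [add_comm]
      rw [bellLabel, this, Pi.single_add, Pi.single_add, bellLabel, bellLabel]
      abel
    -- The qudits `o` and `o'` contribute `c'₁ c₂` and `-c'₁ c₂`. The two cancel, so Bell
    -- measurements need no phase correction, whether `d` is even or odd.
    have h2 : ∑ i, (bellLabel o o' c' i).1 * (bellLabel o o' c i).2 = 0 := by
      rw [← Finset.sum_subset (Finset.subset_univ {o, o'}), Finset.sum_pair h]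
      · simp [bellLabel, h, h.symm]
      · intro i _ hi
        simp only [Finset.mem_insert, Finset.mem_singleton, not_or] at hi
        simp [bellLabel, hi.1, hi.2]
    rw [multiWeyl_mul, h2, h1]
    simp
  unitary c := by convert multiWeyl_unitary (bellLabel o o' c)

theorem isProjectiveMeasurement_portWeyl (o : X) (p : ZMod d × ZMod d) :
    IsProjectiveMeasurement (portWeyl o p) :=
  isProjectiveMeasurement_fourierProj isPairing_mul (isUnitaryRep_portWeyl o p)

theorem isProjectiveMeasurement_portBell {o o' : X} (h : o ≠ o') :
    IsProjectiveMeasurement (portBell (d := d) o o') :=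
  isProjectiveMeasurement_fourierProj isPairing_bracket (isUnitaryRep_portBell h)

theorem sum_stdAddChar_smul_portWeyl (o : X) (p : ZMod d × ZMod d) (k : ZMod d) :
    ∑ q, (ZMod.stdAddChar (k * q) : ℂ) • portWeyl o p q =
      weylPhase p k.val • multiWeyl (weylLabel o (k • p)) := by
  have := sum_stdAddChar_smul_fourierProj (d := d)
    (U := fun k => weylPhase p k.val • multiWeyl (weylLabel o (k • p))) isPairing_mul k
  rw [← this]
  refine Finset.sum_congr rfl fun q _ => ?_
  rw [neg_neg, mul_comm]
  rfl

/-- By bilinearity, the character of weight `k` of the correction `-[p, a]` is the one belonging to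
`k • p`, and Fourier inversion applies. -/
theorem sum_stdAddChar_smul_portBell (o o' : X) (p : ZMod d × ZMod d) (k : ZMod d) :
    ∑ a, (ZMod.stdAddChar (k * -bracket d p a) : ℂ) • portBell o o' a =
      multiWeyl (bellLabel o o' (k • p)) := by
  have := sum_stdAddChar_smul_fourierProj (d := d)
    (U := fun c => multiWeyl (bellLabel o o' c)) isPairing_bracket (k • p)
  rw [← this]
  refine Finset.sum_congr rfl fun q _ => ?_
  have : k * -bracket d p q = -bracket d (k • p) q := by
    simp only [bracket, Prod.smul_fst, Prod.smul_snd, smul_eq_mul]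
    ring
  rw [this]
  rfl

end Port

theorem weylProj_eq_fourierProj {d : ℕ} [NeZero d] (p : ZMod d × ZMod d) :
    weylProj d p = fourierProj (fun k q : ZMod d => -(q * k))
      fun k => weylPhase p k.val • weyl d (k • p) := by
  funext q
  rw [weylProj_eq_sum, fourierProj, ZMod.card]

/-! ## Quantum models in terms of replies -/

section Model

variable {S : Scenario} {H : S.Site → Type} [∀ i, Fintype (H i)]

/-- The operator of a reply. -/
def replyOp (π : (i : S.Site) → (x : S.Setting i) → S.Outcome i x → Matrix (H i) (H i) ℂ)
    (i : S.Site) : Reply S i → Matrix (H i) (H i) ℂ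
  | none => 1
  | some r => π i r.1 r.2

variable (π : (i : S.Site) → (x : S.Setting i) → S.Outcome i x → Matrix (H i) (H i) ℂ)

theorem siteOp_eq_replyOp {C : Context S} (s : LocalSection S C) (i : S.Site) :
    siteOp π C s i = replyOp π i (s.reply i) := by
  unfold siteOp
  split
  · rename_i h
    rw [s.reply_of_none h]
    rfl
  · rename_i x h
    rw [s.reply_of_some h]
    rfl

theorem quantumBehaviour_eq (ψ : ((i : S.Site) → H i) → ℂ) (C : Context S)
    (s : LocalSection S C) : quantumBehaviour S π ψ C s =
      ∑ b, ‖(tensor fun i => replyOp π i (s.reply i)).mulVec ψ b‖ ^ 2 := by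
  simp only [quantumBehaviour, siteOp_eq_replyOp]
  rfl

variable {π} in
theorem isStarProjection_replyOp (hπ : ∀ i x, IsProjectiveMeasurement (π i x)) (i : S.Site)
    (r : Reply S i) : IsStarProjection (replyOp π i r) := by
  cases r with
  | none => exact IsStarProjection.one _
  | some r => exact (hπ i r.1).1 r.2

variable {π} in
theorem quantumBehaviour_eq_expect (hπ : ∀ i x, IsProjectiveMeasurement (π i x))
    (ψ : ((i : S.Site) → H i) → ℂ) (C : Context S) (s : LocalSection S C) :
    (quantumBehaviour S π ψ C s : ℂ) = expect ψ (tensor fun i => replyOp π i (s.reply i)) := by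
  rw [quantumBehaviour_eq, norm_sq_mulVec_eq_expect]
  exact isStarProjection_tensor fun i => isStarProjection_replyOp hπ i _

/-- The sum of `f` over the possible replies to a question. -/
def questionSum {M : Type} [AddCommMonoid M] {i : S.Site} (f : Reply S i → M) : Question S i → M
  | none => f none
  | some x => ∑ o, f (some ⟨x, o⟩)

omit [∀ i, Fintype (H i)] in
-- The enumeration of outcomes is left free: `DistOutcome` is enumerated by cases on the setting,
-- whereas the Fourier sums run over `ZMod d` or its square directly.
theorem questionSum_some {M : Type} [AddCommMonoid M] {i : S.Site} {f : Reply S i → M}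
    {x : S.Setting i} {inst : Fintype (S.Outcome i x)} (g : S.Outcome i x → M)
    (h : ∀ o, f (some ⟨x, o⟩) = g o) :
    questionSum f (some x) = @Finset.sum _ _ _ (@Finset.univ _ inst) g := by
  rw [Subsingleton.elim inst (S.outcomeFintype i x)]
  exact Finset.sum_congr rfl fun o _ => h o

/-- The reply of a site to the question `c`. -/
def localReply {X : Type} {Out : X → Type} : (c : Option X) → ((x : X) → c = some x → Out x) →
    Option ((x : X) × Out x)
  | none, _ => none
  | some x, l => some ⟨x, l x rfl⟩

omit [∀ i, Fintype (H i)] in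
theorem reply_eq_localReply {C : Context S} (s : LocalSection S C) (i : S.Site) :
    s.reply i = localReply (C i) (s i) := by
  have : ∀ (c : Question S i) (h : C i = c), s.reply i =
      localReply c (fun x hx => s i x (h.trans hx)) := by
    intro c h
    cases c with
    | none => exact s.reply_of_none h
    | some x => exact s.reply_of_some h
  exact this _ rfl

/-- An outcome of `x` as a reply to the question `x`. -/
def outcomeEquiv {X : Type} {Out : X → Type} (x : X) :
    Out x ≃ ((y : X) → some x = some y → Out y) where
  toFun o y h := Option.some.inj h ▸ o
  invFun l := l x rfl
  left_inv o := rfl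
  right_inv l := by
    funext y h
    obtain rfl := Option.some.inj h
    rfl

omit [∀ i, Fintype (H i)] in
theorem sum_localReply {M : Type} [AddCommMonoid M] {i : S.Site} (f : Reply S i → M)
    (c : Question S i) [Fintype ((x : S.Setting i) → c = some x → S.Outcome i x)] :
    ∑ l : ((x : S.Setting i) → c = some x → S.Outcome i x), f (localReply c l) =
      questionSum f c := by
  cases c with
  | none =>
    have : Unique ((x : S.Setting i) → none = some x → S.Outcome i x) :=
      ⟨⟨fun x h => by cases h⟩, fun l => by funext x h; cases h⟩
    rw [Fintype.sum_unique]
    rfl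
  | some x =>
    rw [← (outcomeEquiv (Out := S.Outcome i) x).sum_comp]
    rfl

omit [∀ i, Fintype (H i)] in
-- The replies of different sites vary independently, so the sum over joint outcomes distributes
-- over the tensor product.
theorem sum_tensor_reply (C : Context S) (f : ∀ i, Reply S i → Matrix (H i) (H i) ℂ) :
    ∑ s : LocalSection S C, tensor (fun i => f i (s.reply i)) =
      tensor fun i => questionSum (f i) (C i) := by
  simp only [reply_eq_localReply]
  refine (sum_tensor fun i (l : (x : S.Setting i) → C i = some x → S.Outcome i x) =>
    f i (localReply (C i) l)).trans ?_
  exact congrArg tensor (funext fun i => sum_localReply (f i) (C i))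

/-- For a weight that is a product over the sites, the weighted total of the probabilities is the
expectation of one product operator. With characters for `χ` this is the characteristic function of
the outcomes. -/
theorem sum_char_mul_quantumBehaviour (hπ : ∀ i x, IsProjectiveMeasurement (π i x))
    (ψ : ((i : S.Site) → H i) → ℂ) (C : Context S) (χ : ∀ i, Reply S i → ℂ) :
    ∑ s : LocalSection S C, (∏ i, χ i (s.reply i)) * (quantumBehaviour S π ψ C s : ℂ) =
      tensorExpect ψ (fun i => questionSum (fun r => χ i r • replyOp π i r) (C i)) := by
  rw [tensorExpect, ← sum_tensor_reply, expect_sum]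
  refine Finset.sum_congr rfl fun s _ => ?_
  rw [quantumBehaviour_eq_expect hπ, tensor_smul, expect_smul]

/-- The probability assigned to a value of a function of the joint outcome. -/
def valueSum {β : Type} {C : Context S} (D : LocalSection S C → β) (f : LocalSection S C → ℝ)
    (t : β) : ℝ := ∑ s, if D s = t then f s else 0

omit [∀ i, Fintype (H i)] in
theorem ofReal_valueSum {β : Type} {C : Context S} (D : LocalSection S C → β)
    (f : LocalSection S C → ℝ) {t : β} {w : β → ℂ} (ht : w t = 1) (hw : ∀ t', t' ≠ t → w t' = 0) :
    (valueSum D f t : ℂ) = ∑ s, w (D s) * (f s : ℂ) := by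
  rw [valueSum, Complex.ofReal_sum]
  refine Finset.sum_congr rfl fun s _ => ?_
  split_ifs with h
  · rw [h, ht, one_mul]
  · rw [hw _ h, zero_mul, Complex.ofReal_zero]

omit [∀ i, Fintype (H i)] in
theorem acceptSum_preimage {β : Type} [Fintype β] {C : Context S} (D : LocalSection S C → β)
    (A : Set β) (f : LocalSection S C → ℝ) :
    acceptSum (D ⁻¹' A) f = ∑ t, if t ∈ A then valueSum D f t else 0 := by
  have : ∀ t, (if t ∈ A then valueSum D f t else 0) =
      ∑ s, if D s = t then (if t ∈ A then f s else 0) else 0 := by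
    intro t
    by_cases h : t ∈ A <;> simp [h, valueSum]
  simp only [this]
  rw [Finset.sum_comm]
  simp [acceptSum]

omit [∀ i, Fintype (H i)] in
theorem acceptSum_of_injective {β : Type} [Fintype β] {C : Context S} {A : Set (LocalSection S C)}
    {f : LocalSection S C → ℝ} {g : β → ℝ} (e : LocalSection S C → β) (he : Function.Injective e)
    (h0 : ∀ t ∉ Set.range e, g t = 0) (h1 : ∀ s, (if s ∈ A then f s else 0) = g (e s)) :
    acceptSum A f = ∑ t, g t := Fintype.sum_of_injective e he _ _ h0 h1

end Model

/-! ## Fourier expansion of Weyl statistics -/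

section

variable {d : ℕ} [NeZero d] {I : Type} [Fintype I]

/-- Orthogonality of characters on `ZMod d ^ I`; it recovers probabilities from characteristic
functions. -/
theorem ite_eq_sum_stdAddChar (t t' : I → ZMod d) :
    (if t' = t then (1 : ℂ) else 0) = ((d : ℂ)⁻¹) ^ Fintype.card I *
      ∑ k : I → ZMod d, ZMod.stdAddChar (∑ i, k i * (t' i - t i)) := by
  have hd : (d : ℂ) ≠ 0 := Nat.cast_ne_zero.2 (NeZero.ne d)
  simp only [stdAddChar_sum]
  rw [← Fintype.prod_sum fun i (k : ZMod d) => (ZMod.stdAddChar (k * (t' i - t i)) : ℂ)]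
  simp only [sum_stdAddChar_mul]
  rw [← Finset.card_univ, ← Finset.prod_const, ← Finset.prod_mul_distrib]
  by_cases h : t' = t
  · simp [h, hd]
  · rw [if_neg h]
    obtain ⟨i, hi⟩ := Function.ne_iff.1 h
    exact (Finset.prod_eq_zero (Finset.mem_univ i) (by simp [sub_eq_zero, hi])).symm

theorem weyl_unitary (p : ZMod d × ZMod d) : (weyl d p).conjTranspose * weyl d p = 1 := by
  ext b b'
  rw [Matrix.mul_apply, Finset.sum_eq_single (b' + p.1)]
  · simp only [weyl, Matrix.conjTranspose_apply, if_true, Matrix.one_apply, add_left_inj]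
    by_cases h : b = b'
    · subst h
      simp only [if_true]
      change (starRingEnd ℂ) _ * _ = 1
      rw [← AddChar.map_neg_eq_conj, ← AddChar.map_add_eq_mul]
      simp
    · simp [h, Ne.symm h]
  · intro c _ hc
    simp [weyl, hc]
  · simp

theorem isUnitaryRep_weyl (p : ZMod d × ZMod d) :
    IsUnitaryRep fun k : ZMod d => weylPhase p k.val • weyl d (k • p) where
  map_zero := by
    rw [zero_smul, weyl_zero, ZMod.val_zero, weylPhase_zero, one_smul]
    congr!
  map_add k l := by
    rw [smul_mul_smul_comm, weyl_mul, smul_smul, ← add_smul, weylPhase_add]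
  unitary k := by
    rw [Matrix.conjTranspose_smul, smul_mul_smul_comm, weyl_unitary, star_weylPhase_mul,
      one_smul]
    congr!

theorem isProjectiveMeasurement_weylProj (p : ZMod d × ZMod d) :
    IsProjectiveMeasurement (weylProj d p) := by
  rw [weylProj_eq_fourierProj]
  exact isProjectiveMeasurement_fourierProj isPairing_mul (isUnitaryRep_weyl p)

/-- The trivial measurement returns `0` with certainty and leaves the state alone, which justifies
treating unasked players as if they were asked for `W(0, 0)`. -/
theorem weylProj_zero (q : ZMod d) : weylProj d 0 q = if q = 0 then 1 else 0 := by
  have hd : (d : ℂ) ≠ 0 := Nat.cast_ne_zero.2 (NeZero.ne d)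
  have h : ∀ k : ZMod d, weylObs d 0 ^ k.val = 1 := by
    intro k
    have : weylObs d 0 = 1 := by simp [weylObs, weyl_zero]
    rw [this, one_pow]
  simp only [weylProj, h]
  rw [← Finset.sum_smul, smul_smul]
  have : ∀ k : ZMod d, -(q * k) = k * -q := fun k => by ring
  simp only [this, sum_stdAddChar_mul, neg_eq_zero]
  split_ifs <;> simp [hd]

/-- The probability of the outcomes `t` if all qudits are measured. -/
def weylProb (ψ : (I → ZMod d) → ℂ) (p : I → ZMod d × ZMod d) (t : I → ZMod d) : ℝ :=
  ∑ b, ‖(tensor fun i => weylProj d (p i) (t i)).mulVec ψ b‖ ^ 2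

/-- The Fourier sums defining the projectors are multiplied out over the qudits. The distributed
strategy is brought to the same form in `valueSum_distBehaviour`. -/
theorem weylProb_eq_sum (ψ : (I → ZMod d) → ℂ) (p : I → ZMod d × ZMod d) (t : I → ZMod d) :
    (weylProb ψ p t : ℂ) = ((d : ℂ)⁻¹) ^ Fintype.card I * ∑ k : I → ZMod d,
      ZMod.stdAddChar (-∑ i, k i * t i) *
        ((∏ i, weylPhase (p i) (k i).val) * expect ψ (multiWeyl fun i => k i • p i)) := by
  rw [weylProb, norm_sq_mulVec_eq_expect]
  swap
  · exact isStarProjection_tensor fun i => (isProjectiveMeasurement_weylProj _).1 _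
  have h : (tensor fun i => weylProj d (p i) (t i)) = ((d : ℂ)⁻¹) ^ Fintype.card I •
      ∑ k : I → ZMod d, (ZMod.stdAddChar (-∑ i, k i * t i) : ℂ) •
        ((∏ i, weylPhase (p i) (k i).val) • multiWeyl fun i => k i • p i) := by
    simp only [weylProj_eq_sum]
    rw [tensor_smul (fun _ => (d : ℂ)⁻¹), Finset.prod_const, Finset.card_univ]
    congr 1
    rw [← sum_tensor fun i (k : ZMod d) => (ZMod.stdAddChar (-(t i * k)) : ℂ) •
      (weylPhase (p i) k.val • weyl d (k • p i))]
    refine Finset.sum_congr rfl fun k _ => ?_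
    rw [tensor_smul fun i => (ZMod.stdAddChar (-(t i * k i)) : ℂ),
      tensor_smul fun i => weylPhase (p i) (k i).val, tensor_weyl, ← stdAddChar_sum,
      Finset.sum_neg_distrib]
    simp only [mul_comm (t _)]
  rw [h, expect_smul, expect_sum]
  simp only [expect_smul]

/-- The outcomes of a joint question, completed by `0` where nothing is measured. -/
def completeOutcome {C : Context (weylScenario d I)} (s : LocalSection (weylScenario d I) C)
    (i : I) : ZMod d :=
  match s.reply i with
  | none => 0
  | some r => r.2

theorem completeOutcome_of_some {C : Context (weylScenario d I)}
    (s : LocalSection (weylScenario d I) C) {i : I} {x : ZMod d × ZMod d} (h : C i = some x) :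
    completeOutcome s i = s i x h := by
  rw [completeOutcome, s.reply_of_some h]

theorem completeOutcome_of_none {C : Context (weylScenario d I)}
    (s : LocalSection (weylScenario d I) C) {i : I} (h : C i = none) :
    completeOutcome s i = 0 := by
  rw [completeOutcome, s.reply_of_none h]

theorem acceptSum_weylBehaviour (ψ : (I → ZMod d) → ℂ) (C : Context (weylScenario d I))
    (A : Set (LocalSection (weylScenario d I) C)) :
    acceptSum A (weylBehaviour d I ψ C) =
      ∑ t : I → ZMod d, if (fun i _ _ => t i) ∈ A then weylProb ψ (fullSetting C) t else 0 := by
  have hres : ∀ s : LocalSection (weylScenario d I) C, (fun i _ _ => completeOutcome s i) = s :=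
    fun s => funext fun i => funext fun x => funext fun h => completeOutcome_of_some s h
  refine acceptSum_of_injective completeOutcome ?_ ?_ ?_
  · intro s s' h
    rw [← hres s, ← hres s', h]
  -- A tuple that comes from no section has a nonzero entry at an unasked player, where the trivial
  -- measurement only returns `0`.
  · intro t ht
    have h0 : ∃ i, C i = none ∧ t i ≠ 0 := by
      by_contra hc
      push Not at hc
      refine ht ⟨fun i _ _ => t i, funext fun i => ?_⟩
      cases h : C i with
      | none => rw [completeOutcome_of_none _ h, hc i h]
      | some x => rw [completeOutcome_of_some _ h]
    obtain ⟨i, hi, hti⟩ := h0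
    have hz : (tensor fun i => weylProj d (fullSetting C i) (t i)) = 0 := by
      ext b b'
      refine Finset.prod_eq_zero (Finset.mem_univ i) ?_
      simp [fullSetting, hi, weylProj_zero, hti]
    simp [weylProb, hz]
  · intro s
    rw [hres]
    have : weylBehaviour d I ψ C s = weylProb ψ (fullSetting C) (completeOutcome s) := by
      rw [weylBehaviour, quantumBehaviour_eq, weylProb]
      have h2 : (fun i => replyOp (S := weylScenario d I) (H := fun _ => ZMod d)
          (fun _ p q => weylProj d p q) i (s.reply i)) =
          fun i => weylProj d (fullSetting C i) (completeOutcome s i) := by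
        funext i
        cases h : C i with
        | none =>
          rw [completeOutcome_of_none _ h, s.reply_of_none h]
          simp only [fullSetting, h, Option.getD_none, weylProj_zero, if_true]
          simp only [replyOp]
          congr!
        | some x =>
          rw [completeOutcome_of_some _ h, s.reply_of_some h]
          simp only [fullSetting, h, Option.getD_some]
          rfl
      rw [h2]
    rw [this]

end

/-! ## Registers prepared in product states and measured at sites -/

section Partition

variable {d : ℕ} [NeZero d] {Q S T : Type} [Fintype Q] [Fintype S] [Fintype T]

/-- The product over the parts `t` of the states `φ t`, as a state of the sites. -/
def partitionState (site : Q → S) (part : Q → T) (φ : ∀ t, (fiber part t → ZMod d) → ℂ) :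
    (∀ a, (fiber site a → ZMod d)) → ℂ :=
  fun b => productState φ ((glue part (ZMod d)).symm (glue site (ZMod d) b))

/-- A Weyl operator of the whole register factorises along any partition of the qudits. It can
therefore be regrouped from sites, where it is measured, to parts, where the state is a product. -/
theorem expect_partitionState (site : Q → S) (part : Q → T)
    (φ : ∀ t, (fiber part t → ZMod d) → ℂ) (l : Q → ZMod d × ZMod d) :
    expect (partitionState site part φ) (tensor fun a => multiWeyl fun q : fiber site a => l q) =
      ∏ t, expect (φ t) (multiWeyl fun q : fiber part t => l q) := by
  rw [← multiWeyl_glue, ← expect_productState, ← multiWeyl_glue]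
  unfold partitionState
  rw [expect_comp_equiv (glue site (ZMod d))
    (fun b => productState φ ((glue part (ZMod d)).symm b)),
    ← expect_comp_equiv (glue part (ZMod d))
    (fun b => productState φ ((glue part (ZMod d)).symm b))]
  simp only [Equiv.symm_apply_apply]

theorem isState_partitionState (site : Q → S) (part : Q → T)
    (φ : ∀ t, (fiber part t → ZMod d) → ℂ) (hφ : ∀ t, IsState (φ t)) :
    IsState (partitionState site part φ) := by
  rw [IsState]
  unfold partitionState
  rw [(glue site (ZMod d)).sum_comp
      (fun b => ‖productState φ ((glue part (ZMod d)).symm b)‖ ^ 2),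
    (glue part (ZMod d)).symm.sum_comp (fun b => ‖productState φ b‖ ^ 2)]
  simp only [productState, norm_prod, ← Finset.prod_pow]
  rw [← Fintype.prod_sum fun t c => ‖φ t c‖ ^ 2]
  exact Finset.prod_eq_one fun t _ => hφ t

end Partition

/-! ## Bell states -/

section Bell

variable {d : ℕ} [NeZero d] {X : Type} [Fintype X] [DecidableEq X]

/-- The maximally entangled state of the qudits in `X`. -/
def bellState (d : ℕ) (X : Type) : (X → ZMod d) → ℂ :=
  fun b => if ∀ i j, b i = b j then (((Real.sqrt d)⁻¹ : ℝ) : ℂ) else 0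

theorem isState_bellState [Nonempty X] : IsState (bellState d X) := by
  have hd : (d : ℝ) ≠ 0 := Nat.cast_ne_zero.2 (NeZero.ne d)
  have : ∑ _c : ZMod d, (d : ℝ)⁻¹ = ∑ b, ‖bellState d X b‖ ^ 2 := by
    refine Fintype.sum_of_injective (fun c : ZMod d => fun _ : X => c) ?_ _ _ ?_ ?_
    · intro c c' h
      exact congrFun h (Classical.arbitrary X)
    · intro b hb
      have : ¬ ∀ i j, b i = b j := fun h =>
        hb ⟨b (Classical.arbitrary X), funext fun i => h _ _⟩
      simp [bellState, this]
    · intro c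
      simp [bellState]
  rw [IsState, ← this]
  simp [hd]

/-- The state is a uniform superposition of the constant basis states. Equal shifts permute these,
and phases of total exponent zero act trivially on each of them. -/
theorem expect_bellState [Nonempty X] (l : X → ZMod d × ZMod d)
    (h1 : ∀ i j, (l i).1 = (l j).1) (h2 : ∑ i, (l i).2 = 0) :
    expect (bellState d X) (multiWeyl l) = 1 := by
  have hfix : (multiWeyl l).mulVec (bellState d X) = bellState d X := by
    ext b
    have hb : b = (b - fun i => (l i).1) + fun i => (l i).1 := (sub_add_cancel _ _).symm
    rw [Matrix.mulVec, dotProduct, Finset.sum_eq_single (b - fun i => (l i).1)]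
    · rw [multiWeyl, if_pos hb]
      have hiff : (∀ i j, (b - fun i => (l i).1) i = (b - fun i => (l i).1) j) ↔
          ∀ i j, b i = b j := by
        refine forall_congr' fun i => forall_congr' fun j => ?_
        simp only [Pi.sub_apply, h1 i j, sub_left_inj]
      by_cases hc : ∀ i j, b i = b j
      · have hc' := hiff.2 hc
        rw [bellState, bellState, if_pos hc, if_pos hc']
        have : ∑ i, (b - fun i => (l i).1) i * (l i).2 = 0 := by
          rw [Finset.sum_congr rfl fun i _ => by rw [hc' i (Classical.arbitrary X)],
            ← Finset.mul_sum, h2, mul_zero]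
        rw [this]
        simp
      · rw [bellState, bellState, if_neg hc, if_neg (fun h => hc (hiff.1 h)), mul_zero]
    · intro c _ hc
      have : b ≠ c + fun i => (l i).1 := fun h => hc (by rw [h, add_sub_cancel_right])
      rw [multiWeyl, if_neg this, zero_mul]
    · simp
  have h := isState_bellState (d := d) (X := X)
  rw [expect, hfix, ← ofReal_sum_norm_sq, h]
  simp

end Bell

/-! ## The register of the distributed strategy -/

/-- The qudits: for every player, one qudit of the state at the root, and for every edge two halves
of a Bell pair, one at each end. -/
structure Register (I : Type) (G : RootedGraph) where
  player : I
  half : Option G.graph.Dart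

namespace Register

variable {d : ℕ} [NeZero d] {I : Type} {G : RootedGraph}

/-- A qudit as a pair. -/
def equivProd : Register I G ≃ I × Option G.graph.Dart where
  toFun q := (q.player, q.half)
  invFun q := ⟨q.1, q.2⟩
  left_inv _ := rfl
  right_inv _ := rfl

instance [Fintype I] : Fintype (Register I G) := Fintype.ofEquiv _ equivProd.symm

/-- The measurement site at which a qudit is held. -/
def site (q : Register I G) : I × G.V := (q.player, q.half.elim G.root fun e => e.fst)

/-- The parts of the register prepared independently: the qudits of the state, and the Bell
pairs. -/
def part (q : Register I G) : Option (I × G.graph.edgeSet) :=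
  q.half.map fun e => (q.player, ⟨e.edge, e.edge_mem⟩)

/-- The other half of a Bell pair. -/
def partner (q : Register I G) : Register I G := ⟨q.player, q.half.map fun e => e.symm⟩

end Register

section Teleport

variable {d : ℕ} [NeZero d] {I : Type} [Fintype I] {G : RootedGraph}

/-- The state `ψ` or a Bell pair. -/
def partState (G : RootedGraph) (ψ : (I → ZMod d) → ℂ) :
    (t : Option (I × G.graph.edgeSet)) → (fiber (Register.part (I := I) (G := G)) t → ZMod d) → ℂ
  | none => fun b => ψ fun i => b ⟨⟨i, none⟩, by simp [Register.part]⟩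
  | some _ => bellState d _

/-- The qudits of the state, as indexed by the players. -/
def fiberNoneEquiv (I : Type) [Fintype I] (G : RootedGraph) :
    I ≃ fiber (Register.part (I := I) (G := G)) none where
  toFun i := ⟨⟨i, none⟩, by simp [Register.part]⟩
  invFun q := q.1.player
  left_inv _ := rfl
  right_inv := by
    rintro ⟨⟨i, _ | e⟩, hq⟩
    · rfl
    · simp [Register.part] at hq

theorem multiWeyl_reindex {X Y : Type} [Fintype X] [Fintype Y] (e : X ≃ Y)
    (l : Y → ZMod d × ZMod d) :
    (multiWeyl fun i => l (e i)).submatrix (e.arrowCongr (Equiv.refl (ZMod d))).symm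
      (e.arrowCongr (Equiv.refl (ZMod d))).symm = multiWeyl l := by
  ext b b'
  simp only [Matrix.submatrix_apply, multiWeyl]
  have h1 : ∀ b : Y → ZMod d, (e.arrowCongr (Equiv.refl (ZMod d))).symm b = fun i => b (e i) :=
    fun _ => rfl
  have h2 : (fun i => b (e i)) = (fun i => b' (e i)) + (fun i => (l (e i)).1) ↔
      b = b' + fun i => (l i).1 := by
    constructor
    · intro h
      funext i
      have := congrFun h (e.symm i)
      simpa using this
    · rintro rfl
      rfl
  simp only [h1]
  rw [e.sum_comp (fun i => b' i * (l i).2)]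
  exact if_congr h2 rfl rfl

theorem expect_partState_none (ψ : (I → ZMod d) → ℂ)
    (l : Register I G → ZMod d × ZMod d) :
    expect (partState G ψ none) (multiWeyl fun q : fiber Register.part none => l q) =
      expect ψ (multiWeyl fun i => l ⟨i, none⟩) := by
  rw [← multiWeyl_reindex (fiberNoneEquiv I G)]
  exact expect_comp_equiv ((fiberNoneEquiv I G).arrowCongr (Equiv.refl (ZMod d))).symm ψ
    (multiWeyl fun i => l ⟨i, none⟩)

instance nonempty_fiber_part (t : I × G.graph.edgeSet) :
    Nonempty (fiber (Register.part (I := I) (G := G)) (some t)) := by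
  obtain ⟨i, ⟨e, he⟩⟩ := t
  induction e using Sym2.ind with
  | _ v w => exact ⟨⟨⟨i, some ⟨(v, w), he⟩⟩, by simp [Register.part, SimpleGraph.Dart.edge]⟩⟩

theorem isState_partState {ψ : (I → ZMod d) → ℂ} (hψ : IsState ψ)
    (t : Option (I × G.graph.edgeSet)) : IsState (partState G ψ t) := by
  cases t with
  | none =>
    rw [IsState, ← hψ]
    exact ((fiberNoneEquiv I G).arrowCongr (Equiv.refl (ZMod d))).symm.sum_comp
      (fun b => ‖ψ b‖ ^ 2)
  | some t => exact isState_bellState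

/-- Weyl operators that act on the two halves of each Bell pair as `W(c)` and `W(c₁, -c₂)` leave the
Bell pairs invariant. -/
theorem expect_register {A : Type} [Fintype A] (site : Register I G → A) (ψ : (I → ZMod d) → ℂ)
    (l : Register I G → ZMod d × ZMod d) (h1 : ∀ i e, (l ⟨i, some e⟩).1 = (l ⟨i, some e.symm⟩).1)
    (h2 : ∀ i e, (l ⟨i, some e⟩).2 + (l ⟨i, some e.symm⟩).2 = 0) :
    tensorExpect (partitionState site Register.part (partState G ψ))
        (fun a => multiWeyl fun q : fiber site a => l q) =
      expect ψ (multiWeyl fun i => l ⟨i, none⟩) := by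
  rw [tensorExpect, expect_partitionState, Fintype.prod_option, expect_partState_none,
    Finset.prod_eq_one, mul_one]
  rintro ⟨i, e⟩ -
  have hmem : ∀ q : Register I G, q ∈ fiber Register.part (some (i, e)) ↔
      ∃ f : G.graph.Dart, q = ⟨i, some f⟩ ∧ f.edge = e := by
    rintro ⟨j, _ | f⟩
    · simp [Register.part]
    · simp only [Register.part, Finset.mem_filter, Finset.mem_univ, true_and, Option.map_some,
        Option.some.injEq, Prod.mk.injEq, Subtype.ext_iff, Register.mk.injEq]
      constructor
      · rintro ⟨rfl, h⟩
        exact ⟨f, ⟨rfl, rfl⟩, h⟩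
      · rintro ⟨f', ⟨rfl, rfl⟩, h⟩
        exact ⟨rfl, h⟩
  refine expect_bellState _ ?_ ?_
  · rintro ⟨q, hq⟩ ⟨q', hq'⟩
    obtain ⟨f, rfl, hf⟩ := (hmem q).1 hq
    obtain ⟨f', rfl, hf'⟩ := (hmem q').1 hq'
    rcases (SimpleGraph.dart_edge_eq_iff f f').1 (hf.trans hf'.symm) with rfl | rfl
    · rfl
    · exact (h1 i f').symm
  -- A part is an edge with its two orientations; exchanging the halves pairs off the phase
  -- components, which cancel by `h2`.
  · refine Finset.sum_involution (fun q _ => ⟨q.1.partner, ?_⟩) ?_ ?_ ?_ ?_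
    · obtain ⟨f, hq, hf⟩ := (hmem q.1).1 q.2
      refine (hmem _).2 ⟨f.symm, ?_, ?_⟩
      · simp [hq, Register.partner]
      · rw [SimpleGraph.Dart.edge_symm, hf]
    · rintro ⟨q, hq⟩ -
      obtain ⟨f, rfl, hf⟩ := (hmem q).1 hq
      exact h2 i f
    · rintro ⟨q, hq⟩ - - h
      obtain ⟨f, rfl, hf⟩ := (hmem q).1 hq
      simp [Register.partner, f.symm_ne] at h
    · intros
      exact Finset.mem_univ _
    · rintro ⟨q, hq⟩ -
      obtain ⟨f, rfl, hf⟩ := (hmem q).1 hq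
      simp [Register.partner]

end Teleport

/-! ## Measurements of the distributed strategy -/

section Measure

variable {d : ℕ} [NeZero d] {I : Type} [Fintype I] {G : RootedGraph}

/-- The qudits held at a site. -/
abbrev SiteQudits (I : Type) [Fintype I] (G : RootedGraph) (a : I × G.V) : Type :=
  fiber (Register.site (I := I) (G := G)) a

/-- The qudit of the state held at `(i, root)`. -/
def rootPort (i : I) {v : G.V} (hv : v = G.root) : SiteQudits I G (i, v) :=
  ⟨⟨i, none⟩, by simp [Register.site, hv]⟩

/-- The half held at `(i, v)` of the Bell pair shared with `(i, w)`. -/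
def halfPort (i : I) {v w : G.V} (hw : G.graph.Adj v w) : SiteQudits I G (i, v) :=
  ⟨⟨i, some ⟨(v, w), hw⟩⟩, by simp [Register.site]⟩

/-- The measurement of a site for each setting. -/
def settingOp (a : I × G.V) : (x : DistSetting G d a.2) → DistOutcome x →
    Matrix (SiteQudits I G a → ZMod d) (SiteQudits I G a → ZMod d) ℂ
  | .rootWeyl hv p => portWeyl (rootPort a.1 hv) p
  | .rootBell hv _ hw => portBell (rootPort a.1 hv) (halfPort a.1 hw)
  | .weyl _ _ hw p => portWeyl (halfPort a.1 hw) p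
  | .bell _ _ _ hw hw' _ => portBell (halfPort a.1 hw) (halfPort a.1 hw')

theorem rootPort_ne_halfPort (i : I) {v w : G.V} (hv : v = G.root) (hw : G.graph.Adj v w) :
    rootPort i hv ≠ halfPort i hw := by
  simp [rootPort, halfPort]

theorem halfPort_ne_halfPort (i : I) {v w w' : G.V} (hw : G.graph.Adj v w)
    (hw' : G.graph.Adj v w') (hne : w ≠ w') : halfPort i hw ≠ halfPort i hw' := by
  simp [halfPort, hne]

theorem IsProjectiveMeasurement.of_fintype {α B : Type} [Fintype B] {i : Fintype α}
    {P : α → Matrix B B ℂ} (h : @IsProjectiveMeasurement α B i _ P) (j : Fintype α) :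
    @IsProjectiveMeasurement α B j _ P := by
  rwa [Subsingleton.elim j i]

theorem isProjectiveMeasurement_settingOp (a : I × G.V) (x : DistSetting G d a.2) :
    IsProjectiveMeasurement (settingOp a x) := by
  cases x with
  | rootWeyl hv p => exact (isProjectiveMeasurement_portWeyl (rootPort a.1 hv) p).of_fintype _
  | rootBell hv w hw =>
    exact (isProjectiveMeasurement_portBell (rootPort_ne_halfPort a.1 hv hw)).of_fintype _
  | weyl hv w hw p => exact (isProjectiveMeasurement_portWeyl (halfPort a.1 hw) p).of_fintype _
  | bell hv w w' hw hw' hne =>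
    exact (isProjectiveMeasurement_portBell (halfPort_ne_halfPort a.1 hw hw' hne)).of_fintype _

/-- The node `w` comes right after `v` in the path. -/
def RootedPath.Precedes (P : RootedPath G) (v w : G.V) : Prop :=
  ∃ n < P.2.1.length, P.2.1.getVert n = v ∧ P.2.1.getVert (n + 1) = w

/-- A path visits each node once, so the position of `v` is unique and its successor is determined.
-/
theorem RootedPath.precedes_iff (P : RootedPath G) {v : G.V} (hv : v ∈ P.2.1.support) (w : G.V) :
    P.Precedes v w ↔ P.2.1.support.idxOf v < P.2.1.length ∧
      w = P.2.1.getVert (P.2.1.support.idxOf v + 1) := by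
  constructor
  · rintro ⟨n, hn, rfl, rfl⟩
    have : P.2.1.support.idxOf (P.2.1.getVert n) = n :=
      P.2.2.getVert_injOn (P.idxOf_le hv) hn.le (P.getVert_idxOf hv)
    rw [this]
    exact ⟨hn, rfl⟩
  · rintro ⟨hn, rfl⟩
    exact ⟨_, hn, P.getVert_idxOf hv, rfl⟩

theorem RootedPath.precedes_iff' (P : RootedPath G) {v : G.V} (hv : v ∈ P.2.1.support) (w : G.V) :
    P.Precedes w v ↔ P.2.1.support.idxOf v ≠ 0 ∧
      w = P.2.1.getVert (P.2.1.support.idxOf v - 1) := by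
  constructor
  · rintro ⟨n, hn, rfl, rfl⟩
    have : P.2.1.support.idxOf (P.2.1.getVert (n + 1)) = n + 1 :=
      P.2.2.getVert_injOn (P.idxOf_le hv) (Nat.succ_le_of_lt hn) (P.getVert_idxOf hv)
    rw [this]
    exact ⟨by omega, rfl⟩
  · rintro ⟨hn, rfl⟩
    have := P.idxOf_le hv
    exact ⟨_, by omega, rfl, by rw [Nat.sub_add_cancel (by omega), P.getVert_idxOf hv]⟩

theorem RootedPath.Precedes.left_mem {P : RootedPath G} {v w : G.V} (h : P.Precedes v w) :
    v ∈ P.2.1.support := by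
  obtain ⟨n, -, rfl, -⟩ := h
  exact SimpleGraph.Walk.getVert_mem_support _ _

theorem RootedPath.Precedes.right_mem {P : RootedPath G} {v w : G.V} (h : P.Precedes v w) :
    w ∈ P.2.1.support := by
  obtain ⟨n, -, -, rfl⟩ := h
  exact SimpleGraph.Walk.getVert_mem_support _ _

theorem RootedPath.Precedes.asymm {P : RootedPath G} {v w : G.V} (h : P.Precedes v w) :
    ¬ P.Precedes w v := by
  intro h'
  have h1 := (P.precedes_iff h.left_mem w).1 h
  have h2 := (P.precedes_iff' h.left_mem w).1 h'
  exact P.prev_ne_next h1.1 (h2.2.symm.trans h1.2)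

/-- The Weyl operators by which the qudits of a player enter into the corrected outcome. -/
def RootedPath.label (P : RootedPath G) (c : ZMod d × ZMod d) :
    Option G.graph.Dart → ZMod d × ZMod d
  | none => c
  | some e => if P.Precedes e.snd e.fst then c else
      if P.Precedes e.fst e.snd then (c.1, -c.2) else 0

omit [NeZero d] in
-- Together with `RootedPath.label_symm_snd`, this is what `expect_register` requires for the Bell
-- pairs to be left invariant: on a path edge the later node holds `c` and the earlier one `(c₁,
-- -c₂)`, and off the path both labels vanish.
theorem RootedPath.label_symm_fst (P : RootedPath G) (c : ZMod d × ZMod d) (e : G.graph.Dart) :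
    (P.label c (some e)).1 = (P.label c (some e.symm)).1 := by
  by_cases h1 : P.Precedes e.snd e.fst <;> by_cases h2 : P.Precedes e.fst e.snd <;>
    simp [RootedPath.label, h1, h2]

omit [NeZero d] in
theorem RootedPath.label_symm_snd (P : RootedPath G) (c : ZMod d × ZMod d) (e : G.graph.Dart) :
    (P.label c (some e)).2 + (P.label c (some e.symm)).2 = 0 := by
  by_cases h1 : P.Precedes e.snd e.fst
  · simp [RootedPath.label, h1, h1.asymm]
  · by_cases h2 : P.Precedes e.fst e.snd <;> simp [RootedPath.label, h1, h2]

omit [NeZero d] in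
theorem siteQudits_ext {i : I} {v : G.V} {l l' : SiteQudits I G (i, v) → ZMod d × ZMod d}
    (hroot : ∀ hv : v = G.root, l (rootPort i hv) = l' (rootPort i hv))
    (hhalf : ∀ w (hw : G.graph.Adj v w), l (halfPort i hw) = l' (halfPort i hw)) : l = l' := by
  funext ⟨⟨j, h⟩, hq⟩
  have hs : (Register.site ⟨j, h⟩ : I × G.V) = (i, v) := by simpa using hq
  rcases h with _ | ⟨⟨v', w⟩, hw⟩
  · simp only [Register.site, Option.elim_none, Prod.mk.injEq] at hs
    obtain ⟨rfl, rfl⟩ := hs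
    exact hroot rfl
  · simp only [Register.site, Option.elim_some, Prod.mk.injEq] at hs
    obtain ⟨rfl, rfl⟩ := hs
    exact hhalf w hw

omit [NeZero d] in
theorem halfPort_inj (i : I) {v w w' : G.V} (hw : G.graph.Adj v w) (hw' : G.graph.Adj v w') :
    halfPort i hw = halfPort i hw' ↔ w = w' := by
  simp [halfPort]

/-- The label of a player as a function on the qudits of a site. -/
def siteLabel (P : RootedPath G) (c : ZMod d × ZMod d) (a : I × G.V) :
    SiteQudits I G a → ZMod d × ZMod d := fun q => P.label c q.1.half

/-- The contribution of the reply of `(i, v)` to the corrected outcome. -/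
def replyVal (P : RootedPath G) (p : ZMod d × ZMod d) {a : I × G.V}
    (r : Reply (distScenario d I G) a) : ZMod d :=
  (if a.2 = P.1 then weylPart r else 0) - bracket d p (bellPart r)

/-- The operator of a reply, weighted by a character of its contribution to the corrected
outcome. -/
def charOp (P : RootedPath G) (p : ZMod d × ZMod d) (k : ZMod d) (a : I × G.V)
    (r : Reply (distScenario d I G) a) :
    Matrix (SiteQudits I G a → ZMod d) (SiteQudits I G a → ZMod d) ℂ :=
  (ZMod.stdAddChar (k * replyVal P p r) : ℂ) • replyOp
    (S := distScenario d I G) (H := fun a => SiteQudits I G a → ZMod d) settingOp a r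

section

variable (P : RootedPath G) (p : ZMod d × ZMod d) (k : ZMod d) (i : I) {v : G.V}

theorem questionSum_none :
    questionSum (S := distScenario d I G) (i := (i, v)) (charOp P p k (i, v)) none =
      multiWeyl (0 : SiteQudits I G (i, v) → _) := by
  have h : replyVal P p (none : Reply (distScenario d I G) (i, v)) = 0 := by
    change (if v = P.1 then 0 else 0) - bracket d p 0 = 0
    simp [bracket]
  have h2 : replyOp (S := distScenario d I G) (H := fun a => SiteQudits I G a → ZMod d) settingOp
      (i, v) none = multiWeyl 0 :=
    (@multiWeyl_zero d _ (SiteQudits I G (i, v)) _ fun a b => Classical.propDecidable (a = b)).symm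
  change charOp P p k (i, v) none = _
  rw [charOp, h, mul_zero, AddChar.map_zero_eq_one, one_smul, h2]

/-- A Bell reply enters the corrected outcome through the bracket alone, so
`sum_stdAddChar_smul_portBell` collapses the sum to one stabiliser. -/
theorem questionSum_rootBell (hv : v = G.root) {w : G.V} (hw : G.graph.Adj v w) :
    questionSum (S := distScenario d I G) (i := (i, v)) (charOp P p k (i, v))
        (some (.rootBell hv w hw)) =
      multiWeyl (bellLabel (rootPort i hv) (halfPort i hw) (k • p)) := by
  refine Eq.trans (questionSum_some (S := distScenario d I G) (i := (i, v))
    (f := charOp P p k (i, v)) (x := .rootBell hv w hw)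
    (inst := (inferInstance : Fintype (ZMod d × ZMod d)))
    (fun o : ZMod d × ZMod d =>
    (ZMod.stdAddChar (k * -bracket d p o) : ℂ) • portBell (rootPort i hv) (halfPort i hw) o)
    fun o => ?_) (sum_stdAddChar_smul_portBell _ _ p k)
  have h : replyVal P p (a := (i, v)) (some ⟨.rootBell hv w hw, o⟩) = -bracket d p o := by
    change (if v = P.1 then 0 else 0) - bracket d p o = _
    simp
  rw [charOp, h]
  rfl

theorem questionSum_bell (hv : v ≠ G.root) {w w' : G.V} (hw : G.graph.Adj v w)
    (hw' : G.graph.Adj v w') (hne : w ≠ w') :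
    questionSum (S := distScenario d I G) (i := (i, v)) (charOp P p k (i, v))
        (some (.bell hv w w' hw hw' hne)) =
      multiWeyl (bellLabel (halfPort i hw) (halfPort i hw') (k • p)) := by
  refine Eq.trans (questionSum_some (S := distScenario d I G) (i := (i, v))
    (f := charOp P p k (i, v)) (x := .bell hv w w' hw hw' hne)
    (inst := (inferInstance : Fintype (ZMod d × ZMod d)))
    (fun o : ZMod d × ZMod d =>
    (ZMod.stdAddChar (k * -bracket d p o) : ℂ) • portBell (halfPort i hw) (halfPort i hw') o)
    fun o => ?_) (sum_stdAddChar_smul_portBell _ _ p k)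
  have h : replyVal P p (a := (i, v)) (some ⟨.bell hv w w' hw hw' hne, o⟩) = -bracket d p o := by
    change (if v = P.1 then 0 else 0) - bracket d p o = _
    simp
  rw [charOp, h]
  rfl

theorem questionSum_rootWeyl (hv : v = G.root) (hend : v = P.1) :
    questionSum (S := distScenario d I G) (i := (i, v)) (charOp P p k (i, v))
        (some (.rootWeyl hv p)) =
      weylPhase p k.val • multiWeyl (weylLabel (rootPort i hv) (k • p)) := by
  refine Eq.trans (questionSum_some (S := distScenario d I G) (i := (i, v))
    (f := charOp P p k (i, v)) (x := .rootWeyl hv p)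
    (inst := (inferInstance : Fintype (ZMod d)))
    (fun o : ZMod d =>
    (ZMod.stdAddChar (k * o) : ℂ) • portWeyl (rootPort i hv) p o)
    fun o => ?_) (sum_stdAddChar_smul_portWeyl _ p k)
  have h : ∀ o : ZMod d, replyVal P p (a := (i, v)) (some ⟨.rootWeyl hv p, o⟩) = o := by
    intro o
    change (if v = P.1 then o else 0) - bracket d p 0 = o
    simp [bracket, hend]
  refine (congrArg (fun t : ZMod d => (ZMod.stdAddChar (k * t) : ℂ) • _) (h o)).trans ?_
  rfl

theorem questionSum_weyl (hv : v ≠ G.root) {w : G.V} (hw : G.graph.Adj v w) (hend : v = P.1) :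
    questionSum (S := distScenario d I G) (i := (i, v)) (charOp P p k (i, v))
        (some (.weyl hv w hw p)) =
      weylPhase p k.val • multiWeyl (weylLabel (halfPort i hw) (k • p)) := by
  refine Eq.trans (questionSum_some (S := distScenario d I G) (i := (i, v))
    (f := charOp P p k (i, v)) (x := .weyl hv w hw p)
    (inst := (inferInstance : Fintype (ZMod d)))
    (fun o : ZMod d =>
    (ZMod.stdAddChar (k * o) : ℂ) • portWeyl (halfPort i hw) p o)
    fun o => ?_) (sum_stdAddChar_smul_portWeyl _ p k)
  have h : ∀ o : ZMod d, replyVal P p (a := (i, v)) (some ⟨.weyl hv w hw p, o⟩) = o := by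
    intro o
    change (if v = P.1 then o else 0) - bracket d p 0 = o
    simp [bracket, hend]
  refine (congrArg (fun t : ZMod d => (ZMod.stdAddChar (k * t) : ℂ) • _) (h o)).trans ?_
  rfl

omit [NeZero d] in
theorem siteLabel_rootPort (c : ZMod d × ZMod d) (hv : v = G.root) :
    siteLabel P c (i, v) (rootPort i hv) = c := rfl

omit [NeZero d] in
theorem siteLabel_halfPort (c : ZMod d × ZMod d) {w : G.V} (hw : G.graph.Adj v w) :
    siteLabel P c (i, v) (halfPort i hw) =
      if P.Precedes w v then c else if P.Precedes v w then (c.1, -c.2) else 0 := rfl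

omit [NeZero d] in
theorem weylLabel_apply {X : Type} [DecidableEq X] (o : X) (c : ZMod d × ZMod d) (x : X) :
    weylLabel o c x = if x = o then c else 0 := Pi.single_apply _ _ _

omit [NeZero d] in
theorem bellLabel_apply {X : Type} [DecidableEq X] {o o' : X} (h : o ≠ o') (c : ZMod d × ZMod d)
    (x : X) :
    bellLabel o o' c x = if x = o then c else if x = o' then (c.1, -c.2) else 0 := by
  rw [bellLabel, Pi.add_apply, Pi.single_apply, Pi.single_apply]
  by_cases h1 : x = o
  · simp [h1, h]
  · simp [h1]

/-- The sum over the replies to a question of the distributed game, weighted by a character of the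
corrected outcome, is a Weyl operator. -/
theorem questionSum_question :
    questionSum (S := distScenario d I G) (i := (i, v)) (charOp P p k (i, v)) (P.question p v) =
      (if v = P.1 then weylPhase p k.val else 1) • multiWeyl (siteLabel P (k • p) (i, v)) := by
  by_cases hv : v ∈ P.2.1.support
  · have hprec := P.precedes_iff hv
    have hprec' := P.precedes_iff' hv
    have hend : v = P.1 ↔ ¬ P.2.1.support.idxOf v < P.2.1.length := by
      constructor
      · intro h hl
        have h1 := P.getVert_idxOf hv
        have h2 : P.2.1.getVert P.2.1.length = v := by rw [SimpleGraph.Walk.getVert_length, h]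
        have := P.2.2.getVert_injOn (P.idxOf_le hv) (le_refl P.2.1.length) (h1.trans h2.symm)
        omega
      · intro h
        have h1 := P.getVert_idxOf hv
        rw [le_antisymm (P.idxOf_le hv) (not_lt.1 h), SimpleGraph.Walk.getVert_length] at h1
        exact h1.symm
    by_cases h0 : P.2.1.support.idxOf v = 0
    · have hroot := (P.idxOf_eq_zero_iff hv).1 h0
      by_cases hl : P.2.1.support.idxOf v < P.2.1.length
      · have hq : P.question p v = some (.rootBell hroot _ (P.adj_next hv hl)) := by
          simp only [RootedPath.question, dif_pos hv, dif_pos h0, dif_pos hl]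
        have hne := rootPort_ne_halfPort i hroot (P.adj_next hv hl)
        rw [hq, if_neg (fun h => hend.1 h hl), one_smul, questionSum_rootBell]
        congr 1
        -- The labels are compared qudit by qudit: `c` on the qudit of the state, `(c₁, -c₂)` on the
        -- half towards the successor, and `0` elsewhere, as the root has no predecessor.
        refine siteQudits_ext (fun _ => ?_) (fun w hw => ?_)
        · rw [bellLabel_apply hne, if_pos rfl, siteLabel_rootPort]
        · rw [bellLabel_apply hne, siteLabel_halfPort, if_neg (rootPort_ne_halfPort i hroot hw).symm,
            if_neg (fun h => (hprec' w).1 h |>.1 h0)]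
          simp only [halfPort_inj, hprec, hl, true_and]
      · have hq : P.question p v = some (.rootWeyl hroot p) := by
          simp only [RootedPath.question, dif_pos hv, dif_pos h0, dif_neg hl]
        rw [hq, if_pos (hend.2 hl), questionSum_rootWeyl P p k i hroot (hend.2 hl)]
        congr 2
        refine siteQudits_ext (fun _ => ?_) (fun w hw => ?_)
        · rw [weylLabel_apply, if_pos rfl, siteLabel_rootPort]
        · rw [weylLabel_apply, siteLabel_halfPort, if_neg (rootPort_ne_halfPort i hroot hw).symm,
            if_neg (fun h => (hprec' w).1 h |>.1 h0), if_neg (fun h => hl ((hprec w).1 h).1)]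
    · have hroot : v ≠ G.root := fun h => h0 ((P.idxOf_eq_zero_iff hv).2 h)
      by_cases hl : P.2.1.support.idxOf v < P.2.1.length
      · have hq : P.question p v = some (.bell hroot _ _ (P.adj_prev hv h0) (P.adj_next hv hl)
            (P.prev_ne_next hl)) := by
          simp only [RootedPath.question, dif_pos hv, dif_neg h0, dif_pos hl]
        have hne := halfPort_ne_halfPort i (P.adj_prev hv h0) (P.adj_next hv hl) (P.prev_ne_next hl)
        rw [hq, if_neg (fun h => hend.1 h hl), one_smul, questionSum_bell]
        congr 1
        -- At an inner node the half towards the predecessor takes the place of the qudit of the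
        -- state.
        refine siteQudits_ext (fun h => absurd h hroot) (fun w hw => ?_)
        rw [bellLabel_apply hne, siteLabel_halfPort]
        simp only [halfPort_inj, hprec, hprec', hl, h0, true_and, ne_eq, not_false_eq_true]
      · have hq : P.question p v = some (.weyl hroot _ (P.adj_prev hv h0) p) := by
          simp only [RootedPath.question, dif_pos hv, dif_neg h0, dif_neg hl]
        rw [hq, if_pos (hend.2 hl), questionSum_weyl P p k i hroot _ (hend.2 hl)]
        congr 2
        refine siteQudits_ext (fun h => absurd h hroot) (fun w hw => ?_)
        rw [weylLabel_apply, siteLabel_halfPort]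
        simp only [halfPort_inj, hprec, hprec', hl, h0, true_and, ne_eq, not_false_eq_true,
          false_and, if_false]
  · have hx : v ≠ P.1 := by
      intro h
      refine hv ?_
      rw [h]
      exact SimpleGraph.Walk.end_mem_support _
    -- Sites off the path are not measured, and none of their qudits belongs to an edge of the path.
    -- The qudit of the state is not among them either, since the root is on every path.
    rw [P.question_of_notMem p hv, if_neg hx, one_smul, questionSum_none]
    congr 1
    refine siteQudits_ext (fun h => absurd ?_ hv) (fun w hw => ?_)
    · rw [h]
      exact SimpleGraph.Walk.start_mem_support _
    rw [siteLabel_halfPort, if_neg (fun h => hv h.right_mem), if_neg (fun h => hv h.left_mem)]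
    rfl

end

end Measure

/-! ## Teleportation -/

section Statistics

variable {d : ℕ} [NeZero d] {I : Type} [Fintype I] {G : RootedGraph}

/-- The state of the distributed strategy: `ψ` at the root, and Bell pairs along the edges. -/
def distState (G : RootedGraph) (ψ : (I → ZMod d) → ℂ) :
    ((a : I × G.V) → (SiteQudits I G a → ZMod d)) → ℂ :=
  partitionState Register.site Register.part (partState G ψ)

/-- The behaviour of the distributed strategy. -/
def distBehaviour (G : RootedGraph) (ψ : (I → ZMod d) → ℂ) : Behaviour (distScenario d I G) :=
  quantumBehaviour (distScenario d I G) (H := fun a => SiteQudits I G a → ZMod d) settingOp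
    (distState G ψ)

omit [NeZero d] in
theorem bracket_sum {ι : Type} (s : Finset ι) (p : ZMod d × ZMod d) (f : ι → ZMod d × ZMod d) :
    bracket d p (∑ i ∈ s, f i) = ∑ i ∈ s, bracket d p (f i) := by
  simp only [bracket, Prod.fst_sum, Prod.snd_sum, Finset.mul_sum, Finset.sum_sub_distrib]

/-- Linearity of the bracket makes the corrected outcome a sum of contributions of single sites, so
its characters are products over the sites. -/
theorem distOutcome_eq_sum (P : I → RootedPath G) (p : I → ZMod d × ZMod d)
    (s : LocalSection (distScenario d I G) (distContext P p)) (i : I) :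
    distOutcome P p s i = ∑ v : G.V, replyVal (P i) (p i) (s.reply (i, v)) := by
  simp only [replyVal, Finset.sum_sub_distrib]
  rw [distOutcome, bracket_sum]
  congr 1
  rw [Finset.sum_eq_single (P i).1]
  · simp
  · intro v _ hv
    exact if_neg hv
  · simp

omit [NeZero d] in
theorem siteLabel_eq (P : I → RootedPath G) (c : I → ZMod d × ZMod d) (a : I × G.V) :
    siteLabel (P a.1) (c a.1) a =
      fun q : SiteQudits I G a => (P q.1.player).label (c q.1.player) q.1.half := by
  funext ⟨q, hq⟩
  have hs : q.site = a := by simpa using hq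
  subst hs
  rfl

/-- The local operators assemble to one Weyl operator of the register that satisfies the hypotheses
of `expect_register`. The Bell pairs drop out, and each player's last node supplies one phase. -/
theorem expect_charOp (ψ : (I → ZMod d) → ℂ) (P : I → RootedPath G) (p : I → ZMod d × ZMod d)
    (k : I → ZMod d) :
    tensorExpect (distState G ψ) (fun a : (distScenario d I G).Site =>
      questionSum (S := distScenario d I G) (i := a) (charOp (P a.1) (p a.1) (k a.1) a)
        (distContext P p a)) =
      (∏ i, weylPhase (p i) (k i).val) * expect ψ (multiWeyl fun i => k i • p i) := by
  have h1 : (fun a : (distScenario d I G).Site => questionSum (S := distScenario d I G) (i := a)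
      (charOp (P a.1) (p a.1) (k a.1) a) (distContext P p a)) =
      fun a => (if a.2 = (P a.1).1 then weylPhase (p a.1) (k a.1).val else 1) •
        multiWeyl fun q : SiteQudits I G a =>
          (P q.1.player).label (k q.1.player • p q.1.player) q.1.half := by
    funext a
    rw [← siteLabel_eq P (fun i => k i • p i) a]
    exact questionSum_question (P a.1) (p a.1) (k a.1) a.1
  rw [h1, tensorExpect_smul]
  congr 1
  · refine (Fintype.prod_prod_type _).trans (Finset.prod_congr rfl fun i _ => ?_)
    simp
  · exact expect_register (A := (distScenario d I G).Site) Register.site ψ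
      (fun q => (P q.player).label (k q.player • p q.player) q.half)
      (fun i e => (P i).label_symm_fst _ e) (fun i e => (P i).label_symm_snd _ e)

/-- The corrected outcomes have the statistics of the Weyl measurements of `ψ`. -/
theorem valueSum_distBehaviour (ψ : (I → ZMod d) → ℂ) (P : I → RootedPath G)
    (p : I → ZMod d × ZMod d) (t : I → ZMod d) :
    valueSum (S := distScenario d I G) (distOutcome P p) (distBehaviour G ψ (distContext P p)) t =
      weylProb ψ p t := by
  have hchar : ∀ (s : LocalSection (distScenario d I G) (distContext P p)) (k : I → ZMod d),
      (ZMod.stdAddChar (∑ i, k i * (distOutcome P p s i - t i)) : ℂ) =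
      ZMod.stdAddChar (-∑ i, k i * t i) * ∏ a : (distScenario d I G).Site,
        (ZMod.stdAddChar (k a.1 * replyVal (P a.1) (p a.1) (s.reply a)) : ℂ) := by
    intro s k
    rw [← stdAddChar_sum, ← AddChar.map_add_eq_mul]
    congr 1
    have : ∑ a : (distScenario d I G).Site, k a.1 * replyVal (P a.1) (p a.1) (s.reply a) =
        ∑ i, k i * distOutcome P p s i := by
      refine (Fintype.sum_prod_type _).trans (Finset.sum_congr rfl fun i _ => ?_)
      rw [distOutcome_eq_sum, Finset.mul_sum]
    rw [this]
    simp only [mul_sub, Finset.sum_sub_distrib]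
    ring
  have hval : ∀ s : LocalSection (distScenario d I G) (distContext P p),
      ((d : ℂ)⁻¹ ^ Fintype.card I *
        ∑ k : I → ZMod d, ZMod.stdAddChar (∑ i, k i * (distOutcome P p s i - t i))) *
        (distBehaviour G ψ (distContext P p) s : ℂ) =
      ((d : ℂ)⁻¹) ^ Fintype.card I * ∑ k : I → ZMod d, ZMod.stdAddChar (-∑ i, k i * t i) *
        ((∏ a : (distScenario d I G).Site,
          (ZMod.stdAddChar (k a.1 * replyVal (P a.1) (p a.1) (s.reply a)) : ℂ)) *
          (distBehaviour G ψ (distContext P p) s : ℂ)) := by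
    intro s
    rw [mul_assoc, Finset.sum_mul]
    congr 1
    refine Finset.sum_congr rfl fun k _ => ?_
    rw [hchar, mul_assoc]
  apply Complex.ofReal_injective
  rw [weylProb_eq_sum]
  -- The event that the corrected outcomes equal `t` is expanded in characters; afterwards the two
  -- sides agree term by term in `k`.
  refine (ofReal_valueSum (S := distScenario d I G) (distOutcome P p)
    (distBehaviour G ψ (distContext P p)) (w := fun t' => (d : ℂ)⁻¹ ^ Fintype.card I *
      ∑ k : I → ZMod d, ZMod.stdAddChar (∑ i, k i * (t' i - t i))) ?_ ?_).trans ?_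
  · rw [← ite_eq_sum_stdAddChar, if_pos rfl]
  · intro t' ht
    rw [← ite_eq_sum_stdAddChar, if_neg ht]
  refine (Finset.sum_congr rfl fun s _ => hval s).trans ?_
  rw [← Finset.mul_sum]
  congr 1
  rw [Finset.sum_comm]
  refine Finset.sum_congr rfl fun k _ => ?_
  rw [← Finset.mul_sum, ← expect_charOp ψ P p k]
  congr 1
  exact sum_char_mul_quantumBehaviour (S := distScenario d I G) settingOp
    isProjectiveMeasurement_settingOp (distState G ψ) (distContext P p)
    fun a r => (ZMod.stdAddChar (k a.1 * replyVal (P a.1) (p a.1) r) : ℂ)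

/-- Acceptance depends only on the corrected outcomes, whose law does not depend on the paths, so
averaging over the paths changes nothing. -/
theorem successProb_distBehaviour (ψ : (I → ZMod d) → ℂ) (u : PathDistribution G)
    (Φ : Game (weylScenario d I)) :
    successProb (distBehaviour G ψ) (distributedGame u Φ) =
      successProb (weylBehaviour d I ψ) Φ := by
  rw [successProb_distributedGame, successProb_eq]
  have h : ∀ (P : I → RootedPath G) k, acceptSum (pathAcc Φ P k)
      (distBehaviour G ψ (distContext P (fullSetting (Φ.ctx k)))) =
      acceptSum (Φ.acc k) (weylBehaviour d I ψ (Φ.ctx k)) := by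
    intro P k
    rw [acceptSum_weylBehaviour]
    refine (acceptSum_preimage (S := distScenario d I G) (distOutcome P (fullSetting (Φ.ctx k)))
      {t | (fun i _ _ => t i) ∈ Φ.acc k} _).trans ?_
    refine Finset.sum_congr rfl fun t _ => ?_
    rw [valueSum_distBehaviour]
    rfl
  simp only [h]
  rw [← Finset.sum_mul, sum_prod_pathWeight, one_mul]

theorem isNonlocalGame_distributedGame {Φ : Game (weylScenario d I)} {ψ : (I → ZMod d) → ℂ} {γ : ℝ}
    (hΦ : IsWeylGame d Φ ψ γ) (u : PathDistribution G) :
    IsNonlocalGame (distributedGame u Φ) γ := by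
  refine ⟨classicalBound_distributedGame hΦ.bound u, fun a => SiteQudits I G a → ZMod d,
    fun _ => inferInstance, settingOp, distState G ψ, isProjectiveMeasurement_settingOp,
    isState_partitionState (S := (distScenario d I G).Site) _ _ _ fun t =>
      isState_partState hΦ.state t, ?_⟩
  exact hΦ.violation.trans_eq (successProb_distBehaviour ψ u Φ).symm

end Statistics

/-! ## Two-layer quantum circuits -/

theorem QuantumCircuit.layer_of_covered {S : Scenario} {d : ℕ} [NeZero d] (F : QuantumCircuit S d)
    (x : ∀ i, Question S i) (a : ∀ g, F.Val g) {k : ℕ}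
    (h : ∀ q, ∃ g, F.graph.time g = k ∧ q ∈ F.graph.acts g) (b b' : F.Q → ZMod d) :
    F.layer x a k b b' = ∏ g : F.graph.Gate, if F.graph.time g = k then
      F.op g (fun n => F.graph.nodeVal x a n) (a g) (fun q => b q) (fun q => b' q) else 1 := by
  rw [QuantumCircuit.layer, if_pos, mul_one]
  intro q hq
  obtain ⟨g, h1, h2⟩ := h q
  exact absurd h2 (hq g h1)

theorem QuantumCircuit.outProb_of_unique {S : Scenario} {d : ℕ} [NeZero d] (F : QuantumCircuit S d)
    (x : ∀ i, Question S i) (y : ∀ i, Reply S i) (a : ∀ g, F.Val g)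
    (ha : ∀ a', (∀ j, F.decode j (F.graph.nodeVal x a' (F.graph.out j)) = y j) ↔ a' = a) :
    F.outProb x y = ∑ b, ‖F.state x a (Finset.univ.sup F.graph.time + 1) b‖ ^ 2 := by
  simp only [QuantumCircuit.outProb, ha]
  rw [Finset.sum_ite_eq' Finset.univ a, if_pos (Finset.mem_univ _)]

/-- Every edge strictly increases the schedule time, so a schedule with times `0` and `1` forces
depth at most two. -/
theorem CircuitGraph.PathTo.le_time {Wire Q : Type} {F : CircuitGraph Wire Q} {n : ℕ} {g : F.Gate}
    (h : F.PathTo n g) : n ≤ F.time g + 1 := by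
  induction h with
  | input _ => omega
  | qudit _ => omega
  | step _ e ih =>
    have : F.time _ < F.time _ := e.elim (F.reads_earlier _ _) And.left
    omega

/-- Every state is the first column of a unitary matrix. -/
theorem exists_unitary_column {B : Type} [Fintype B] [DecidableEq B] {φ : B → ℂ} (hφ : IsState φ)
    (b₀ : B) : ∃ U ∈ Matrix.unitaryGroup B ℂ, ∀ b, U b b₀ = φ b := by
  -- A single unit vector is an orthonormal family indexed by `{b₀}`. An extension to an orthonormal
  -- basis indexed by `B` supplies the remaining columns.
  have hv : Orthonormal ℂ (({b₀} : Set B).domRestrict fun _ => (WithLp.toLp 2 φ : EuclideanSpace ℂ B)) := by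
    refine ⟨fun i => ?_, fun i j hij => absurd (Subsingleton.elim i j) hij⟩
    rw [Set.domRestrict_apply, EuclideanSpace.norm_eq]
    simp only
    rw [show ∑ i, ‖φ i‖ ^ 2 = 1 from hφ, Real.sqrt_one]
  obtain ⟨b, hb⟩ := hv.exists_orthonormalBasis_extension_of_card_eq (by simp)
  refine ⟨(EuclideanSpace.basisFun B ℂ).toBasis.toMatrix b,
    OrthonormalBasis.toMatrix_orthonormalBasis_mem_unitary _ _, fun i => ?_⟩
  rw [Module.Basis.toMatrix_apply, hb b₀ rfl]
  simp

/-- A first layer of gates acts on the parts, and a second one on the sites. The gate at a site reads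
the input of the site and gives its output. -/
def twoLayerGraph {W Q T : Type} [Fintype W] [Fintype Q] [Fintype T] (site : Q → W) (part : Q → T) :
    CircuitGraph W Q where
  Gate := T ⊕ W
  time := Sum.elim (fun _ => 0) (fun _ => 1)
  reads := Sum.elim (fun _ => ∅) (fun a => {Sum.inl a})
  acts := Sum.elim (fiber part) (fiber site)
  out a := .inr (.inr a)
  reads_earlier := by
    rintro (t | a) g' h
    · simp at h
    · simp at h
  acts_disjoint := by
    have key : ∀ {Y : Type} (f : Q → Y) (y y' : Y), y ≠ y' → Disjoint (fiber f y) (fiber f y') := by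
      intro Y f y y' h
      rw [Finset.disjoint_left]
      intro q hq hq'
      simp only [Finset.mem_filter, Finset.mem_univ, true_and] at hq hq'
      exact h (hq.symm.trans hq')
    rintro (t | a) (t' | a') hne ht
    · exact key part t t' fun h => hne (congrArg _ h)
    · simp at ht
    · simp at ht
    · exact key site a a' fun h => hne (congrArg _ h)

section

variable {W Q T : Type} [Fintype W] [Fintype Q] [Fintype T] (site : Q → W) (part : Q → T)

theorem twoLayerGraph_depthLE : (twoLayerGraph site part).DepthLE 2 := by
  rintro j (t | a) n - h
  · exact h.le_time.trans (Nat.le_succ _)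
  · exact h.le_time

theorem twoLayerGraph_fanInLE {K : ℕ} (h1 : ∀ a, (fiber site a).card ≤ K)
    (h2 : ∀ t, (fiber part t).card ≤ K) : (twoLayerGraph site part).FanInLE (K + 1) := by
  rintro (t | a)
  · change (∅ : Finset (W ⊕ (T ⊕ W))).card + (fiber part t).card ≤ K + 1
    have := h2 t
    rw [Finset.card_empty]
    omega
  · change ({Sum.inl a} : Finset (W ⊕ (T ⊕ W))).card + (fiber site a).card ≤ K + 1
    have := h1 a
    rw [Finset.card_singleton]
    omega

end

section

variable {S : Scenario} {d : ℕ} [NeZero d] {Q T : Type} [Fintype Q] [Fintype T]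
  {site : Q → S.Site}

/-- The measurement of a site as an operation on questions and replies. -/
def gateOp (π : (i : S.Site) → (x : S.Setting i) → S.Outcome i x →
      Matrix (fiber site i → ZMod d) (fiber site i → ZMod d) ℂ) (i : S.Site) (x : Question S i)
    (y : Reply S i) : Matrix (fiber site i → ZMod d) (fiber site i → ZMod d) ℂ :=
  if y.map Sigma.fst = x then
    replyOp (H := fun i => fiber site i → ZMod d) π i y
  else 0

/-- The gate has all replies as formal outcomes. Those that do not fit the question get the
projector `0`, so completeness reduces to that of the measurement asked for, or to the identity on
input `•`. -/
theorem isProjectiveMeasurement_gateOp {π : (i : S.Site) → (x : S.Setting i) → S.Outcome i x →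
      Matrix (fiber site i → ZMod d) (fiber site i → ZMod d) ℂ}
    (hπ : ∀ i x, IsProjectiveMeasurement (π i x)) (i : S.Site) (x : Question S i) :
    IsProjectiveMeasurement (gateOp π i x) := by
  constructor
  · intro y
    rw [gateOp]
    split_ifs
    · exact isStarProjection_replyOp hπ i y
    · exact IsStarProjection.zero _
  · cases x with
    | none =>
      rw [Fintype.sum_option]
      simp [gateOp, replyOp]
    | some x =>
      rw [Fintype.sum_option, Fintype.sum_sigma, Finset.sum_eq_single x, ← (hπ i x).2]
      · simp [gateOp, replyOp]
      · intro x' _ hx'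
        simp [gateOp, hx']
      · simp

/-- The circuit that prepares the states `φ` and performs the measurements `π`. -/
def twoLayerCircuit (part : Q → T) (φ : ∀ t, (fiber part t → ZMod d) → ℂ) (hφ : ∀ t, IsState (φ t))
    (π : (i : S.Site) → (x : S.Setting i) → S.Outcome i x →
      Matrix (fiber site i → ZMod d) (fiber site i → ZMod d) ℂ)
    (hπ : ∀ i x, IsProjectiveMeasurement (π i x)) : QuantumCircuit S d where
  Q := Q
  graph := twoLayerGraph site part
  Val g := match g with
    | .inl _ => Unit
    | .inr a => Reply S a
  valFintype g := match g with
    | .inl _ => inferInstanceAs (Fintype Unit)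
    | .inr a => inferInstanceAs (Fintype (Reply S a))
  op g := match g with
    | .inl t => fun _ _ => Classical.choose (exists_unitary_column (hφ t) 0)
    | .inr a => fun c y => gateOp π a (c ⟨.inl a, Finset.mem_singleton_self _⟩) y
  op_spec g := match g with
    | .inl t => .inl ⟨⟨inferInstanceAs (Unique Unit)⟩, fun _ _ =>
        (Classical.choose_spec (exists_unitary_column (hφ t) 0)).1⟩
    | .inr a => .inr fun _ => isProjectiveMeasurement_gateOp hπ a _
  decode _ y := y


variable (part : Q → T) {φ : ∀ t, (fiber part t → ZMod d) → ℂ} (hφ : ∀ t, IsState (φ t))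
  {π : (i : S.Site) → (x : S.Setting i) → S.Outcome i x →
      Matrix (fiber site i → ZMod d) (fiber site i → ZMod d) ℂ}
  (hπ : ∀ i x, IsProjectiveMeasurement (π i x))

theorem twoLayerCircuit_layer_zero (x : ∀ i, Question S i)
    (a : ∀ g, (twoLayerCircuit part φ hφ π hπ).Val g) (b : Q → ZMod d) :
    (twoLayerCircuit part φ hφ π hπ).layer x a 0 b 0 =
      productState φ ((glue part (ZMod d)).symm b) := by
  refine (QuantumCircuit.layer_of_covered _ x a (fun q => ⟨.inl (part q), rfl,
    Finset.mem_filter.2 ⟨Finset.mem_univ _, rfl⟩⟩) b 0).trans ((Fintype.prod_sum_type _).trans ?_)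
  rw [Finset.prod_eq_one (s := Finset.univ (α := S.Site)), mul_one]
  · refine Finset.prod_congr rfl fun t _ => ?_
    exact (if_pos rfl).trans ((Classical.choose_spec (exists_unitary_column (hφ t) 0)).2 _)
  · intro i _
    exact if_neg Nat.one_ne_zero

theorem twoLayerCircuit_layer_one (x : ∀ i, Question S i)
    (a : ∀ g, (twoLayerCircuit part φ hφ π hπ).Val g) (b b' : Q → ZMod d) :
    (twoLayerCircuit part φ hφ π hπ).layer x a 1 b b' =
      tensor (fun i => gateOp π i (x i) (a (.inr i))) ((glue site (ZMod d)).symm b)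
        ((glue site (ZMod d)).symm b') := by
  refine (QuantumCircuit.layer_of_covered _ x a (fun q => ⟨.inr (site q), rfl,
    Finset.mem_filter.2 ⟨Finset.mem_univ _, rfl⟩⟩) b b').trans ((Fintype.prod_sum_type _).trans ?_)
  rw [Finset.prod_eq_one (s := Finset.univ (α := T)), one_mul]
  · exact Finset.prod_congr rfl fun i _ => if_pos rfl
  · intro t _
    exact if_neg Nat.zero_ne_one

theorem twoLayerCircuit_state_one (x : ∀ i, Question S i)
    (a : ∀ g, (twoLayerCircuit part φ hφ π hπ).Val g) (b : Q → ZMod d) :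
    (twoLayerCircuit part φ hφ π hπ).state x a 1 b =
      productState φ ((glue part (ZMod d)).symm b) := by
  rw [← twoLayerCircuit_layer_zero part hφ hπ x a b]
  change ((twoLayerCircuit part φ hφ π hπ).layer x a 0).mulVec (Pi.single 0 1) b = _
  rw [Matrix.mulVec_single_one]
  rfl

theorem twoLayerCircuit_state_two (x : ∀ i, Question S i)
    (a : ∀ g, (twoLayerCircuit part φ hφ π hπ).Val g) (b : Q → ZMod d) :
    (twoLayerCircuit part φ hφ π hπ).state x a 2 b =
      (tensor fun i => gateOp π i (x i) (a (.inr i))).mulVec (partitionState site part φ)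
        ((glue site (ZMod d)).symm b) := by
  change ((twoLayerCircuit part φ hφ π hπ).layer x a 1).mulVec
    ((twoLayerCircuit part φ hφ π hπ).state x a 1) b = _
  simp only [Matrix.mulVec, dotProduct]
  refine Eq.trans ?_ (Equiv.sum_comp (glue site (ZMod d)).symm _)
  refine Finset.sum_congr rfl fun b' _ => ?_
  refine (congrArg₂ (· * ·) (twoLayerCircuit_layer_one part hφ hπ x a b b')
    (twoLayerCircuit_state_one part hφ hπ x a b')).trans ?_
  have e : glue site (ZMod d) ((glue site (ZMod d)).symm b') = b' := Equiv.apply_symm_apply _ _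
  exact congrArg (fun z => tensor (fun i => gateOp π i (x i) (a (.inr i)))
    ((glue site (ZMod d)).symm b) ((glue site (ZMod d)).symm b') *
      productState φ ((glue part (ZMod d)).symm z)) e.symm

theorem twoLayerCircuit_state_sup (x : ∀ i, Question S i)
    (a : ∀ g, (twoLayerCircuit part φ hφ π hπ).Val g) :
    (twoLayerCircuit part φ hφ π hπ).state x a
        (Finset.univ.sup (twoLayerCircuit part φ hφ π hπ).graph.time + 1) =
      (twoLayerCircuit part φ hφ π hπ).state x a 2 := by
  have hle : Finset.univ.sup (twoLayerCircuit part φ hφ π hπ).graph.time ≤ 1 := by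
    refine Finset.sup_le ?_
    rintro (t | i) -
    · exact Nat.zero_le _
    · exact le_rfl
  by_cases hS : Nonempty S.Site
  · obtain ⟨i⟩ := hS
    have hge : 1 ≤ Finset.univ.sup (twoLayerCircuit part φ hφ π hπ).graph.time :=
      Finset.le_sup (f := (twoLayerCircuit part φ hφ π hπ).graph.time)
        (b := (.inr i : T ⊕ S.Site)) (Finset.mem_univ _)
    rw [le_antisymm hle hge]
  -- Without sites there are no gates at time `1` and the last time may be `0`. The second layer is
  -- then an empty tensor product, so stopping earlier makes no difference.
  · have hone : (twoLayerCircuit part φ hφ π hπ).state x a 2 =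
        (twoLayerCircuit part φ hφ π hπ).state x a 1 := by
      have : IsEmpty S.Site := not_nonempty_iff.1 hS
      funext b
      refine (twoLayerCircuit_state_two part hφ hπ x a b).trans
        (Eq.trans ?_ (twoLayerCircuit_state_one part hφ hπ x a b).symm)
      have : Unique (∀ i, (fiber site i → ZMod d)) := Pi.uniqueOfIsEmpty _
      rw [Matrix.mulVec, dotProduct, Fintype.sum_unique, tensor, Finset.univ_eq_empty,
        Finset.prod_empty, one_mul, partitionState]
      congr 2
      exact (Equiv.eq_symm_apply (glue site (ZMod d))).1 (Subsingleton.elim _ _)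
    rcases Nat.le_one_iff_eq_zero_or_eq_one.1 hle with h | h
    · rw [h, hone]
    · rw [h]

/-- The measurement results are output unchanged and the preparation gates have only the trivial
result, so exactly one run of the circuit yields `y`. -/
theorem twoLayerCircuit_outProb (x : ∀ i, Question S i) (y : ∀ i, Reply S i) :
    (twoLayerCircuit part φ hφ π hπ).outProb x y =
      ∑ b, ‖(tensor fun i => gateOp π i (x i) (y i)).mulVec (partitionState site part φ) b‖ ^ 2 := by
  have ha : ∀ a' : (g : (twoLayerCircuit part φ hφ π hπ).graph.Gate) →
      (twoLayerCircuit part φ hφ π hπ).Val g,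
      (∀ j, (twoLayerCircuit part φ hφ π hπ).decode j ((twoLayerCircuit part φ hφ π hπ).graph.nodeVal
        x a' ((twoLayerCircuit part φ hφ π hπ).graph.out j)) = y j) ↔
      a' = fun g => match g with
        | .inl _ => ()
        | .inr i => y i := by
    intro a'
    constructor
    · intro h
      funext g
      rcases g with t | i
      · rfl
      · exact h i
    · rintro rfl j
      rfl
  rw [QuantumCircuit.outProb_of_unique _ x y _ ha, twoLayerCircuit_state_sup]
  refine Eq.trans ?_ (Equiv.sum_comp (glue site (ZMod d)).symm _)
  refine Finset.sum_congr rfl fun b _ => ?_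
  exact congrArg (fun z : ℂ => ‖z‖ ^ 2) (twoLayerCircuit_state_two part hφ hπ x _ b)

theorem twoLayerCircuit_wellTyped : WellTyped (twoLayerCircuit part φ hφ π hπ).outProb := by
  intro C y h i
  by_contra hi
  refine h ?_
  rw [twoLayerCircuit_outProb]
  have : (tensor fun i => gateOp π i (C i) (y i)) = 0 := by
    ext b b'
    refine Finset.prod_eq_zero (Finset.mem_univ i) ?_
    simp [gateOp, hi]
  simp [this]

theorem twoLayerCircuit_behaviour :
    circuitBehaviour (twoLayerCircuit part φ hφ π hπ).outProb =
      quantumBehaviour S (H := fun i => fiber site i → ZMod d) π (partitionState site part φ) := by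
  funext C s
  rw [circuitBehaviour, twoLayerCircuit_outProb, quantumBehaviour_eq]
  have : ∀ i, gateOp π i (C i) (s.reply i) =
      replyOp (H := fun i => fiber site i → ZMod d) π i (s.reply i) :=
    fun i => if_pos (s.reply_map_fst i)
  simp only [this]

end

/-! ## The shallow quantum strategy -/

section

variable {d : ℕ} [NeZero d] {I : Type} [Fintype I] {G : RootedGraph}

/-- A part is either `ψ`, with one qudit per player, or a Bell pair, with two; the bound is the sum
of both. -/
theorem card_fiber_part_le (t : Option (I × G.graph.edgeSet)) :
    (fiber (Register.part (I := I) (G := G)) t).card ≤ Fintype.card I + 2 := by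
  rcases t with _ | ⟨i, ⟨e, he⟩⟩
  · refine le_add_right (le_of_eq ?_)
    rw [← Fintype.card_coe]
    exact (Fintype.card_congr (fiberNoneEquiv I G)).symm
  · refine le_add_left ?_
    induction e using Sym2.ind with
    | _ v w =>
      let f : G.graph.Dart := ⟨(v, w), he⟩
      have : fiber (Register.part (I := I) (G := G)) (some (i, ⟨s(v, w), he⟩)) ⊆
          {⟨i, some f⟩, ⟨i, some f.symm⟩} := by
        rintro ⟨j, _ | f'⟩ hq
        · simp [Register.part] at hq
        · simp only [Register.part, Finset.mem_filter, Finset.mem_univ, true_and, Option.map_some,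
            Option.some.injEq, Prod.mk.injEq, Subtype.ext_iff] at hq
          obtain ⟨rfl, hf⟩ := hq
          have hf : f'.edge = f.edge := hf
          rcases (SimpleGraph.dart_edge_eq_iff f' f).1 hf with rfl | rfl <;> simp
      exact (Finset.card_le_card this).trans Finset.card_le_two

theorem card_fiber_site_le (a : I × G.V) :
    (fiber (Register.site (I := I) (G := G)) a).card ≤ G.graph.degree a.2 + 1 := by
  rw [← SimpleGraph.card_neighborFinset_eq_degree, ← Finset.card_insertNone]
  -- A qudit at a given site is identified by the far end of its edge, or by `none` for the qudit of
  -- the state. This gives the degree plus one.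
  refine Finset.card_le_card_of_injOn (fun q => q.half.map fun e => e.snd) ?_ ?_
  · rintro ⟨i, _ | e⟩ hq
    · simp
    · have hs : (i, e.fst) = a := by simpa [Register.site] using hq
      subst hs
      simp
  · rintro ⟨i, h⟩ hq ⟨j, h'⟩ hq' heq
    have hs : Register.site ⟨i, h⟩ = a := by simpa using hq
    have hs' : Register.site ⟨j, h'⟩ = a := by simpa using hq'
    have hij : i = j := congrArg Prod.fst (hs.trans hs'.symm)
    have hv := congrArg Prod.snd (hs.trans hs'.symm)
    subst hij
    rcases h with _ | e <;> rcases h' with _ | e'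
    · rfl
    · simp at heq
    · simp at heq
    · have hsnd : e.snd = e'.snd := by simpa using heq
      have : e = e' := SimpleGraph.Dart.ext _ _ (Prod.ext hv hsnd)
      rw [this]

/-- The circuit that prepares `ψ` at the root and Bell pairs along the edges in its first layer, and
measures the qudits of every site in its second layer. -/
def distCircuit (G : RootedGraph) {ψ : (I → ZMod d) → ℂ} (hψ : IsState ψ) :
    QuantumCircuit (distScenario d I G) d :=
  twoLayerCircuit (S := distScenario d I G) (site := Register.site) Register.part (partState G ψ)
    (fun t => isState_partState hψ t) settingOp isProjectiveMeasurement_settingOp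

theorem distCircuit_wellTyped {ψ : (I → ZMod d) → ℂ} (hψ : IsState ψ) :
    WellTyped (distCircuit G hψ).outProb :=
  twoLayerCircuit_wellTyped (S := distScenario d I G) _ _ _

theorem distCircuit_behaviour {ψ : (I → ZMod d) → ℂ} (hψ : IsState ψ) :
    circuitBehaviour (distCircuit G hψ).outProb = distBehaviour G ψ :=
  twoLayerCircuit_behaviour (S := distScenario d I G) _ _ _

theorem distCircuit_depthLE {ψ : (I → ZMod d) → ℂ} (hψ : IsState ψ) :
    (distCircuit G hψ).graph.DepthLE 2 :=
  twoLayerGraph_depthLE (W := (distScenario d I G).Site) _ _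

theorem distCircuit_fanInLE {ψ : (I → ZMod d) → ℂ} (hψ : IsState ψ) {Δ : ℕ}
    (hΔ : ∀ v, G.graph.degree v ≤ Δ) :
    (distCircuit G hψ).graph.FanInLE (Fintype.card I + Δ + 2 + 1) := by
  refine twoLayerGraph_fanInLE (W := (distScenario d I G).Site) _ _ (fun a => ?_) fun t => ?_
  · have h1 := card_fiber_site_le a
    have h2 := hΔ a.2
    exact h1.trans (by omega)
  · have := card_fiber_part_le t
    exact this.trans (by omega)

end

end ShallowGames

end

/-! ### The main theorem -/

open scoped Classical in
theorem mainTheorem2 (d : ℕ) [NeZero d] (hd : 2 ≤ d) (I : Type) [Fintype I]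
    (Φ : ShallowGames.Game (ShallowGames.weylScenario d I)) (ψ : (I → ZMod d) → ℂ) (γ : ℝ)
    (hΦ : ShallowGames.IsWeylGame d Φ ψ γ)
    (G : ℕ → ShallowGames.RootedGraph)
    (hdeg : ∃ Δ : ℕ, ∀ (n : ℕ) (v : (G n).V), (G n).graph.degree v ≤ Δ)
    (hrad : Filter.Tendsto (fun n => ((G n).rad : ℝ) / ((G n).size : ℝ)) Filter.atTop (nhds 0)) :
    (∀ n, Nonempty (ShallowGames.PathDistribution (G n))) ∧
    ∀ u : (n : ℕ) → ShallowGames.PathDistribution (G n),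
      (∀ n, ShallowGames.IsNonlocalGame (ShallowGames.distributedGame (u n) Φ) γ) ∧
      (∃ Q : (n : ℕ) → ShallowGames.QuantumCircuit (ShallowGames.distScenario d I (G n)) d,
        (∀ n, ShallowGames.WellTyped (Q n).outProb) ∧
        ShallowGames.Shallow (fun n => (Q n).graph) ∧
        ∀ n,
          ShallowGames.successProb (ShallowGames.circuitBehaviour (Q n).outProb)
              (ShallowGames.distributedGame (u n) Φ) =
            ShallowGames.successProb (ShallowGames.weylBehaviour d I ψ) Φ ∧
          γ < ShallowGames.successProb (ShallowGames.circuitBehaviour (Q n).outProb)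
              (ShallowGames.distributedGame (u n) Φ)) ∧
      (∀ C : (n : ℕ) → ShallowGames.ClassicalCircuit (ShallowGames.distScenario d I (G n)),
        (∀ n, ShallowGames.WellTyped (C n).outProb) →
        ShallowGames.Shallow (fun n => (C n).graph) →
        ∃ ε : ℕ → ℝ,
          ε =O[Filter.atTop] (fun n => ((G n).rad : ℝ) / ((G n).size : ℝ)) ∧
          Filter.Tendsto ε Filter.atTop (nhds 0) ∧
          ∀ n,
            ShallowGames.successProb (ShallowGames.circuitBehaviour (C n).outProb)
              (ShallowGames.distributedGame (u n) Φ) ≤ γ + ε n) := by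
  obtain ⟨Δ, hΔ⟩ := hdeg
  refine ⟨fun n => ShallowGames.nonempty_pathDistribution (G n), fun u =>
    ⟨fun n => ShallowGames.isNonlocalGame_distributedGame hΦ (u n),
      ⟨fun n => ShallowGames.distCircuit (G n) hΦ.state,
        fun n => ShallowGames.distCircuit_wellTyped hΦ.state,
        ⟨_, 2, fun n => ⟨ShallowGames.distCircuit_depthLE hΦ.state,
          ShallowGames.distCircuit_fanInLE hΦ.state (hΔ n)⟩⟩, fun n => ?_⟩, ?_⟩⟩
  · have h := ShallowGames.successProb_distBehaviour ψ (u n) Φ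
    rw [ShallowGames.distCircuit_behaviour, h]
    exact ⟨rfl, hΦ.violation⟩
  · rintro C - ⟨K, D, hC⟩
    -- The crosstalk bound itself serves as the error: its constant involves only the number of
    -- players, the fan-in `K` and the depth `D`, none of which depends on `n`.
    refine ⟨fun n => (Fintype.card I : ℝ) ^ 2 * (K + 1) ^ D * (((G n).rad : ℝ) / (G n).size),
      Asymptotics.isBigO_const_mul_self _ _ _, ?_, fun n => ?_⟩
    · simpa using hrad.const_mul ((Fintype.card I : ℝ) ^ 2 * (K + 1) ^ D)
    · have h := ShallowGames.sum_crosstalk_le (u n) (C n).graph (hC n).2 (hC n).1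
      exact (ShallowGames.successProb_le_add_crosstalk hΦ.bound (u n) (C n)).trans (by gcongr)
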